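/- Let $K\subset\mathbb R$ be a real quadratic field of discriminant $D$ with conjugation $x\mapsto x'$, let $\mathfrak a$ be a nonzero fractional ideal of $K$ with norm $N(\mathfrak a)$, let $m\ge 1$ be an integer and $s\in\mathbb C$ with $\operatorname{Re}(s)>1$. Let $\Gamma(\mathfrak a)\subset \mathrm{SL}_2(K)$ be the group of matrices of determinant $1$ with diagonal entries in $\mathcal O_K$, upper right entry in $\mathfrak a^{-1}$ and lower left entry in $\mathfrak a$. It acts on $\mathbb H^2$ by $M(z_1,z_2)=(Mz_1,M'z_2)$; put $X(\mathfrak a)=\Gamma(\mathfrak a)\backslash\mathbb H^2$. Let $\eta_j=\frac{1}{4\pi}\frac{dx_j\,dy_j}{y_j^2}$ and $\omega=\eta_1+\eta_2$, so that $\omega^2=2\,\eta_1\eta_2$. Let $V$ be the rational quadratic space of matrices $A=\begin{pmatrix}a&\lambda'\\ \lambda&b\end{pmatrix}$ with $a,b\in\mathbb Q$, $\lambda\in K$, with quadratic form $\det$, on which $M\in\mathrm{SL}_2(K)$ acts by $M.A=MA(M')^{\top}$. Let $L(\mathfrak a)\subset V$ be the lattice given by $a\in\mathbb Z$, $b\in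 N(\mathfrak a)\mathbb Z$, $\lambda\in\mathfrak a$, and $L(\mathfrak a)^\vee$ its dual with respect to the bilinear form $\det(A+B)-\det A-\det B$. For $\det A>0$ let $$g(A,z)=\frac{|bz_1z_2-\lambda z_1-\lambda' z_2+a|^2}{4y_1y_2\det A},\qquad T_A=\{z\in\mathbb H^2: bz_1z_2-\lambda z_1-\lambda' z_2+a=0\}.$$ Let $T(\mathfrak a,m)=\sum T_A$, summed over $A\in L(\mathfrak a)^\vee/\{\pm1\}$ with $\det A=m/(N(\mathfrak a)D)$; it is $\Gamma(\mathfrak a)$-invariant and hence a divisor on $X(\mathfrak a)$. Put $$\operatorname{vol}(T(\mathfrak a,m))=\sum_{\substack{A\in\Gamma(\mathfrak a)\backslash L(\mathfrak a)^\vee/\{\pm1\}\\ \det A=m/(N(\mathfrak a)D)}}\ \int_{\Gamma'_{\pm A}\backslash\mathbb H}\frac{1}{4\pi}\frac{dx\,dy}{y^2},\qquad \Gamma'_{\pm A}=\{M': M\in\Gamma(\mathfrak a),\ M.A\in\{A,-A\}\}.$$ Then $\operatorname{vol}(T(\mathfrak a,m))$ is finite and equals one half of the area $\int_{T(\mathfrak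 a,m)}\omega$ of the divisor $T(\mathfrak a,m)$ on $X(\mathfrak a)$. The series $$\Psi(\mathfrak a,m,s,z)=\sum_{\substack{A\in L(\mathfrak a)^\vee\\ \det A=m/(N(\mathfrak a)D)}}(1+g(A,z))^{-s}$$ converges absolutely for every $z\in\mathbb H^2$, is a smooth function of $z$, is $\Gamma(\mathfrak a)$-invariant and integrable over $X(\mathfrak a)$, and $$\int_{X(\mathfrak a)}\Psi(\mathfrak a,m,s,z)\,\omega^2=\frac{4}{s-1}\operatorname{vol}(T(\mathfrak a,m)).$$ -/

import Mathlib

open scoped MatrixGroups nonZeroDivisors UpperHalfPlane ContDiff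
open MeasureTheory NumberField

noncomputable section

namespace HilbertModular

/-! ### Measures on orbit spaces -/

/-- The measure induced by `μ` on the quotient of `α` by an equivalence relation with countable
classes: the smallest measure `ν` on the quotient such that, for each measurable `E ⊆ α` on which
the projection `π` is injective, `μ (E ∩ π⁻¹ B) ≤ ν B` for all measurable `B`. If `α` carries a
measure-preserving action of a countable group and `F` is a measurable set that meets almost every
orbit in exactly one point, this is the image of `μ` restricted to `F`, so integrals against it are
integrals over a fundamental domain. Group elements that act trivially play no role. -/
def quotientMeasure {α : Type*} [MeasurableSpace α] (r : Setoid α) (μ : Measure α) :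
    Measure (Quotient r) :=
  ⨆ E : {E : Set α // MeasurableSet E ∧ Set.InjOn (Quotient.mk r) E},
    (μ.restrict (E : Set α)).map (Quotient.mk r)

/-- `η = (4π)⁻¹ dx dy / y²` on the upper half plane. (`volume` on `ℍ` is `dx dy / y²`.) -/
def eta : Measure ℍ := ENNReal.ofReal (1 / (4 * Real.pi)) • (volume : Measure ℍ)

/-- The volume form `ω² = 2 η₁ η₂` on `ℍ × ℍ`, where `ω = η₁ + η₂`. -/
def omegaSq : Measure (ℍ × ℍ) := (2 : ENNReal) • eta.prod eta

/-! ### Hilbert modular groups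

`K` is a real quadratic field, `ι : K → ℝ` a real embedding, and `σ` the conjugation `x ↦ x'`. -/

variable {K : Type*} [Field K] [NumberField K]

/-- `SL(𝒪 ⊕ 𝔞)`: matrices of determinant one with diagonal entries in `𝒪_K`, upper right entry in
`𝔞⁻¹` and lower left entry in `𝔞`. -/
def Gam (𝔞 : (FractionalIdeal (𝓞 K)⁰ K)ˣ) : Subgroup SL(2, K) where
  carrier := {M | M 0 0 ∈ (1 : FractionalIdeal (𝓞 K)⁰ K) ∧
    M 0 1 ∈ ((𝔞⁻¹ : (FractionalIdeal (𝓞 K)⁰ K)ˣ) : FractionalIdeal (𝓞 K)⁰ K) ∧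
    M 1 0 ∈ (𝔞 : FractionalIdeal (𝓞 K)⁰ K) ∧
    M 1 1 ∈ (1 : FractionalIdeal (𝓞 K)⁰ K)}
  one_mem' := by
    simp [FractionalIdeal.zero_mem]
  mul_mem' := by
    rintro M N ⟨h1, h2, h3, h4⟩ ⟨k1, k2, k3, k4⟩
    have key : ∀ {I J L : FractionalIdeal (𝓞 K)⁰ K} {x y : K}, I * J = L → x ∈ I → y ∈ J →
        x * y ∈ L := by
      rintro I J L x y rfl hx hy
      exact FractionalIdeal.mul_mem_mul hx hy
    have add : ∀ {L : FractionalIdeal (𝓞 K)⁰ K} {x y : K}, x ∈ L → y ∈ L → x + y ∈ L := by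
      intro L x y hx hy
      exact (L : Submodule (𝓞 K) K).add_mem hx hy
    simp only [Set.mem_ofPred_eq, Matrix.SpecialLinearGroup.coe_mul, Matrix.mul_apply,
      Fin.sum_univ_two]
    exact ⟨add (key (by simp) h1 k1) (key (by simp) h2 k3),
      add (key (by simp) h1 k2) (key (by simp) h2 k4),
      add (key (by simp) h3 k1) (key (by simp) h4 k3),
      add (key (by simp) h3 k2) (key (by simp) h4 k4)⟩
  inv_mem' := by
    rintro M ⟨h1, h2, h3, h4⟩
    have neg : ∀ {L : FractionalIdeal (𝓞 K)⁰ K} {x : K}, x ∈ L → -x ∈ L := by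
      intro L x hx
      exact (L : Submodule (𝓞 K) K).neg_mem hx
    simp only [Set.mem_ofPred_eq, Matrix.SpecialLinearGroup.coe_inv, Matrix.adjugate_fin_two]
    exact ⟨h4, neg h2, neg h3, h1⟩

/-- The action `M (z₁, z₂) = (M z₁, M' z₂)` of `SL₂(K)` on `ℍ × ℍ` by Möbius transformations. -/
def act (ι : K →+* ℝ) (σ : K ≃ₐ[ℚ] K) (M : SL(2, K)) (z : ℍ × ℍ) : ℍ × ℍ :=
  (Matrix.SpecialLinearGroup.map ι M • z.1,
    Matrix.SpecialLinearGroup.map (ι.comp (σ : K →+* K)) M • z.2)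

theorem act_one (ι : K →+* ℝ) (σ : K ≃ₐ[ℚ] K) (z : ℍ × ℍ) : act ι σ 1 z = z := by
  simp [act]

theorem act_mul (ι : K →+* ℝ) (σ : K ≃ₐ[ℚ] K) (M N : SL(2, K)) (z : ℍ × ℍ) :
    act ι σ (M * N) z = act ι σ M (act ι σ N z) := by
  simp [act, mul_smul]

/-- `Γ(𝔞)`-equivalence on `ℍ × ℍ`. -/
def orbitSetoid (ι : K →+* ℝ) (σ : K ≃ₐ[ℚ] K) (𝔞 : (FractionalIdeal (𝓞 K)⁰ K)ˣ) :
    Setoid (ℍ × ℍ) where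
  r z w := ∃ M ∈ Gam 𝔞, act ι σ M z = w
  iseqv :=
    { refl := fun z => ⟨1, one_mem _, act_one ι σ z⟩
      symm := by
        rintro z w ⟨M, hM, rfl⟩
        exact ⟨M⁻¹, inv_mem hM, by rw [← act_mul, inv_mul_cancel, act_one]⟩
      trans := by
        rintro z w v ⟨M, hM, rfl⟩ ⟨N, hN, rfl⟩
        exact ⟨N * M, mul_mem hN hM, act_mul ι σ N M z⟩ }

/-- The Hilbert modular surface `X(𝔞) = Γ(𝔞) \ ℍ²`. -/
abbrev X (ι : K →+* ℝ) (σ : K ≃ₐ[ℚ] K) (𝔞 : (FractionalIdeal (𝓞 K)⁰ K)ˣ) : Type :=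
  Quotient (orbitSetoid ι σ 𝔞)

/-! ### The quadratic space `V` and its lattices -/

/-- The `ℚ`-vector space `V` of matrices `A = (a, λ'; λ, b)` over `K` with `Aᵀ = A'`; this forces
`a` and `b` to be rational. -/
def V (σ : K ≃ₐ[ℚ] K) : Set (Matrix (Fin 2) (Fin 2) K) := {A | A.transpose = A.map σ}

/-- The action `M.A = M A (M')ᵀ` of `SL₂(K)` on `V`. -/
def vact (σ : K ≃ₐ[ℚ] K) (M : SL(2, K)) (A : Matrix (Fin 2) (Fin 2) K) :
    Matrix (Fin 2) (Fin 2) K :=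
  (M : Matrix (Fin 2) (Fin 2) K) * A * ((M : Matrix (Fin 2) (Fin 2) K).map σ).transpose

theorem vact_one (σ : K ≃ₐ[ℚ] K) (A : Matrix (Fin 2) (Fin 2) K) : vact σ 1 A = A := by
  simp [vact]

theorem vact_mul (σ : K ≃ₐ[ℚ] K) (M N : SL(2, K)) (A : Matrix (Fin 2) (Fin 2) K) :
    vact σ (M * N) A = vact σ M (vact σ N A) := by
  simp [vact, Matrix.map_mul, Matrix.mul_assoc]

theorem vact_neg (σ : K ≃ₐ[ℚ] K) (M : SL(2, K)) (A : Matrix (Fin 2) (Fin 2) K) :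
    vact σ M (-A) = -vact σ M A := by
  simp [vact]

/-- The lattice `L(𝔞)` of all `(a, λ'; λ, b) ∈ V` with `a ∈ ℤ`, `b ∈ N(𝔞) ℤ` and `λ ∈ 𝔞`. -/
def L (σ : K ≃ₐ[ℚ] K) (𝔞 : (FractionalIdeal (𝓞 K)⁰ K)ˣ) : Set (Matrix (Fin 2) (Fin 2) K) :=
  {A | A ∈ V σ ∧ (∃ n : ℤ, A 0 0 = n) ∧
    (∃ n : ℤ, A 1 1 = algebraMap ℚ K (FractionalIdeal.absNorm (𝔞 : FractionalIdeal (𝓞 K)⁰ K) * n)) ∧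
    A 1 0 ∈ (𝔞 : FractionalIdeal (𝓞 K)⁰ K)}

/-- The dual lattice `L(𝔞)^∨` with respect to the bilinear form
`(A, B) = det (A + B) - det A - det B` of the quadratic form `det` on `V`. -/
def Ldual (σ : K ≃ₐ[ℚ] K) (𝔞 : (FractionalIdeal (𝓞 K)⁰ K)ˣ) :
    Set (Matrix (Fin 2) (Fin 2) K) :=
  {A | A ∈ V σ ∧ ∀ B ∈ L σ 𝔞, ∃ n : ℤ, (A + B).det - A.det - B.det = n}

/-- All `A ∈ L(𝔞)^∨` with `det A = m / (N(𝔞) D)`, where `D` is the discriminant of `K`. -/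
def Lm (σ : K ≃ₐ[ℚ] K) (𝔞 : (FractionalIdeal (𝓞 K)⁰ K)ˣ) (m : ℕ) :
    Set (Matrix (Fin 2) (Fin 2) K) :=
  {A | A ∈ Ldual σ 𝔞 ∧ A.det = algebraMap ℚ K
    (m / (FractionalIdeal.absNorm (𝔞 : FractionalIdeal (𝓞 K)⁰ K) * NumberField.discr K))}

/-- `b z₁ z₂ - λ z₁ - λ' z₂ + a` for `A = (a, λ'; λ, b)`. -/
def lin (ι : K →+* ℝ) (A : Matrix (Fin 2) (Fin 2) K) (z : ℍ × ℍ) : ℂ :=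
  (ι (A 1 1) : ℂ) * z.1 * z.2 - (ι (A 1 0) : ℂ) * z.1 - (ι (A 0 1) : ℂ) * z.2 + (ι (A 0 0) : ℂ)

/-- `g(A, z) = |b z₁ z₂ - λ z₁ - λ' z₂ + a|² / (4 y₁ y₂ det A)`. -/
def g (ι : K →+* ℝ) (A : Matrix (Fin 2) (Fin 2) K) (z : ℍ × ℍ) : ℝ :=
  ‖lin ι A z‖ ^ 2 / (4 * z.1.im * z.2.im * ι A.det)

/-- The summand `(1 + g(A, z))^{-s}`. -/
def psiTerm (ι : K →+* ℝ) (s : ℂ) (A : Matrix (Fin 2) (Fin 2) K) (z : ℍ × ℍ) : ℂ :=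
  ((1 + g ι A z : ℝ) : ℂ) ^ (-s)

/-- `Ψ(𝔞, m, s, z)`. -/
def Psi (ι : K →+* ℝ) (σ : K ≃ₐ[ℚ] K) (𝔞 : (FractionalIdeal (𝓞 K)⁰ K)ˣ) (m : ℕ) (s : ℂ)
    (z : ℍ × ℍ) : ℂ :=
  ∑' A : Lm σ 𝔞 m, psiTerm ι s A z

/-! ### Hirzebruch–Zagier divisors and their volume -/

/-- `A` and `B` are identified if `M.A = ± B` for some `M ∈ Γ(𝔞)`. -/
def pmSetoid (σ : K ≃ₐ[ℚ] K) (𝔞 : (FractionalIdeal (𝓞 K)⁰ K)ˣ) (m : ℕ) :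
    Setoid (Lm σ 𝔞 m) where
  r A B := ∃ M ∈ Gam 𝔞, vact σ M A = (B : Matrix (Fin 2) (Fin 2) K) ∨
    vact σ M A = -(B : Matrix (Fin 2) (Fin 2) K)
  iseqv :=
    { refl := fun A => ⟨1, one_mem _, Or.inl (vact_one σ _)⟩
      symm := by
        rintro A B ⟨M, hM, h | h⟩
        · exact ⟨M⁻¹, inv_mem hM, Or.inl (by
            rw [← h, ← vact_mul, inv_mul_cancel, vact_one])⟩
        · exact ⟨M⁻¹, inv_mem hM, Or.inr (by
            rw [← neg_eq_iff_eq_neg.mpr h, vact_neg, ← vact_mul, inv_mul_cancel, vact_one])⟩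
      trans := by
        rintro A B C ⟨M, hM, h⟩ ⟨N, hN, k⟩
        refine ⟨N * M, mul_mem hN hM, ?_⟩
        rw [vact_mul]
        rcases h with h | h <;> rcases k with k | k <;> simp [h, k, vact_neg] }

/-- The index set `Γ(𝔞) \ {A ∈ L(𝔞)^∨ : det A = m / (N(𝔞) D)} / {±1}`. -/
abbrev Components (σ : K ≃ₐ[ℚ] K) (𝔞 : (FractionalIdeal (𝓞 K)⁰ K)ˣ) (m : ℕ) :=
  Quotient (pmSetoid σ 𝔞 m)

/-- The stabilizer of `{±A}` in `Γ(𝔞)`. -/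
def stab (σ : K ≃ₐ[ℚ] K) (𝔞 : (FractionalIdeal (𝓞 K)⁰ K)ˣ) (A : Matrix (Fin 2) (Fin 2) K) :
    Subgroup SL(2, K) where
  carrier := {M | M ∈ Gam 𝔞 ∧ (vact σ M A = A ∨ vact σ M A = -A)}
  one_mem' := ⟨one_mem _, Or.inl (vact_one σ A)⟩
  mul_mem' := by
    rintro M N ⟨hM, h⟩ ⟨hN, k⟩
    refine ⟨mul_mem hM hN, ?_⟩
    rw [vact_mul]
    rcases h with h | h <;> rcases k with k | k <;> simp [h, k, vact_neg]
  inv_mem' := by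
    rintro M ⟨hM, h | h⟩
    · refine ⟨inv_mem hM, Or.inl ?_⟩
      conv_lhs => rw [← h]
      rw [← vact_mul, inv_mul_cancel, vact_one]
    · refine ⟨inv_mem hM, Or.inr ?_⟩
      conv_lhs => rw [← neg_eq_iff_eq_neg.mpr h]
      rw [vact_neg, ← vact_mul, inv_mul_cancel, vact_one]

/-- The group `{M' : M ∈ Γ(𝔞), M.A ∈ {±A}}`, as a group of real matrices. -/
def stabConj (ι : K →+* ℝ) (σ : K ≃ₐ[ℚ] K) (𝔞 : (FractionalIdeal (𝓞 K)⁰ K)ˣ)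
    (A : Matrix (Fin 2) (Fin 2) K) : Subgroup SL(2, ℝ) :=
  (stab σ 𝔞 A).map (Matrix.SpecialLinearGroup.map (ι.comp (σ : K →+* K)))

/-- `vol(T(𝔞, m))`: the sum over `A ∈ Γ(𝔞) \ L(𝔞)^∨ / {±1}` with `det A = m / (N(𝔞) D)` of the
`η`-volumes of the quotients of `ℍ` by `{M' : M ∈ Γ(𝔞), M.A ∈ {±A}}`. -/
def volT (ι : K →+* ℝ) (σ : K ≃ₐ[ℚ] K) (𝔞 : (FractionalIdeal (𝓞 K)⁰ K)ˣ) (m : ℕ) : ENNReal :=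
  ∑' c : Components σ 𝔞 m,
    quotientMeasure (MulAction.orbitRel (stabConj ι σ 𝔞 (c.out : Matrix (Fin 2) (Fin 2) K)) ℍ)
      eta Set.univ

/-- The curve `T_A ⊆ ℍ²`, given by `b z₁ z₂ - λ z₁ - λ' z₂ + a = 0`. -/
def curve (ι : K →+* ℝ) (A : Matrix (Fin 2) (Fin 2) K) : Set (ℍ × ℍ) := {z | lin ι A z = 0}

/-- The pullback of `ω = η₁ + η₂` to `T_A`, as a measure. If `det A > 0`, then each of the two
coordinates maps `T_A` bijectively onto `ℍ`, and `η_j` is pulled back along the `j`-th one. -/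
def curveArea (ι : K →+* ℝ) (A : Matrix (Fin 2) (Fin 2) K) : Measure (curve ι A) :=
  eta.comap (fun z : curve ι A => (z : ℍ × ℍ).1) + eta.comap (fun z : curve ι A => (z : ℍ × ℍ).2)

/-- The area `∫_{T(𝔞, m)} ω` of the divisor `T(𝔞, m)` on `X(𝔞)`: the sum of the areas of its
components, which are the images in `X(𝔞)` of the curves `T_A`. -/
def areaT (ι : K →+* ℝ) (σ : K ≃ₐ[ℚ] K) (𝔞 : (FractionalIdeal (𝓞 K)⁰ K)ˣ) (m : ℕ) : ENNReal :=
  ∑' c : Components σ 𝔞 m,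
    quotientMeasure
      (Setoid.comap (Subtype.val : curve ι (c.out : Matrix (Fin 2) (Fin 2) K) → ℍ × ℍ)
        (orbitSetoid ι σ 𝔞))
      (curveArea ι (c.out : Matrix (Fin 2) (Fin 2) K)) Set.univ

end HilbertModular

end

open HilbertModular

set_option linter.unusedSectionVars false

noncomputable section

namespace HilbertModular

section

variable {K : Type*} [Field K] [NumberField K]

/-! ### Geometry of the functions `lin` and `g` -/

/-! The proof unfolds the sum over `A`. For det A > 0 the curve T_A is the graph z₁ = γ z₂ of a
hyperbolic isometry γ (`moeb`), and g(A, z) = sinh²(d(z₁, γ z₂)/2) (`g_eq_sinh`). Since a hyperbolic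
disc of radius R has area 4π sinh²(R/2), the function sinh²(d(·, w)/2) carries `eta` to Lebesgue
measure on (0, ∞) (`lintegral_radial`). Integrating over z₁ for fixed z₂ therefore gives ∫ k(t) dt
for any summand k(g), and the remaining integral over z₂ modulo the stabilizer of ±A is one term of
vol(T). This yields `lintegral_tsum_g`, an identity in [0, ∞] for every measurable k ≥ 0, free of
any convergence hypothesis: the integral over X(𝔞) of the sum of k(g(A, z)) is 4 vol(T) ∫ k. One
factor 2 comes from ω² = 2 η₁η₂, the other from M and -M acting alike. Explicit fundamental domains
are replaced by measurable transversals, obtained by minimising a distance on each orbit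
(`exists_transversal`).

Finiteness of vol(T) is deduced from the same identity with k = (1+t)⁻³ (`volT_ne_top`). Minkowski's
theorem and the finiteness of the class group cover ℍ² by translates of finitely many Siegel sets
(`exists_siegel_cover`). There 1 + g controls four integral coordinates of A, so the series is at
most a constant times (y₁y₂)^(3/4), which is integrable.

Once vol(T) is finite, k = (1+t)^(-Re s) shows that the series converges absolutely at some point.
It then converges everywhere, because 1 + g changes between two points by a factor bounded
independently of A (`one_add_g_le`). For smoothness, A is rescaled by √(1 + g(A, z₀)): the rescaled
matrices stay in a compact set, so all derivatives of the terms are dominated by the summable values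
at z₀ (`contDiffAt_Psi`). The complex integral is read off from the equality of measures `sum_map_g`
and ∫ (1+t)^(-s) dt = 1/(s-1).

For the area, both coordinates of T_A pull `eta` back to the same measure, whence the factor 2. Off
the countable set where T_A meets other components, Γ(𝔞)-equivalence on T_A is equivalence under the
stabilizer of ±A (`quotientMeasure_curveArea`). -/

/-- The real Möbius transformation whose graph over the second coordinate is `T_A`. -/
def moeb (ι : K →+* ℝ) (A : Matrix (Fin 2) (Fin 2) K) (h : 0 < ι A.det) : GL (Fin 2) ℝ :=
  Matrix.GeneralLinearGroup.mkOfDetNeZero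
    !![ι (A 0 1), -ι (A 0 0); ι (A 1 1), -ι (A 1 0)] (by
      have : ι (A 0 1) * -ι (A 1 0) - -ι (A 0 0) * ι (A 1 1) = ι A.det := by
        rw [Matrix.det_fin_two]; simp only [map_sub, map_mul]; ring
      rw [Matrix.det_fin_two_of, this]; exact h.ne')

variable {ι : K →+* ℝ} {A : Matrix (Fin 2) (Fin 2) K}

theorem moeb_coe (h : 0 < ι A.det) :
    (moeb ι A h : Matrix (Fin 2) (Fin 2) ℝ) =
      !![ι (A 0 1), -ι (A 0 0); ι (A 1 1), -ι (A 1 0)] := rfl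

theorem moeb_det (h : 0 < ι A.det) : (moeb ι A h).det.val = ι A.det := by
  rw [Matrix.GeneralLinearGroup.val_det_apply, moeb_coe, Matrix.det_fin_two_of,
    Matrix.det_fin_two]
  simp only [map_sub, map_mul]; ring

theorem moeb_denom (h : 0 < ι A.det) (w : ℂ) :
    UpperHalfPlane.denom (moeb ι A h) w = ι (A 1 1) * w - ι (A 1 0) := by
  simp [UpperHalfPlane.denom, moeb_coe, sub_eq_add_neg]

theorem moeb_num (h : 0 < ι A.det) (w : ℂ) :
    UpperHalfPlane.num (moeb ι A h) w = ι (A 0 1) * w - ι (A 0 0) := by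
  simp [UpperHalfPlane.num, moeb_coe, sub_eq_add_neg]

/-- The equation of T_A has degree one in z₁. Solving for z₁ leaves the leading coefficient, which
is the denominator of `moeb` at z₂ and never vanishes. -/
theorem lin_eq (h : 0 < ι A.det) (z : ℍ × ℍ) :
    lin ι A z = (ι (A 1 1) * z.2 - ι (A 1 0)) * (z.1 - ((moeb ι A h • z.2 : ℍ) : ℂ)) := by
  have hd := UpperHalfPlane.denom_ne_zero (moeb ι A h) z.2
  rw [UpperHalfPlane.coe_smul_of_det_pos (by rw [moeb_det]; exact h), moeb_num]
  rw [moeb_denom] at hd ⊢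
  rw [lin]; field_simp; ring

theorem lin_eq_zero_iff (h : 0 < ι A.det) (z : ℍ × ℍ) :
    lin ι A z = 0 ↔ z.1 = moeb ι A h • z.2 := by
  have hd := UpperHalfPlane.denom_ne_zero (moeb ι A h) z.2
  rw [moeb_denom] at hd
  rw [lin_eq h, mul_eq_zero, or_iff_right hd, sub_eq_zero, UpperHalfPlane.coe_inj]

/-- The denominator in `lin_eq` cancels against Im(γ z₂) = det A · y₂ / |denominator|², leaving |z₁
- γ z₂|² / (4 Im z₁ Im γ z₂). -/
theorem g_eq_sinh (h : 0 < ι A.det) (z : ℍ × ℍ) :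
    g ι A z = Real.sinh (dist z.1 (moeb ι A h • z.2) / 2) ^ 2 := by
  have hd := UpperHalfPlane.denom_ne_zero (moeb ι A h) z.2
  have him := UpperHalfPlane.im_smul_eq_div_normSq (moeb ι A h) z.2
  rw [moeb_det, abs_of_pos h, Complex.normSq_eq_norm_sq] at him
  rw [moeb_denom] at hd him
  have h1 : 0 < ‖(ι (A 1 1) * z.2 - ι (A 1 0) : ℂ)‖ := norm_pos_iff.2 hd
  have h2 := z.1.im_pos
  have h3 := z.2.im_pos
  rw [UpperHalfPlane.sinh_half_dist, g, lin_eq h, norm_mul, div_pow, mul_pow, mul_pow,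
    Real.sq_sqrt (by positivity), dist_eq_norm, him]
  generalize ‖(ι (A 1 1) * z.2 - ι (A 1 0) : ℂ)‖ = n at *
  field_simp; norm_num

theorem g_nonneg (h : 0 < ι A.det) (z : ℍ × ℍ) : 0 ≤ g ι A z := by
  rw [g_eq_sinh h]; positivity

theorem one_add_g_eq_cosh (h : 0 < ι A.det) (z : ℍ × ℍ) :
    1 + g ι A z = Real.cosh (dist z.1 (moeb ι A h • z.2) / 2) ^ 2 := by
  rw [g_eq_sinh h, Real.cosh_sq]; ring

theorem g_neg (z : ℍ × ℍ) : g ι (-A) z = g ι A z := by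
  have : lin ι (-A) z = - lin ι A z := by simp [lin]; ring
  rw [g, g, this, norm_neg, Matrix.det_neg]; simp

theorem cosh_add_le {x d : ℝ} (hd : 0 ≤ d) : Real.cosh (x + d) ≤ Real.exp d * Real.cosh x := by
  rw [Real.cosh_eq, Real.cosh_eq, neg_add, Real.exp_add, Real.exp_add]
  have : Real.exp (-d) ≤ Real.exp d := Real.exp_le_exp.2 (by linarith)
  nlinarith [Real.exp_pos (-x)]

/-- The matrix is not normalised to determinant one. The differences and the imaginary parts of the
images acquire matching factors, so `cosh` of the distance is unchanged. -/
theorem dist_moeb (h : 0 < ι A.det) (z w : ℍ) :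
    dist (moeb ι A h • z) (moeb ι A h • w) = dist z w := by
  have h0 : 0 < (moeb ι A h).det.val := by rw [moeb_det]; exact h
  have hz := UpperHalfPlane.im_smul_eq_div_normSq (moeb ι A h) z
  have hw := UpperHalfPlane.im_smul_eq_div_normSq (moeb ι A h) w
  have dz := UpperHalfPlane.denom_ne_zero (moeb ι A h) z
  have dw := UpperHalfPlane.denom_ne_zero (moeb ι A h) w
  have hz' := UpperHalfPlane.coe_smul_of_det_pos h0 z
  have hw' := UpperHalfPlane.coe_smul_of_det_pos h0 w
  rw [moeb_det, abs_of_pos h, Complex.normSq_eq_norm_sq] at hz hw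
  rw [moeb_num] at hz' hw'
  rw [moeb_denom] at dz dw hz hw hz' hw'
  have pz : 0 < ‖(ι (A 1 1) * z - ι (A 1 0) : ℂ)‖ := norm_pos_iff.2 dz
  have pw : 0 < ‖(ι (A 1 1) * w - ι (A 1 0) : ℂ)‖ := norm_pos_iff.2 dw
  have hdet : (ι A.det : ℂ) = ι (A 0 0) * ι (A 1 1) - ι (A 0 1) * ι (A 1 0) := by
    rw [Matrix.det_fin_two]; push_cast [map_sub, map_mul]; ring
  have key : ((moeb ι A h • z : ℍ) : ℂ) - (moeb ι A h • w : ℍ) =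
      ι A.det * (z - w) / ((ι (A 1 1) * z - ι (A 1 0)) * (ι (A 1 1) * w - ι (A 1 0))) := by
    rw [hz', hw', hdet, div_sub_div _ _ dz dw]; congr 1; ring
  have hc : Real.cosh (dist (moeb ι A h • z) (moeb ι A h • w)) = Real.cosh (dist z w) := by
    have i1 := z.im_pos
    have i2 := w.im_pos
    rw [UpperHalfPlane.cosh_dist, UpperHalfPlane.cosh_dist, dist_eq_norm (_ : ℂ), key, hz, hw,
      norm_div, norm_mul, norm_mul, dist_eq_norm (z : ℂ)]
    simp only [Complex.norm_real, Real.norm_eq_abs, abs_of_pos h]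
    generalize ‖(ι (A 1 1) * z - ι (A 1 0) : ℂ)‖ = n at *
    generalize ‖(ι (A 1 1) * w - ι (A 1 0) : ℂ)‖ = n at *
    field_simp
  have h1 := Real.cosh_le_cosh.1 hc.le
  have h2 := Real.cosh_le_cosh.1 hc.ge
  rw [abs_of_nonneg dist_nonneg, abs_of_nonneg dist_nonneg] at h1 h2
  exact le_antisymm h1 h2

/-- Moving the point changes `1 + g(A, z)` by a factor that is bounded independently of `A`. -/
theorem one_add_g_le (h : 0 < ι A.det) (z w : ℍ × ℍ) :
    1 + g ι A z ≤ Real.exp (dist z.1 w.1 + dist z.2 w.2) * (1 + g ι A w) := by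
  rw [one_add_g_eq_cosh h, one_add_g_eq_cosh h]
  have h1 : dist z.1 (moeb ι A h • z.2) ≤
      dist w.1 (moeb ι A h • w.2) + (dist z.1 w.1 + dist z.2 w.2) := by
    -- Replacing w₂ by z₂ inside the isometry costs only the distance of w₂ and z₂, whatever A is.
    have e1 := dist_triangle z.1 w.1 (moeb ι A h • z.2)
    have e2 := dist_triangle w.1 (moeb ι A h • w.2) (moeb ι A h • z.2)
    rw [dist_moeb, dist_comm w.2] at e2
    linarith
  set δ := dist z.1 w.1 + dist z.2 w.2 with hδ
  have hδ0 : 0 ≤ δ := add_nonneg dist_nonneg dist_nonneg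
  set x := dist w.1 (moeb ι A h • w.2)
  have hx : 0 ≤ x := dist_nonneg
  have h2 : Real.cosh (dist z.1 (moeb ι A h • z.2) / 2) ≤
      Real.exp (δ / 2) * Real.cosh (x / 2) := by
    refine le_trans ?_ (cosh_add_le (by positivity : 0 ≤ δ / 2))
    rw [Real.cosh_le_cosh, abs_of_nonneg (by positivity), abs_of_nonneg (by positivity)]
    linarith
  calc _ ≤ (Real.exp (δ / 2) * Real.cosh (x / 2)) ^ 2 := by
        gcongr
    _ = _ := by rw [mul_pow, ← Real.exp_nat_mul]; congr 2; push_cast; ring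

/-! ### Equivariance -/

theorem coe_sl_smul (M : SL(2, ℝ)) (z : ℍ) :
    ((M • z : ℍ) : ℂ) = (M 0 0 * z + M 0 1) / (M 1 0 * z + M 1 1) :=
  congrArg UpperHalfPlane.coe (UpperHalfPlane.specialLinearGroup_apply M z)

theorem sl_denom_ne (M : SL(2, ℝ)) (z : ℍ) : (M 1 0 * z + M 1 1 : ℂ) ≠ 0 :=
  UpperHalfPlane.denom_ne_zero (M : GL (Fin 2) ℝ) z

theorem sl_im (M : SL(2, ℝ)) (z : ℍ) :
    (M • z).im = z.im / ‖(M 1 0 * z + M 1 1 : ℂ)‖ ^ 2 := by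
  rw [← Complex.normSq_eq_norm_sq]
  have := UpperHalfPlane.im_smul_eq_div_normSq (M : GL (Fin 2) ℝ) z
  simp only [Matrix.SpecialLinearGroup.coeToGL_det, Units.val_one, abs_one, one_mul] at this
  exact this

theorem det_vact (σ : K ≃ₐ[ℚ] K) (M : SL(2, K)) (A : Matrix (Fin 2) (Fin 2) K) :
    (vact σ M A).det = A.det := by
  have : ((M : Matrix (Fin 2) (Fin 2) K).map σ).det = 1 := by
    have h := M.det_coe
    rw [Matrix.det_fin_two] at h ⊢
    simp only [Matrix.map_apply]
    rw [← map_mul, ← map_mul, ← map_sub, h, map_one]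
  rw [vact, Matrix.det_mul, Matrix.det_mul, Matrix.det_transpose, this, M.det_coe]; simp

/-- The form `lin` transforms with weight -1 in each variable: the two denominators are the
automorphy factors at the two real places. -/
theorem lin_vact (σ : K ≃ₐ[ℚ] K) (M : SL(2, K)) (A : Matrix (Fin 2) (Fin 2) K) (z : ℍ × ℍ) :
    lin ι (vact σ M A) (act ι σ M z) *
      ((ι (M 1 0) * z.1 + ι (M 1 1)) * (ι (σ (M 1 0)) * z.2 + ι (σ (M 1 1)))) = lin ι A z := by
  have h1 := sl_denom_ne (Matrix.SpecialLinearGroup.map ι M) z.1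
  have h2 := sl_denom_ne (Matrix.SpecialLinearGroup.map (ι.comp (σ : K →+* K)) M) z.2
  have d1 : (ι (M 0 0) * ι (M 1 1) - ι (M 0 1) * ι (M 1 0) : ℂ) = 1 := by
    have h := M.det_coe
    rw [Matrix.det_fin_two] at h
    have := congrArg (fun x => ((ι x : ℝ) : ℂ)) h
    simpa using this
  have d2 : (ι (σ (M 0 0)) * ι (σ (M 1 1)) - ι (σ (M 0 1)) * ι (σ (M 1 0)) : ℂ) = 1 := by
    have h := M.det_coe
    rw [Matrix.det_fin_two] at h
    have := congrArg (fun x => ((ι (σ x) : ℝ) : ℂ)) h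
    simpa using this
  rw [lin, act]
  simp only [coe_sl_smul]
  simp only [Matrix.SpecialLinearGroup.map_apply_coe, RingHom.mapMatrix_apply, Matrix.map_apply,
    RingHom.coe_comp, Function.comp_apply, RingHom.coe_coe, vact,
    Matrix.mul_apply, Fin.sum_univ_two, Matrix.transpose_apply, map_add, map_mul] at h1 h2 ⊢
  push_cast
  rw [lin]
  generalize (ι (M 0 0) : ℂ) = p at *
  generalize (ι (M 0 1) : ℂ) = q at *
  generalize (ι (M 1 0) : ℂ) = r at *
  generalize (ι (M 1 1) : ℂ) = t at *
  generalize (ι (σ (M 0 0)) : ℂ) = p' at *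
  generalize (ι (σ (M 0 1)) : ℂ) = q' at *
  generalize (ι (σ (M 1 0)) : ℂ) = r' at *
  generalize (ι (σ (M 1 1)) : ℂ) = t' at *
  field_simp
  -- With denominators cleared, the two sides differ by det M · det M' - 1 times the value of `lin`
  -- at z.
  linear_combination ((ι (A 1 1) : ℂ) * z.1 * z.2 - (ι (A 1 0) : ℂ) * z.1 - (ι (A 0 1) : ℂ) * z.2
    + (ι (A 0 0) : ℂ)) * ((p' * t' - q' * r') * d1 + d2)

theorem g_vact (σ : K ≃ₐ[ℚ] K) (M : SL(2, K)) (A : Matrix (Fin 2) (Fin 2) K) (z : ℍ × ℍ) :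
    g ι (vact σ M A) (act ι σ M z) = g ι A z := by
  have h1 := sl_denom_ne (Matrix.SpecialLinearGroup.map ι M) z.1
  have h2 := sl_denom_ne (Matrix.SpecialLinearGroup.map (ι.comp (σ : K →+* K)) M) z.2
  have i1 := sl_im (Matrix.SpecialLinearGroup.map ι M) z.1
  have i2 := sl_im (Matrix.SpecialLinearGroup.map (ι.comp (σ : K →+* K)) M) z.2
  have hl := lin_vact (ι := ι) σ M A z
  rw [g, g, det_vact, ← hl]
  simp only [act, i1, i2]
  simp only [Matrix.SpecialLinearGroup.map_apply_coe, RingHom.mapMatrix_apply, Matrix.map_apply,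
    RingHom.coe_comp, Function.comp_apply, RingHom.coe_coe, norm_mul] at h1 h2 ⊢
  have h1' := norm_pos_iff.2 h1
  have h2' := norm_pos_iff.2 h2
  have := z.1.im_pos
  have := z.2.im_pos
  -- For determinant zero both quotients are 0 by the convention for division.
  by_cases hA : ι A.det = 0
  · simp [hA]
  field_simp

theorem lin_vact_eq_zero_iff (σ : K ≃ₐ[ℚ] K) (M : SL(2, K)) (z : ℍ × ℍ) :
    lin ι (vact σ M A) (act ι σ M z) = 0 ↔ lin ι A z = 0 := by
  have h1 := sl_denom_ne (Matrix.SpecialLinearGroup.map ι M) z.1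
  have h2 := sl_denom_ne (Matrix.SpecialLinearGroup.map (ι.comp (σ : K →+* K)) M) z.2
  rw [← lin_vact (ι := ι) σ M A z, mul_eq_zero, or_iff_left]
  exact mul_ne_zero h1 h2

theorem lin_neg (z : ℍ × ℍ) : lin ι (-A) z = - lin ι A z := by simp [lin]; ring

theorem continuous_lin : Continuous (lin ι A) := by
  unfold lin; fun_prop

theorem continuous_g : Continuous (g ι A) := by
  by_cases hA : ι A.det = 0
  · have : g ι A = fun _ => 0 := by ext z; simp [g, hA]
    rw [this]; exact continuous_const
  unfold g
  refine Continuous.div (by have := continuous_lin (ι := ι) (A := A); fun_prop)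
    (by fun_prop) fun z => ?_
  have := z.1.im_pos
  have := z.2.im_pos
  positivity

theorem measurable_g : Measurable (g ι A) := continuous_g.measurable

end

section

variable {K : Type*} [Field K] [NumberField K]

/-! ### Arithmetic of a real quadratic field -/

section Quadratic

variable (hK : Module.finrank ℚ K = 2) {σ : K ≃ₐ[ℚ] K} (hσ : σ ≠ AlgEquiv.refl)

include hK hσ

theorem univ_eq_pair [DecidableEq (K ≃ₐ[ℚ] K)] :
    (Finset.univ : Finset (K ≃ₐ[ℚ] K)) = {1, σ} := by
  symm
  apply Finset.eq_of_subset_of_card_le (Finset.subset_univ _)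
  rw [Finset.card_univ, Finset.card_pair (Ne.symm hσ : (1 : K ≃ₐ[ℚ] K) ≠ σ), ← hK]
  convert AlgEquiv.card_le (F := ℚ) (K := K)

theorem isGalois_of_quadratic : IsGalois ℚ K := by
  classical
  apply IsGalois.of_card_aut_eq_finrank
  rw [Nat.card_eq_fintype_card, ← Finset.card_univ, univ_eq_pair hK hσ,
    Finset.card_pair (Ne.symm hσ : (1 : K ≃ₐ[ℚ] K) ≠ σ), hK]

theorem sigma_sigma (x : K) : σ (σ x) = x := by
  classical
  have h : σ * σ ∈ (Finset.univ : Finset (K ≃ₐ[ℚ] K)) := Finset.mem_univ _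
  rw [univ_eq_pair hK hσ, Finset.mem_insert, Finset.mem_singleton] at h
  rcases h with h | h
  · exact DFunLike.congr_fun h x
  · exact absurd (mul_eq_left.1 h) hσ

theorem eq_rat_of_fixed {x : K} (hx : σ x = x) : ∃ q : ℚ, algebraMap ℚ K q = x := by
  classical
  have := isGalois_of_quadratic hK hσ
  rw [← Set.mem_range, ← IntermediateField.coe_bot, SetLike.mem_coe, IsGalois.mem_bot_iff_fixed]
  intro f
  have h := Finset.mem_univ f
  rw [univ_eq_pair hK hσ, Finset.mem_insert, Finset.mem_singleton] at h
  rcases h with rfl | rfl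
  · rfl
  · exact hx

theorem mul_sigma_eq_norm (x : K) : x * σ x = algebraMap ℚ K (Algebra.norm ℚ x) := by
  classical
  have := isGalois_of_quadratic hK hσ
  rw [Algebra.norm_eq_prod_automorphisms, univ_eq_pair hK hσ, Finset.prod_pair (Ne.symm hσ : (1 : K ≃ₐ[ℚ] K) ≠ σ)]
  rfl

theorem eq_int_of_fixed {x : K} (hx : σ x = x) (hi : IsIntegral ℤ x) : ∃ n : ℤ, x = n := by
  obtain ⟨q, rfl⟩ := eq_rat_of_fixed hK hσ hx
  rw [isIntegral_algebraMap_iff (algebraMap ℚ K).injective] at hi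
  obtain ⟨n, hn⟩ := IsIntegrallyClosed.isIntegral_iff.1 hi
  exact ⟨n, by rw [← hn]; simp⟩

omit hK hσ in
theorem isIntegral_sigma {x : K} (hi : IsIntegral ℤ x) : IsIntegral ℤ (σ x) :=
  hi.map (σ : K →+* K).toIntAlgHom

omit hK hσ in
theorem isIntegral_intCast (n : ℤ) : IsIntegral ℤ (n : K) := by
  simpa using isIntegral_algebraMap (R := ℤ) (A := K) (x := n)

omit hK hσ in
theorem isIntegral_natCast (n : ℕ) : IsIntegral ℤ (n : K) := by
  simpa using isIntegral_intCast (K := K) n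

omit hK hσ in
theorem exists_nat_mul_isIntegral (x : K) : ∃ n : ℕ, 0 < n ∧ IsIntegral ℤ (n * x) := by
  have hx : IsAlgebraic ℤ x :=
    (IsFractionRing.isAlgebraic_iff ℤ ℚ K).2 (Algebra.IsAlgebraic.isAlgebraic x)
  obtain ⟨y, hy, h⟩ := exists_integral_multiples ℤ ℚ (L := K) {x}
  refine ⟨y.natAbs, Int.natAbs_pos.2 hy, ?_⟩
  have h1 := h x (by simp)
  rw [zsmul_eq_mul] at h1
  rcases Int.natAbs_eq y with h2 | h2
  · rw [h2] at h1; simpa using h1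
  · rw [h2] at h1; simpa using h1.neg

/-- An integral square root of a positive nonsquare integer in `K`. -/
theorem exists_sqrt (ι : K →+* ℝ) : ∃ (α : K) (δ : ℤ), σ α = -α ∧ 0 < ι α ∧ IsIntegral ℤ α ∧
    0 < δ ∧ α ^ 2 = δ ∧ ¬ IsSquare δ := by
  obtain ⟨x, hx⟩ : ∃ x, σ x ≠ x := by
    by_contra! h
    exact hσ (AlgEquiv.ext h)
  obtain ⟨n, hn, hi⟩ := exists_nat_mul_isIntegral (x - σ x)
  have hn0 : (n : K) ≠ 0 := by exact_mod_cast hn.ne'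
  obtain ⟨β, hβ1, hβ2, hβ3⟩ : ∃ β : K, σ β = -β ∧ β ≠ 0 ∧ IsIntegral ℤ β :=
    ⟨n * (x - σ x), by simp [sigma_sigma hK hσ]; ring,
      mul_ne_zero hn0 (sub_ne_zero.2 hx.symm), hi⟩
  obtain ⟨α, h1, h2, h3⟩ : ∃ α : K, σ α = -α ∧ 0 < ι α ∧ IsIntegral ℤ α := by
    rcases lt_or_gt_of_ne ((map_ne_zero ι).2 hβ2) with h | h
    · exact ⟨-β, by simp [hβ1], by simpa using h, hβ3.neg⟩
    · exact ⟨β, hβ1, h, hβ3⟩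
  obtain ⟨δ, hδ⟩ := eq_int_of_fixed hK hσ (x := α ^ 2) (by simp [h1]) (h3.pow 2)
  refine ⟨α, δ, h1, h2, h3, ?_, hδ, ?_⟩
  · have := congrArg ι hδ
    simp only [map_pow, map_intCast] at this
    have h4 : (0 : ℝ) < δ := by rw [← this]; positivity
    exact_mod_cast h4
  -- If δ = k², then α = ±k is fixed by σ, against σ α = -α ≠ 0.
  · rintro ⟨k, rfl⟩
    have h4 : (α - k) * (α + k) = 0 := by push_cast at hδ; linear_combination hδ
    have h5 : σ α = α := by
      rcases mul_eq_zero.1 h4 with h | h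
      · rw [sub_eq_zero.1 h]; simp
      · rw [eq_neg_of_add_eq_zero_left h]; simp
    rw [h5] at h1
    have : α = 0 := self_eq_neg.1 h1
    simp [this] at h2

/-- A nontrivial solution of Pell's equation x² - δy² = 1 gives the unit |x| + |y|α of norm one; the
absolute values make its image exceed 1. -/
theorem exists_unit (ι : K →+* ℝ) : ∃ ε : K, IsIntegral ℤ ε ∧ ε * σ ε = 1 ∧ 1 < ι ε := by
  obtain ⟨α, δ, h1, h2, h3, h4, h5, h6⟩ := exists_sqrt hK hσ ι
  obtain ⟨x, y, hxy, hy⟩ := Pell.exists_of_not_isSquare h4 h6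
  refine ⟨(|x| : ℤ) + (|y| : ℤ) * α, (isIntegral_intCast _).add ((isIntegral_intCast _).mul h3),
    ?_, ?_⟩
  · have e1 : ((|x| : ℤ) : K) ^ 2 = (x : K) ^ 2 := by exact_mod_cast sq_abs x
    have e2 : ((|y| : ℤ) : K) ^ 2 = (y : K) ^ 2 := by exact_mod_cast sq_abs y
    have e3 : (x : K) ^ 2 - δ * (y : K) ^ 2 = 1 := by exact_mod_cast hxy
    simp only [map_add, map_mul, map_intCast, h1]
    linear_combination e3 + e1 - ((|y| : ℤ) : K) ^ 2 * h5 - δ * e2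
  · simp only [map_add, map_mul, map_intCast]
    have hx : 1 ≤ |x| := Int.one_le_abs (by rintro rfl; nlinarith [sq_nonneg y])
    have hy' : 1 ≤ |y| := Int.one_le_abs hy
    have hx2 : (1 : ℝ) ≤ (|x| : ℤ) := by exact_mod_cast hx
    have hy2 : (1 : ℝ) ≤ (|y| : ℤ) := by exact_mod_cast hy'
    nlinarith

omit hσ in
-- The embedding ι provides a real place, so in degree two there is no complex place, and the sign
-- of the discriminant is (-1) to the number of complex places.
theorem discr_pos (ι : K →+* ℝ) : 0 < NumberField.discr K := by
  have h := InfinitePlace.card_add_two_mul_card_eq_rank K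
  rw [hK] at h
  have h1 : 0 < InfinitePlace.nrRealPlaces K := by
    refine (@Fintype.card_pos_iff _ (_)).2 ⟨⟨InfinitePlace.mk (Complex.ofRealHom.comp ι), ?_⟩⟩
    refine ⟨_, ?_, rfl⟩
    ext x
    simp
  have h2 : InfinitePlace.nrComplexPlaces K = 0 := by omega
  have h3 := NumberField.sign_discr (K := K)
  rw [h2, pow_zero] at h3
  exact Int.sign_eq_one_iff_pos.1 h3

/-- The trace of nx and (nx - σ(nx))α are rational integers that determine x, and bounds on both
conjugates of x bound them. This is the source of all discreteness statements below. -/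
theorem finite_bounded (ι : K →+* ℝ) {n : ℕ} (hn : 0 < n) (C : ℝ) :
    {x : K | IsIntegral ℤ (n * x) ∧ |ι x| ≤ C ∧ |ι (σ x)| ≤ C}.Finite := by
  obtain ⟨α, δ, h1, h2, h3, h4, h5, h6⟩ := exists_sqrt hK hσ ι
  have hn0 : (n : K) ≠ 0 := by exact_mod_cast hn.ne'
  have hα : α ≠ 0 := by rintro rfl; simp at h2
  let R : ℤ := ⌈n * (2 * C) * (1 + ι α)⌉
  have key : ∀ x ∈ {x : K | IsIntegral ℤ (n * x) ∧ |ι x| ≤ C ∧ |ι (σ x)| ≤ C},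
      ∃ p ∈ (Set.Icc (-R) R) ×ˢ (Set.Icc (-R) R),
        (((p.1 : K) + p.2 / α) / (2 * n)) = x := by
    rintro x ⟨hi, b1, b2⟩
    obtain ⟨p, hp⟩ := eq_int_of_fixed hK hσ (x := n * x + σ (n * x))
      (by rw [map_add, sigma_sigma hK hσ]; ring) (hi.add (isIntegral_sigma hi))
    obtain ⟨q, hq⟩ := eq_int_of_fixed hK hσ (x := (n * x - σ (n * x)) * α)
      (by rw [map_mul, map_sub, sigma_sigma hK hσ, h1]; ring)
      ((hi.sub (isIntegral_sigma hi)).mul h3)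
    have hn' : (0 : ℝ) < n := by exact_mod_cast hn
    have hp' : (p : ℝ) = n * (ι x + ι (σ x)) := by
      have := congrArg ι hp; simp at this; linarith
    have hq' : (q : ℝ) = n * (ι x - ι (σ x)) * ι α := by
      have := congrArg ι hq; simp at this; linarith
    have hC : 0 ≤ C := (abs_nonneg _).trans b1
    have hR : n * (2 * C) * (1 + ι α) ≤ R := Int.le_ceil _
    have s1 : |(p : ℝ)| ≤ R := by
      rw [hp', abs_mul, abs_of_pos hn']
      refine le_trans ?_ hR
      have : |ι x + ι (σ x)| ≤ 2 * C := by have := abs_add_le (ι x) (ι (σ x)); linarith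
      have h7 : n * |ι x + ι (σ x)| ≤ n * (2 * C) := by gcongr
      nlinarith [mul_nonneg hn'.le (mul_nonneg zero_le_two hC)]
    have s2 : |(q : ℝ)| ≤ R := by
      rw [hq', abs_mul, abs_mul, abs_of_pos hn', abs_of_pos h2]
      refine le_trans ?_ hR
      have : |ι x - ι (σ x)| ≤ 2 * C := by have := abs_sub (ι x) (ι (σ x)); linarith
      have h7 : n * |ι x - ι (σ x)| * ι α ≤ n * (2 * C) * ι α := by gcongr
      nlinarith [mul_nonneg hn'.le (mul_nonneg zero_le_two hC)]
    refine ⟨(p, q), ⟨?_, ?_⟩, ?_⟩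
    · exact abs_le.1 (by exact_mod_cast s1)
    · exact abs_le.1 (by exact_mod_cast s2)
    · simp only [← hp, ← hq]
      field_simp; ring
  refine Set.Finite.subset (((Set.finite_Icc (-R) R).prod (Set.finite_Icc (-R) R)).image
    fun p : ℤ × ℤ => (((p.1 : K) + p.2 / α) / (2 * n))) ?_
  intro x hx
  obtain ⟨p, hp, h⟩ := key x hx
  exact ⟨p, hp, h⟩

end Quadratic

/-! ### Invariance of the lattices -/

section Lattice

theorem mem_one_iff_isIntegral {x : K} :
    x ∈ (1 : FractionalIdeal (𝓞 K)⁰ K) ↔ IsIntegral ℤ x := by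
  rw [FractionalIdeal.mem_one_iff]
  exact ⟨fun ⟨y, hy⟩ => hy ▸ y.isIntegral_coe, fun h => ⟨⟨x, h⟩, rfl⟩⟩

theorem isIntegral_mul_of_mem_inv {𝔞 : (FractionalIdeal (𝓞 K)⁰ K)ˣ} {x y : K}
    (hx : x ∈ (𝔞 : FractionalIdeal (𝓞 K)⁰ K))
    (hy : y ∈ ((𝔞⁻¹ : (FractionalIdeal (𝓞 K)⁰ K)ˣ) : FractionalIdeal (𝓞 K)⁰ K)) :
    IsIntegral ℤ (x * y) := by
  rw [← mem_one_iff_isIntegral, ← Units.mul_inv 𝔞]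
  exact FractionalIdeal.mul_mem_mul hx hy

theorem mem_of_isIntegral_mul {𝔞 : (FractionalIdeal (𝓞 K)⁰ K)ˣ} {x : K}
    (hx : ∀ y ∈ ((𝔞⁻¹ : (FractionalIdeal (𝓞 K)⁰ K)ˣ) : FractionalIdeal (𝓞 K)⁰ K),
      IsIntegral ℤ (x * y)) : x ∈ (𝔞 : FractionalIdeal (𝓞 K)⁰ K) := by
  have h : FractionalIdeal.spanSingleton (𝓞 K)⁰ x *
      ((𝔞⁻¹ : (FractionalIdeal (𝓞 K)⁰ K)ˣ) : FractionalIdeal (𝓞 K)⁰ K) ≤ 1 := by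
    rw [FractionalIdeal.spanSingleton_mul_le_iff]
    exact fun y hy => mem_one_iff_isIntegral.2 (hx y hy)
  have h2 := mul_le_mul_left h (𝔞 : FractionalIdeal (𝓞 K)⁰ K)
  rw [mul_assoc, Units.inv_mul, mul_one, one_mul] at h2
  exact h2 (FractionalIdeal.mem_spanSingleton_self _ x)

theorem mul_mem_of_isIntegral {I : FractionalIdeal (𝓞 K)⁰ K} {x y : K} (hx : IsIntegral ℤ x)
    (hy : y ∈ I) : x * y ∈ I := by
  rw [← one_mul I]
  exact FractionalIdeal.mul_mem_mul (mem_one_iff_isIntegral.2 hx) hy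

theorem frac_add_mem {I : FractionalIdeal (𝓞 K)⁰ K} {x y : K} (hx : x ∈ I) (hy : y ∈ I) :
    x + y ∈ I := (I : Submodule (𝓞 K) K).add_mem hx hy

theorem frac_neg_mem {I : FractionalIdeal (𝓞 K)⁰ K} {x : K} (hx : x ∈ I) :
    -x ∈ I := (I : Submodule (𝓞 K) K).neg_mem hx

/-- Write (x) = 𝔞J with J an integral ideal and take norms. -/
theorem norm_mem {𝔞 : (FractionalIdeal (𝓞 K)⁰ K)ˣ} {x : K}
    (hx : x ∈ (𝔞 : FractionalIdeal (𝓞 K)⁰ K)) :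
    ∃ n : ℤ, Algebra.norm ℚ x = FractionalIdeal.absNorm (𝔞 : FractionalIdeal (𝓞 K)⁰ K) * n := by
  have h1 : FractionalIdeal.spanSingleton (𝓞 K)⁰ x *
      ((𝔞⁻¹ : (FractionalIdeal (𝓞 K)⁰ K)ˣ) : FractionalIdeal (𝓞 K)⁰ K) ≤ 1 := by
    rw [FractionalIdeal.spanSingleton_mul_le_iff]
    exact fun y hy => mem_one_iff_isIntegral.2 (isIntegral_mul_of_mem_inv hx hy)
  obtain ⟨J, hJ⟩ := FractionalIdeal.le_one_iff_exists_coeIdeal.1 h1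
  have h2 : FractionalIdeal.spanSingleton (𝓞 K)⁰ x = (𝔞 : FractionalIdeal (𝓞 K)⁰ K) * J := by
    rw [hJ, mul_comm, mul_assoc, Units.inv_mul, mul_one]
  have h3 := congrArg FractionalIdeal.absNorm h2
  rw [map_mul, FractionalIdeal.coeIdeal_absNorm, FractionalIdeal.absNorm_span_singleton] at h3
  rcases abs_choice (Algebra.norm ℚ x) with h | h
  · exact ⟨Ideal.absNorm J, by rw [← h, h3]; simp⟩
  · refine ⟨-Ideal.absNorm J, ?_⟩
    rw [← neg_neg (Algebra.norm ℚ x), ← h, h3]; simp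

theorem absNorm_unit_pos (𝔞 : (FractionalIdeal (𝓞 K)⁰ K)ˣ) :
    0 < FractionalIdeal.absNorm (𝔞 : FractionalIdeal (𝓞 K)⁰ K) :=
  lt_of_le_of_ne (FractionalIdeal.absNorm_nonneg _) fun h => by
    exact 𝔞.ne_zero (FractionalIdeal.absNorm_eq_zero_iff.1 h.symm)

theorem absNorm_inv_mul (𝔞 : (FractionalIdeal (𝓞 K)⁰ K)ˣ) :
    FractionalIdeal.absNorm (𝔞 : FractionalIdeal (𝓞 K)⁰ K) * FractionalIdeal.absNorm
      ((𝔞⁻¹ : (FractionalIdeal (𝓞 K)⁰ K)ˣ) : FractionalIdeal (𝓞 K)⁰ K) = 1 := by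
  rw [← map_mul, Units.mul_inv, map_one]

variable (hK : Module.finrank ℚ K = 2) {σ : K ≃ₐ[ℚ] K} (hσ : σ ≠ AlgEquiv.refl)

include hK hσ

theorem mul_sigma_mem {𝔞 : (FractionalIdeal (𝓞 K)⁰ K)ˣ} {x : K}
    (hx : x ∈ (𝔞 : FractionalIdeal (𝓞 K)⁰ K)) : ∃ n : ℤ, x * σ x =
      algebraMap ℚ K (FractionalIdeal.absNorm (𝔞 : FractionalIdeal (𝓞 K)⁰ K)) * n := by
  obtain ⟨n, hn⟩ := norm_mem hx
  exact ⟨n, by rw [mul_sigma_eq_norm hK hσ, hn]; simp⟩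

/-- Polarization of the norm form in `mul_sigma_mem`. -/
theorem trace_mul_sigma_mem {𝔞 : (FractionalIdeal (𝓞 K)⁰ K)ˣ} {x y : K}
    (hx : x ∈ (𝔞 : FractionalIdeal (𝓞 K)⁰ K)) (hy : y ∈ (𝔞 : FractionalIdeal (𝓞 K)⁰ K)) :
    ∃ n : ℤ, x * σ y + y * σ x =
      algebraMap ℚ K (FractionalIdeal.absNorm (𝔞 : FractionalIdeal (𝓞 K)⁰ K)) * n := by
  obtain ⟨n, hn⟩ := mul_sigma_mem hK hσ hx
  obtain ⟨k, hk⟩ := mul_sigma_mem hK hσ hy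
  obtain ⟨l, hl⟩ := mul_sigma_mem hK hσ (frac_add_mem hx hy)
  rw [map_add] at hl
  exact ⟨l - n - k, by push_cast; linear_combination hl - hn - hk⟩

omit hK hσ in
theorem mul_sigma_inv {𝔞 : (FractionalIdeal (𝓞 K)⁰ K)ˣ} {x : K}
    (h : ∃ n : ℤ, x = algebraMap ℚ K (FractionalIdeal.absNorm
      ((𝔞⁻¹ : (FractionalIdeal (𝓞 K)⁰ K)ˣ) : FractionalIdeal (𝓞 K)⁰ K)) * n) :
    ∃ n : ℤ, algebraMap ℚ K (FractionalIdeal.absNorm (𝔞 : FractionalIdeal (𝓞 K)⁰ K)) * x = n := by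
  obtain ⟨n, hn⟩ := h
  refine ⟨n, ?_⟩
  rw [hn, ← mul_assoc, ← map_mul, absNorm_inv_mul, map_one, one_mul]

/-- An elementwise form of the inclusion N(𝔞)σ(𝔞⁻¹) ⊆ 𝔞, a part of 𝔞σ(𝔞) = (N(𝔞)). It suffices that
Nσ(x)y be integral for y in 𝔞⁻¹. -/
theorem absNorm_mul_sigma_mem {𝔞 : (FractionalIdeal (𝓞 K)⁰ K)ˣ} {x : K}
    (hx : x ∈ ((𝔞⁻¹ : (FractionalIdeal (𝓞 K)⁰ K)ˣ) : FractionalIdeal (𝓞 K)⁰ K)) :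
    algebraMap ℚ K (FractionalIdeal.absNorm (𝔞 : FractionalIdeal (𝓞 K)⁰ K)) * σ x ∈
      (𝔞 : FractionalIdeal (𝓞 K)⁰ K) := by
  apply mem_of_isIntegral_mul
  intro y hy
  set N := algebraMap ℚ K (FractionalIdeal.absNorm (𝔞 : FractionalIdeal (𝓞 K)⁰ K)) with hN
  have hσN : σ N = N := by rw [hN]; exact σ.commutes _
  obtain ⟨p, hp⟩ := mul_sigma_inv (trace_mul_sigma_mem hK hσ hx hy)
  obtain ⟨q, hq⟩ := mul_sigma_inv (mul_sigma_mem hK hσ hx)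
  obtain ⟨r, hr⟩ := mul_sigma_inv (mul_sigma_mem hK hσ hy)
  rw [← hN] at hp hq hr
  -- This polynomial has the conjugate roots Nσ(x)y and Nxσ(y), with sum p and product qr.
  refine ⟨Polynomial.X ^ 2 - Polynomial.C p * Polynomial.X + Polynomial.C (q * r), ?_, ?_⟩
  · monicity!
  · simp only [Polynomial.eval₂_add, Polynomial.eval₂_sub, Polynomial.eval₂_pow,
      Polynomial.eval₂_X, Polynomial.eval₂_mul, Polynomial.eval₂_C, algebraMap_int_eq, map_mul]
    simp only [eq_intCast]
    linear_combination (N * σ x * y) * hp - r * hq - N * x * σ x * hr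

theorem vact_mem_V {A : Matrix (Fin 2) (Fin 2) K} (hA : A ∈ V σ) (M : SL(2, K)) :
    vact σ M A ∈ V σ := by
  have hss : ∀ B : Matrix (Fin 2) (Fin 2) K, (B.map σ).map σ = B := by
    intro B; ext i j; simp [sigma_sigma hK hσ]
  have hA' : A.transpose = A.map σ := hA
  change (vact σ M A).transpose = (vact σ M A).map σ
  rw [vact, Matrix.transpose_mul, Matrix.transpose_mul, Matrix.transpose_transpose, hA',
    Matrix.map_mul, Matrix.map_mul, Matrix.transpose_map, hss, Matrix.mul_assoc]

theorem mem_V_iff {A : Matrix (Fin 2) (Fin 2) K} :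
    A ∈ V σ ↔ σ (A 0 0) = A 0 0 ∧ σ (A 1 0) = A 0 1 ∧ σ (A 0 1) = A 1 0 ∧ σ (A 1 1) = A 1 1 := by
  change A.transpose = A.map σ ↔ _
  rw [← Matrix.ext_iff]
  simp only [Fin.forall_fin_two, Matrix.transpose_apply, Matrix.map_apply]
  constructor
  · rintro ⟨⟨h1, h2⟩, h3, h4⟩; exact ⟨h1.symm, h3.symm, h2.symm, h4.symm⟩
  · rintro ⟨h1, h2, h3, h4⟩; exact ⟨⟨h1.symm, h3.symm⟩, h2.symm, h4.symm⟩

/-- Each entry is expanded and its terms are treated separately. The diagonal entries use that norms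
from 𝔞⁻¹ and 𝔞 lie in N(𝔞)⁻¹ℤ and N(𝔞)ℤ; the term of the lower left entry that contains b uses
`absNorm_mul_sigma_mem`. -/
theorem vact_mem_L {𝔞 : (FractionalIdeal (𝓞 K)⁰ K)ˣ} {A : Matrix (Fin 2) (Fin 2) K}
    (hA : A ∈ L σ 𝔞) {M : SL(2, K)} (hM : M ∈ Gam 𝔞) : vact σ M A ∈ L σ 𝔞 := by
  obtain ⟨hV, ⟨a, ha⟩, ⟨b, hb⟩, hl⟩ := hA
  obtain ⟨h1, h2, h3, h4⟩ := hM
  have hV' := vact_mem_V hK hσ hV M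
  rw [mem_one_iff_isIntegral] at h1 h4
  have i1 := isIntegral_sigma (σ := σ) h1
  have i4 := isIntegral_sigma (σ := σ) h4
  set N := algebraMap ℚ K (FractionalIdeal.absNorm (𝔞 : FractionalIdeal (𝓞 K)⁰ K)) with hN
  rw [map_mul, ← hN, map_intCast] at hb
  have hVA := (mem_V_iff hK hσ).1 hV
  refine ⟨hV', ?_, ?_, ?_⟩
  · apply eq_int_of_fixed hK hσ ((mem_V_iff hK hσ).1 hV').1
    simp only [vact, Matrix.mul_apply, Fin.sum_univ_two, Matrix.transpose_apply, Matrix.map_apply]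
    obtain ⟨n, hn⟩ := mul_sigma_inv (mul_sigma_mem hK hσ h2)
    have e1 : IsIntegral ℤ (A 1 0 * M 0 1) := isIntegral_mul_of_mem_inv hl h2
    have e2 := isIntegral_sigma (σ := σ) e1
    rw [map_mul, hVA.2.1] at e2
    have e3 : IsIntegral ℤ (M 0 1 * A 1 1 * σ (M 0 1)) := by
      have : M 0 1 * A 1 1 * σ (M 0 1) = (n * b : ℤ) := by
        rw [hb]; push_cast; rw [← hn]; ring
      rw [this]; exact isIntegral_intCast _
    have e4 : IsIntegral ℤ (M 0 0 * A 0 0 * σ (M 0 0)) := by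
      rw [ha]; exact (h1.mul (isIntegral_intCast _)).mul i1
    have : IsIntegral ℤ (M 0 0 * A 0 0 * σ (M 0 0) + (A 1 0 * M 0 1) * σ (M 0 0) +
        M 0 0 * (A 0 1 * σ (M 0 1)) + M 0 1 * A 1 1 * σ (M 0 1)) :=
      ((e4.add (e1.mul i1)).add (h1.mul e2)).add e3
    convert this using 1; ring
  · simp only [vact, Matrix.mul_apply, Fin.sum_univ_two, Matrix.transpose_apply, Matrix.map_apply]
    obtain ⟨n, hn⟩ := mul_sigma_mem hK hσ h3
    obtain ⟨k, hk⟩ := trace_mul_sigma_mem hK hσ (mul_mem_of_isIntegral h4 hl) h3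
    obtain ⟨r, hr⟩ := eq_int_of_fixed hK hσ (x := M 1 1 * σ (M 1 1))
      (by rw [map_mul, sigma_sigma hK hσ]; ring) (h4.mul i4)
    rw [map_mul, hVA.2.1] at hk
    refine ⟨n * a + k + r * b, ?_⟩
    rw [map_mul, ← hN, map_intCast]
    rw [← hN] at hn hk
    rw [ha, hb]; push_cast
    linear_combination a * hn + hk + N * b * hr
  · simp only [vact, Matrix.mul_apply, Fin.sum_univ_two, Matrix.transpose_apply, Matrix.map_apply]
    have e1 : IsIntegral ℤ (A 1 0 * M 0 1) := isIntegral_mul_of_mem_inv hl h2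
    have e2 := isIntegral_sigma (σ := σ) e1
    rw [map_mul, hVA.2.1] at e2
    have e5 : (a * σ (M 0 0)) * M 1 0 + (A 0 1 * σ (M 0 1)) * M 1 0 +
        (M 1 1 * σ (M 0 0)) * A 1 0 + (b * M 1 1) * (N * σ (M 0 1)) ∈
        (𝔞 : FractionalIdeal (𝓞 K)⁰ K) :=
      frac_add_mem (frac_add_mem (frac_add_mem
        (mul_mem_of_isIntegral ((isIntegral_intCast _).mul i1) h3) (mul_mem_of_isIntegral e2 h3))
        (mul_mem_of_isIntegral (h4.mul i1) hl))
        (mul_mem_of_isIntegral ((isIntegral_intCast _).mul h4) (absNorm_mul_sigma_mem hK hσ h2))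
    convert e5 using 1
    rw [ha, hb]; ring

/-- The bilinear form is invariant, so M moves to the other argument as M⁻¹, which preserves the
lattice. -/
theorem vact_mem_Ldual {𝔞 : (FractionalIdeal (𝓞 K)⁰ K)ˣ} {A : Matrix (Fin 2) (Fin 2) K}
    (hA : A ∈ Ldual σ 𝔞) {M : SL(2, K)} (hM : M ∈ Gam 𝔞) : vact σ M A ∈ Ldual σ 𝔞 := by
  refine ⟨vact_mem_V hK hσ hA.1 M, fun B hB => ?_⟩
  obtain ⟨n, hn⟩ := hA.2 (vact σ M⁻¹ B) (vact_mem_L hK hσ hB (inv_mem hM))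
  refine ⟨n, ?_⟩
  have h1 : vact σ M A + B = vact σ M (A + vact σ M⁻¹ B) := by
    have : vact σ M (vact σ M⁻¹ B) = B := by rw [← vact_mul, mul_inv_cancel, vact_one]
    conv_lhs => rw [← this]
    simp only [vact, Matrix.mul_add, Matrix.add_mul]
  rw [h1, det_vact, det_vact, ← hn, det_vact]

omit hK hσ in
theorem neg_mem_Ldual {𝔞 : (FractionalIdeal (𝓞 K)⁰ K)ˣ} {A : Matrix (Fin 2) (Fin 2) K}
    (hA : A ∈ Ldual σ 𝔞) : -A ∈ Ldual σ 𝔞 := by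
  obtain ⟨hV, h⟩ := hA
  have hV' : A.transpose = A.map σ := hV
  refine ⟨?_, fun B hB => ?_⟩
  · change (-A).transpose = (-A).map σ
    rw [Matrix.transpose_neg, hV']; ext i j; simp
  · obtain ⟨n, hn⟩ := h B hB
    refine ⟨-n, ?_⟩
    push_cast
    rw [← hn]
    simp only [Matrix.det_fin_two, Matrix.add_apply, Matrix.neg_apply]
    ring

theorem vact_mem_Lm {𝔞 : (FractionalIdeal (𝓞 K)⁰ K)ˣ} {m : ℕ} {A : Matrix (Fin 2) (Fin 2) K}
    (hA : A ∈ Lm σ 𝔞 m) {M : SL(2, K)} (hM : M ∈ Gam 𝔞) : vact σ M A ∈ Lm σ 𝔞 m :=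
  ⟨vact_mem_Ldual hK hσ hA.1 hM, by rw [det_vact]; exact hA.2⟩

omit hK hσ in
theorem neg_mem_Lm {𝔞 : (FractionalIdeal (𝓞 K)⁰ K)ˣ} {m : ℕ} {A : Matrix (Fin 2) (Fin 2) K}
    (hA : A ∈ Lm σ 𝔞 m) : -A ∈ Lm σ 𝔞 m :=
  ⟨neg_mem_Ldual hA.1, by rw [Matrix.det_neg, hA.2]; simp⟩

omit hσ in
theorem exists_det_pos (σ : K ≃ₐ[ℚ] K) (ι : K →+* ℝ) (𝔞 : (FractionalIdeal (𝓞 K)⁰ K)ˣ) {m : ℕ} (hm : 0 < m) :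
    ∃ d : ℝ, 0 < d ∧ ∀ A ∈ Lm σ 𝔞 m, ι A.det = d := by
  have h1 := absNorm_unit_pos 𝔞
  have h2 := discr_pos hK ι
  refine ⟨((m / (FractionalIdeal.absNorm (𝔞 : FractionalIdeal (𝓞 K)⁰ K) *
    NumberField.discr K) : ℚ) : ℝ), ?_, fun A hA => ?_⟩
  · have h3 : (0 : ℚ) < NumberField.discr K := by exact_mod_cast h2
    have h4 : (0 : ℚ) < m := by exact_mod_cast hm
    have : (0 : ℚ) < m / (FractionalIdeal.absNorm (𝔞 : FractionalIdeal (𝓞 K)⁰ K) *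
      NumberField.discr K) := by positivity
    exact_mod_cast this
  · rw [hA.2, eq_ratCast, map_ratCast]

/-- The exact dual lattice is not needed, only a common denominator. It comes from pairing with
diagonal test vectors and with the antidiagonal ones for μ = k and μ = αk, where k is a positive
integer in 𝔞. -/
theorem exists_denom_Ldual (ι : K →+* ℝ) (𝔞 : (FractionalIdeal (𝓞 K)⁰ K)ˣ) :
    ∃ n : ℕ, 0 < n ∧ ∀ A ∈ Ldual σ 𝔞, ∀ i j, IsIntegral ℤ (n * A i j) := by
  obtain ⟨α, δ, h1, h2, h3, h4, h5, h6⟩ := exists_sqrt hK hσ ι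
  have hα : α ≠ 0 := by rintro rfl; simp at h2
  have hNpos := absNorm_unit_pos 𝔞
  set Nq := FractionalIdeal.absNorm (𝔞 : FractionalIdeal (𝓞 K)⁰ K) with hNq
  obtain ⟨x, hx, hx0⟩ : ∃ x ∈ (𝔞 : FractionalIdeal (𝓞 K)⁰ K), x ≠ 0 := by
    by_contra! h
    exact 𝔞.ne_zero (FractionalIdeal.eq_zero_iff.2 h)
  obtain ⟨k, hk, hki⟩ := exists_nat_mul_isIntegral x⁻¹
  have hka : (k : K) ∈ (𝔞 : FractionalIdeal (𝓞 K)⁰ K) := by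
    have := mul_mem_of_isIntegral hki hx
    rwa [mul_assoc, inv_mul_cancel₀ hx0, mul_one] at this
  obtain ⟨c, hc, hci⟩ := exists_nat_mul_isIntegral (algebraMap ℚ K Nq)⁻¹
  have hN0 : algebraMap ℚ K Nq ≠ 0 := by simpa using hNpos.ne'
  have hci' : ∀ t : K, IsIntegral ℤ (algebraMap ℚ K Nq * t) →
      IsIntegral ℤ (Nq.num.natAbs * t) := by
    intro t ht
    have : ((Nq.num.natAbs : ℕ) : K) * t = Nq.den * (algebraMap ℚ K Nq * t) := by
      have e : (Nq.num.natAbs : ℚ) = Nq.den * Nq := by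
        rw [mul_comm, Rat.mul_den_eq_num]
        have : ((Nq.num.natAbs : ℤ) : ℚ) = Nq.num := by
          rw [Int.natAbs_of_nonneg (Rat.num_nonneg.2 hNpos.le)]
        rwa [Int.cast_natCast] at this
      have e2 := congrArg (algebraMap ℚ K) e
      rw [map_mul, map_natCast, map_natCast] at e2
      rw [e2, mul_assoc]
    rw [this]
    exact (isIntegral_natCast _).mul ht
  have hnum : 0 < Nq.num.natAbs := Int.natAbs_pos.2 (Rat.num_pos.2 hNpos).ne'
  have hδ0 : 0 < δ.toNat := by omega
  refine ⟨Nq.num.natAbs * (2 * k * δ.toNat), by positivity, ?_⟩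
  rintro A ⟨hV, hA⟩
  have hVA := (mem_V_iff hK hσ).1 hV
  have b1 : IsIntegral ℤ (A 1 1) := by
    obtain ⟨n, hn⟩ := hA !![1, 0; 0, 0] ⟨(mem_V_iff hK hσ).2 (by simp), ⟨1, by simp⟩,
      ⟨0, by simp⟩, by simp [FractionalIdeal.zero_mem]⟩
    have : A 1 1 = n := by
      rw [← hn]; simp [Matrix.det_fin_two]; ring
    rw [this]; exact isIntegral_intCast _
  have a1 : IsIntegral ℤ (algebraMap ℚ K Nq * A 0 0) := by
    obtain ⟨n, hn⟩ := hA !![0, 0; 0, algebraMap ℚ K Nq] ⟨(mem_V_iff hK hσ).2 (by simp),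
      ⟨0, by simp⟩, ⟨1, by simp [hNq]⟩, by simp [FractionalIdeal.zero_mem]⟩
    have : algebraMap ℚ K Nq * A 0 0 = n := by
      rw [← hn]; simp only [Matrix.det_fin_two, Matrix.add_apply]; simp; ring
    rw [this]; exact isIntegral_intCast _
  have l1 : ∀ μ ∈ (𝔞 : FractionalIdeal (𝓞 K)⁰ K), IsIntegral ℤ (A 1 0 * σ μ + A 0 1 * μ) := by
    intro μ hμ
    obtain ⟨n, hn⟩ := hA !![0, σ μ; μ, 0] ⟨(mem_V_iff hK hσ).2 (by simp [sigma_sigma hK hσ]),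
      ⟨0, by simp⟩, ⟨0, by simp⟩, by simpa using hμ⟩
    have : A 1 0 * σ μ + A 0 1 * μ = (-n : ℤ) := by
      push_cast; rw [← hn]; simp only [Matrix.det_fin_two, Matrix.add_apply]; simp; ring
    rw [this]; exact isIntegral_intCast _
  -- Since σ(α) = -α and α² = δ, the combination of δ times the first pairing and -α times the
  -- second eliminates A 0 1.
  have lam : IsIntegral ℤ (2 * k * δ.toNat * A 1 0) := by
    have e1 := l1 k hka
    have e2 := l1 (α * k) (mul_mem_of_isIntegral h3 hka)
    have hδ : ((δ.toNat : ℕ) : K) = α ^ 2 := by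
      rw [h5]; exact_mod_cast congrArg (Int.cast (R := K)) (Int.toNat_of_nonneg h4.le)
    have e3 := ((isIntegral_natCast (K := K) δ.toNat).mul e1).sub (h3.mul e2)
    have e4 : (2 * k * δ.toNat * A 1 0 : K) = δ.toNat * (A 1 0 * σ k + A 0 1 * k) -
        α * (A 1 0 * σ (α * k) + A 0 1 * (α * k)) := by
      rw [hδ]; simp only [map_mul, map_natCast, h1]; ring
    rw [e4]; exact e3
  have lam2 := isIntegral_sigma (σ := σ) lam
  simp only [map_mul, map_natCast, map_ofNat, hVA.2.1] at lam2
  have i2 : IsIntegral ℤ (2 * k * δ.toNat : K) := by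
    exact_mod_cast isIntegral_natCast (K := K) (2 * k * δ.toNat)
  intro i j
  push_cast
  fin_cases i <;> fin_cases j <;> simp only [Fin.zero_eta, Fin.mk_one, Fin.isValue]
  · rw [mul_comm (Nq.num.natAbs : K), mul_assoc]; exact i2.mul (hci' _ a1)
  · rw [mul_assoc]; exact (isIntegral_natCast _).mul lam2
  · rw [mul_assoc]; exact (isIntegral_natCast _).mul lam
  · exact ((isIntegral_natCast _).mul i2).mul b1

omit hK hσ in
theorem exists_denom_matrix (M : Matrix (Fin 2) (Fin 2) K) :
    ∃ n : ℕ, 0 < n ∧ ∀ i j, IsIntegral ℤ (n * M i j) := by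
  choose f hf hfi using fun p : Fin 2 × Fin 2 => exists_nat_mul_isIntegral (M p.1 p.2)
  refine ⟨∏ p, f p, Finset.prod_pos fun p _ => hf p, fun i j => ?_⟩
  rw [← Finset.prod_erase_mul _ _ (Finset.mem_univ (i, j))]
  push_cast
  rw [mul_assoc]
  refine IsIntegral.mul ?_ (hfi (i, j))
  exact_mod_cast isIntegral_natCast (K := K) _

/-- A matrix N that moves a cusp need not preserve the lattice, but denominators stay bounded; M
enters twice, hence the factor k². -/
theorem exists_denom_vact (ι : K →+* ℝ) (𝔞 : (FractionalIdeal (𝓞 K)⁰ K)ˣ) (M : SL(2, K)) :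
    ∃ n : ℕ, 0 < n ∧ ∀ A ∈ Ldual σ 𝔞, ∀ i j, IsIntegral ℤ (n * vact σ M A i j) := by
  obtain ⟨n, hn, h⟩ := exists_denom_Ldual hK hσ ι 𝔞
  obtain ⟨k, hk, h'⟩ := exists_denom_matrix (M : Matrix (Fin 2) (Fin 2) K)
  refine ⟨k * n * k, by positivity, fun A hA i j => ?_⟩
  simp only [vact, Matrix.mul_apply, Matrix.transpose_apply, Matrix.map_apply,
    Finset.mul_sum, Finset.sum_mul]
  refine IsIntegral.sum _ fun x _ => IsIntegral.sum _ fun y _ => ?_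
  have := ((h' i y).mul (h A hA y x)).mul (isIntegral_sigma (σ := σ) (h' j x))
  convert this using 1
  push_cast [map_mul, map_natCast]; ring

end Lattice

end

section

/-! ### Transversals of countable equivalence relations -/

section Transversal

variable {α : Type*} [MeasurableSpace α]

/-- Cut E into pieces according to the first n with T n x in F and move each piece into F. The
images are disjoint because E contains at most one point of each class. -/
theorem measure_le_of_transversal (r : Setoid α) (μ : Measure α) {E F : Set α}
    (hE : MeasurableSet E) (hF : MeasurableSet F) (hinj : Set.InjOn (Quotient.mk r) E)
    (T : ℕ → α ≃ᵐ α) (hT : ∀ n, MeasurePreserving (T n) μ μ) (hr : ∀ n x, r (T n x) x)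
    (hcov : ∀ᵐ x ∂μ, ∃ n, T n x ∈ F) {B : Set (Quotient r)}
    (hB : MeasurableSet (Quotient.mk r ⁻¹' B)) :
    μ (E ∩ Quotient.mk r ⁻¹' B) ≤ μ (F ∩ Quotient.mk r ⁻¹' B) := by
  set S : ℕ → Set α := fun n => E ∩ Quotient.mk r ⁻¹' B ∩ T n ⁻¹' F with hS
  have hSm : ∀ n, MeasurableSet (S n) := fun n => (hE.inter hB).inter ((T n).measurable hF)
  have hDm : ∀ n, MeasurableSet (disjointed S n) := fun n => MeasurableSet.disjointed hSm n
  have hDS : ∀ n, disjointed S n ⊆ S n := fun n => disjointed_subset S n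
  calc μ (E ∩ Quotient.mk r ⁻¹' B) ≤ μ (⋃ n, disjointed S n) := by
        apply measure_mono_ae
        filter_upwards [hcov] with x hx hxE
        rw [iUnion_disjointed]
        obtain ⟨n, hn⟩ := hx
        exact Set.mem_iUnion.2 ⟨n, hxE, hn⟩
    _ = ∑' n, μ (disjointed S n) := measure_iUnion (disjoint_disjointed S) hDm
    _ = ∑' n, μ (T n '' disjointed S n) := by
        congr 1; ext n
        rw [← (hT n).measure_preimage_equiv (T n '' disjointed S n),
          Set.preimage_image_eq _ (T n).injective]
    _ = μ (⋃ n, T n '' disjointed S n) := by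
        rw [measure_iUnion _ fun n => (T n).measurableSet_image.2 (hDm n)]
        intro i j hij
        rw [Function.onFun, Set.disjoint_left]
        rintro _ ⟨x, hx, rfl⟩ ⟨y, hy, hxy⟩
        have h1 : x = y := hinj (hDS i hx).1.1 (hDS j hy).1.1 <| Quotient.sound <|
          r.trans (r.symm (hr i x)) (hxy ▸ hr j y)
        subst h1
        exact Set.disjoint_left.1 (disjoint_disjointed S hij) hx hy
    _ ≤ μ (F ∩ Quotient.mk r ⁻¹' B) := by
        apply measure_mono
        rintro y hy
        obtain ⟨n, x, hx, rfl⟩ := Set.mem_iUnion.1 hy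
        refine ⟨(hDS n hx).2, ?_⟩
        have h1 : Quotient.mk r (T n x) = Quotient.mk r x := Quotient.sound (hr n x)
        simp only [Set.mem_preimage]
        rw [h1]
        exact (hDS n hx).1.2

/-- The quotient measure is the image of the measure on a transversal. -/
theorem quotientMeasure_eq_map (r : Setoid α) (μ : Measure α) {F : Set α}
    (hF : MeasurableSet F) (hinj : Set.InjOn (Quotient.mk r) F) {κ : Type*} [Countable κ]
    [Nonempty κ] (T : κ → α ≃ᵐ α) (hT : ∀ n, MeasurePreserving (T n) μ μ)
    (hr : ∀ n x, r (T n x) x) (hcov : ∀ᵐ x ∂μ, ∃ n, T n x ∈ F) :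
    quotientMeasure r μ = (μ.restrict F).map (Quotient.mk r) := by
  obtain ⟨e, he⟩ := exists_surjective_nat κ
  have hmk : Measurable (Quotient.mk r) := fun s hs => hs
  -- Every competitor E in the supremum is dominated by F, and F is itself a competitor.
  apply le_antisymm
  · refine iSup_le fun E => Measure.le_iff.2 fun B hB => ?_
    rw [Measure.map_apply hmk hB, Measure.map_apply hmk hB, Measure.restrict_apply (hmk hB),
      Measure.restrict_apply (hmk hB), Set.inter_comm, Set.inter_comm _ F]
    refine measure_le_of_transversal r μ E.2.1 hF E.2.2 (fun n => T (e n)) (fun n => hT _)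
      (fun n => hr _) ?_ (hmk hB)
    filter_upwards [hcov] with x ⟨k, hk⟩
    obtain ⟨n, rfl⟩ := he k
    exact ⟨n, hk⟩
  · exact le_iSup (fun E : {E : Set α // MeasurableSet E ∧ Set.InjOn (Quotient.mk r) E} =>
      (μ.restrict (E : Set α)).map (Quotient.mk r)) ⟨F, hF, hinj⟩

theorem quotientMeasure_univ (r : Setoid α) (μ : Measure α) {F : Set α}
    (hF : MeasurableSet F) (hinj : Set.InjOn (Quotient.mk r) F) {κ : Type*} [Countable κ]
    [Nonempty κ] (T : κ → α ≃ᵐ α) (hT : ∀ n, MeasurePreserving (T n) μ μ)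
    (hr : ∀ n x, r (T n x) x) (hcov : ∀ᵐ x ∂μ, ∃ n, T n x ∈ F) :
    quotientMeasure r μ Set.univ = μ F := by
  have hmk : Measurable (Quotient.mk r) := fun s hs => hs
  rw [quotientMeasure_eq_map r μ hF hinj T hT hr hcov, Measure.map_apply hmk MeasurableSet.univ]
  simp

theorem exists_injective_measurable_real [MeasurableSpace.CountablySeparated α] :
    ∃ t : α → ℝ, Measurable t ∧ Function.Injective t := by
  obtain ⟨f, hf, hfi⟩ := MeasurableSpace.measurable_injection_nat_bool_of_countablySeparated α
  obtain ⟨h, hh⟩ := exists_measurableEmbedding_real (ℕ → Bool)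
  exact ⟨h ∘ f, hh.measurable.comp hf, hh.injective.comp hfi⟩

/-- A countable family of maps whose orbits meet the sublevel sets of a function `D` in finite sets
has a measurable transversal: take the points where `D` is smallest. -/
theorem exists_transversal [MeasurableSpace.CountablySeparated α] {κ : Type*} [Countable κ]
    (T : κ → α → α) (hT : ∀ n, Measurable (T n)) (r : Setoid α)
    (hr : ∀ x y, r x y ↔ ∃ n, T n x = y) (D : α → ℝ) (hD : Measurable D)
    (hfin : ∀ x C, {y | r x y ∧ D y ≤ C}.Finite) :
    ∃ F : Set α, MeasurableSet F ∧ (∀ x ∈ F, ∀ y ∈ F, r x y → x = y) ∧ ∀ x, ∃ n, T n x ∈ F := by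
  obtain ⟨t, ht, hti⟩ := exists_injective_measurable_real (α := α)
  -- Ties of D are broken by the injective function t, so a minimum on an orbit is attained at one
  -- point only.
  let f : α → ℝ ×ₗ ℝ := fun x => toLex (D x, t x)
  have hf : ∀ x y, f x ≤ f y ↔ D x < D y ∨ D x = D y ∧ t x ≤ t y := fun x y =>
    Prod.Lex.toLex_le_toLex
  refine ⟨{x | ∀ n, f x ≤ f (T n x)}, ?_, ?_, ?_⟩
  · simp only [hf, Set.ofPred_forall, Set.ofPred_or, Set.ofPred_and]
    refine MeasurableSet.iInter fun n => ?_
    exact (measurableSet_lt hD (hD.comp (hT n))).union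
      ((measurableSet_eq_fun hD (hD.comp (hT n))).inter (measurableSet_le ht (ht.comp (hT n))))
  · intro x hx y hy hxy
    obtain ⟨n, hn⟩ := (hr x y).1 hxy
    obtain ⟨k, hk⟩ := (hr y x).1 (r.symm hxy)
    have h1 := hx n
    have h2 := hy k
    rw [hn] at h1
    rw [hk] at h2
    have h3 := le_antisymm h1 h2
    have h4 : (D x, t x) = (D y, t y) := h3
    exact hti (Prod.ext_iff.1 h4).2
  · intro x
    -- Points of the orbit with D larger than D x cannot be minimal, so a finite set remains, and it
    -- contains x.
    obtain ⟨y, hy, hmin⟩ := Set.exists_min_image {y | r x y ∧ D y ≤ D x} f (hfin x (D x))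
      ⟨x, r.refl x, le_rfl⟩
    obtain ⟨n, hn⟩ := (hr x y).1 hy.1
    refine ⟨n, fun k => ?_⟩
    rw [hn]
    have h1 : r x (T k y) := r.trans hy.1 ((hr _ _).2 ⟨k, rfl⟩)
    rcases le_or_gt (D (T k y)) (D x) with h | h
    · exact hmin _ ⟨h1, h⟩
    · exact (hf _ _).2 (Or.inl (hy.2.trans_lt h))

end Transversal

/-! ### The measure `eta` -/

theorem measurePreserving_gl (M : GL (Fin 2) ℝ) :
    MeasurePreserving (fun z : ℍ => M • z) eta eta :=
  (measurePreserving_smul M (volume : Measure ℍ)).smul_measure _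

theorem measurePreserving_sl (M : SL(2, ℝ)) :
    MeasurePreserving (fun z : ℍ => M • z) eta eta :=
  measurePreserving_gl (M : GL (Fin 2) ℝ)

instance : SigmaFinite eta :=
  inferInstanceAs (SigmaFinite (Real.toNNReal (1 / (4 * Real.pi)) • (volume : Measure ℍ)))

instance : NullSingletonClass eta := by
  refine ⟨fun z => ?_⟩
  have : (volume : Measure ℍ) {z} = 0 := by
    rw [UpperHalfPlane.volume_eq_lintegral]; simp
  simp [eta, this]

theorem eta_univ_ne_zero : eta ≠ 0 := by
  intro h
  have h1 : eta (Metric.ball UpperHalfPlane.I 1) = 0 := by rw [h]; simp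
  have h2 : (volume : Measure ℍ) (Metric.ball UpperHalfPlane.I 1) = 0 := by
    rw [eta, Measure.smul_apply, smul_eq_mul, mul_eq_zero] at h1
    refine h1.resolve_left ?_
    rw [ENNReal.ofReal_eq_zero, not_le]; positivity
  rw [UpperHalfPlane.volume_eq_lintegral, setLIntegral_eq_zero_iff] at h2
  · have h3 : volume (UpperHalfPlane.coe '' Metric.ball UpperHalfPlane.I 1) = 0 := by
      refine measure_mono_null ?_ h2
      rintro _ ⟨w, hw, rfl⟩
      intro h
      have := h ⟨w, hw, rfl⟩
      have h5 := w.im_pos.ne'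
      simp [h5] at this
    exact (UpperHalfPlane.isOpenEmbedding_coe.isOpenMap _ Metric.isOpen_ball).measure_ne_zero _
      ⟨_, UpperHalfPlane.I, Metric.mem_ball_self one_pos, rfl⟩ h3
  · exact UpperHalfPlane.measurableEmbedding_coe.measurableSet_image.2 Metric.isOpen_ball.measurableSet
  · fun_prop

/-- A noncentral matrix of positive determinant with a fixed point in ℍ is elliptic, and then its
fixed point is unique. -/
theorem subsingleton_fixed {M : GL (Fin 2) ℝ} (h : 0 < M.val.det)
    (hM : M ∉ Subgroup.center _) : {z : ℍ | M • z = z}.Subsingleton := by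
  intro z hz w hw
  have hell := UpperHalfPlane.isElliptic_of_exists_smul_eq_self h hM ⟨z, hz⟩
  rw [(UpperHalfPlane.gl_smul_eq_self_iff_eq_fixedPt h hell).1 hz,
    (UpperHalfPlane.gl_smul_eq_self_iff_eq_fixedPt h hell).1 hw]

theorem eta_fixed_eq_zero {M : GL (Fin 2) ℝ} (h : 0 < M.val.det)
    (hM : M ∉ Subgroup.center _) : eta {z : ℍ | M • z = z} = 0 :=
  (subsingleton_fixed h hM).measure_zero eta

/-- The orbit map g ↦ g·i on SL₂(ℝ) is proper. Writing z = h·i, the matrices Mh lie in a compact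
set, hence so do the M. -/
theorem exists_entry_bound (z : ℍ) (C : ℝ) :
    ∃ B : ℝ, ∀ M : SL(2, ℝ), dist (M • z) UpperHalfPlane.I ≤ C → ∀ i j, |M i j| ≤ B := by
  have h1 : IsCompact ((fun g : SL(2, ℝ) => g • UpperHalfPlane.I) ⁻¹'
      Metric.closedBall UpperHalfPlane.I C) :=
    UpperHalfPlane.isProperMap_smul_I.isCompact_preimage (isCompact_closedBall _ _)
  have h2 : ∀ i j, ∃ B : ℝ, ∀ M : SL(2, ℝ), dist (M • z) UpperHalfPlane.I ≤ C → |M i j| ≤ B := by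
    intro i j
    obtain ⟨B, hB⟩ := (h1.image_of_continuousOn (f := fun g : SL(2, ℝ) => (g * z.toSL2R⁻¹) i j)
      (by fun_prop)).isBounded.exists_norm_le
    refine ⟨B, fun M hM => ?_⟩
    have := hB (M i j) ⟨M * z.toSL2R, ?_, by simp⟩
    · exact this
    · simpa [mul_smul] using hM
  choose B hB using h2
  refine ⟨∑ i, ∑ j, |B i j|, fun M hM i j => (hB i j M hM).trans ?_⟩
  refine (le_abs_self _).trans ?_
  refine (Finset.single_le_sum (f := fun j => |B i j|) (fun j _ => abs_nonneg _)
    (Finset.mem_univ j)).trans ?_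
  exact Finset.single_le_sum (f := fun i => ∑ j, |B i j|)
    (fun i _ => Finset.sum_nonneg fun j _ => abs_nonneg _) (Finset.mem_univ i)

/-! ### The action of the Hilbert modular group on `ℍ × ℍ` -/

variable {K : Type*} [Field K] [NumberField K]

theorem countable_numberField : Countable K := by
  have := Module.Finite.finite_basis (Module.finBasis ℚ K)
  exact (Module.finBasis ℚ K).equivFun.toEquiv.countable_iff.2 inferInstance

instance : Countable SL(2, K) := by
  have : Countable K := countable_numberField
  have : Countable (Matrix (Fin 2) (Fin 2) K) := inferInstanceAs (Countable (Fin 2 → Fin 2 → K))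
  exact Subtype.countable

variable (ι : K →+* ℝ) (σ : K ≃ₐ[ℚ] K)

theorem measurable_act (M : SL(2, K)) : Measurable (act ι σ M) :=
  ((measurePreserving_sl _).measurable.comp measurable_fst).prodMk
    ((measurePreserving_sl _).measurable.comp measurable_snd)

/-- The action of a matrix on `ℍ × ℍ` as a measurable equivalence. -/
def actEquiv (M : SL(2, K)) : ℍ × ℍ ≃ᵐ ℍ × ℍ where
  toFun := act ι σ M
  invFun := act ι σ M⁻¹
  left_inv z := by rw [← act_mul, inv_mul_cancel, act_one]
  right_inv z := by rw [← act_mul, mul_inv_cancel, act_one]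
  measurable_toFun := measurable_act ι σ M
  measurable_invFun := measurable_act ι σ M⁻¹

theorem measurePreserving_act (M : SL(2, K)) :
    MeasurePreserving (act ι σ M) omegaSq omegaSq :=
  ((measurePreserving_sl (Matrix.SpecialLinearGroup.map ι M)).prod
    (measurePreserving_sl (Matrix.SpecialLinearGroup.map (ι.comp (σ : K →+* K)) M))).smul_measure _

theorem act_neg (M : SL(2, K)) (z : ℍ × ℍ) : act ι σ (-M) z = act ι σ M z := by
  rw [act, act]
  congr 1
  · ext1; rw [coe_sl_smul, coe_sl_smul, ← neg_div_neg_eq]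
    simp [add_comm]
  · ext1; rw [coe_sl_smul, coe_sl_smul, ← neg_div_neg_eq]
    simp [add_comm]

theorem neg_mem_Gam {𝔞 : (FractionalIdeal (𝓞 K)⁰ K)ˣ} {M : SL(2, K)} (hM : M ∈ Gam 𝔞) :
    -M ∈ Gam 𝔞 := by
  obtain ⟨h1, h2, h3, h4⟩ := hM
  exact ⟨frac_neg_mem h1, frac_neg_mem h2, frac_neg_mem h3, frac_neg_mem h4⟩

theorem one_or_neg_one_of_center (φ : K →+* ℝ) (M : SL(2, K))
    (h : ((Matrix.SpecialLinearGroup.map φ M : SL(2, ℝ)) : GL (Fin 2) ℝ) ∈ Subgroup.center _) :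
    M = 1 ∨ M = -1 := by
  rw [Matrix.GeneralLinearGroup.mem_center_iff_val_mem_range_scalar] at h
  obtain ⟨c, hc⟩ := h
  have e := fun i j => congrFun (congrFun hc i) j
  have e00 := e 0 0
  have e01 := e 0 1
  have e10 := e 1 0
  have e11 := e 1 1
  simp at e00 e01 e10 e11
  have e01 : M 0 1 = 0 := φ.injective (by rw [map_zero]; exact e01.symm)
  have e10 : M 1 0 = 0 := φ.injective (by rw [map_zero]; exact e10.symm)
  have hd := M.det_coe
  rw [Matrix.det_fin_two] at hd
  have e2 : M 0 0 = M 1 1 := φ.injective (e00.symm.trans e11)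
  rw [e01, e2] at hd
  have h3 : (M 1 1 - 1) * (M 1 1 + 1) = 0 := by linear_combination hd
  rcases mul_eq_zero.1 h3 with h | h
  · left
    ext i j
    fin_cases i <;> fin_cases j <;> simp [e01, e10, e2, sub_eq_zero.1 h]
  · right
    ext i j
    fin_cases i <;> fin_cases j <;> simp [e01, e10, e2, eq_neg_of_add_eq_zero_left h]

/-- There are countably many matrices over K, and each one other than ±1 fixes at most one point. -/
theorem ae_stab_trivial (φ : K →+* ℝ) : ∀ᵐ z ∂eta, ∀ M : SL(2, K),
    Matrix.SpecialLinearGroup.map φ M • z = z → M = 1 ∨ M = -1 := by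
  rw [ae_all_iff]
  intro M
  by_cases h : ((Matrix.SpecialLinearGroup.map φ M : SL(2, ℝ)) : GL (Fin 2) ℝ) ∈ Subgroup.center _
  · exact Filter.Eventually.of_forall fun z _ => one_or_neg_one_of_center φ M h
  · have h1 : eta {z : ℍ | ((Matrix.SpecialLinearGroup.map φ M : SL(2, ℝ)) : GL (Fin 2) ℝ) • z = z}
        = 0 := by
      refine eta_fixed_eq_zero ?_ h
      rw [← Matrix.GeneralLinearGroup.val_det_apply]
      simp
    filter_upwards [measure_eq_zero_iff_ae_notMem.1 h1] with z hz hz'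
    exact absurd hz' hz

theorem ae_snd {p : ℍ → Prop} (h : ∀ᵐ z ∂eta, p z) : ∀ᵐ x ∂omegaSq, p x.2 := by
  have h1 : ∀ᵐ x ∂(eta.prod eta), p x.2 := Measure.quasiMeasurePreserving_snd.ae h
  exact Measure.ae_smul_measure h1 _

theorem ae_act_stab_trivial : ∀ᵐ x ∂omegaSq, ∀ M : SL(2, K),
    act ι σ M x = x → M = 1 ∨ M = -1 := by
  filter_upwards [ae_snd (ae_stab_trivial (ι.comp (σ : K →+* K)))] with x hx M hM
  exact hx M (congrArg Prod.snd hM)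

theorem exists_nat_mul_mem (I : FractionalIdeal (𝓞 K)⁰ K) :
    ∃ n : ℕ, 0 < n ∧ ∀ x ∈ I, IsIntegral ℤ (n * x) := by
  obtain ⟨a, ha, h⟩ := I.isFractional
  have ha0 : (algebraMap (𝓞 K) K a) ≠ 0 := by
    simpa using nonZeroDivisors.ne_zero ha
  obtain ⟨n, hn, hi⟩ := exists_nat_mul_isIntegral (algebraMap (𝓞 K) K a)⁻¹
  refine ⟨n, hn, fun x hx => ?_⟩
  obtain ⟨y, hy⟩ := h x hx
  have h1 : IsIntegral ℤ (algebraMap (𝓞 K) K a * x) := by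
    rw [Algebra.smul_def] at hy
    rw [← hy]; exact y.isIntegral_coe
  have h2 := hi.mul h1
  rwa [show (n : K) * (algebraMap (𝓞 K) K a)⁻¹ * (algebraMap (𝓞 K) K a * x) = n * x by
    field_simp] at h2

theorem exists_denom_Gam (𝔞 : (FractionalIdeal (𝓞 K)⁰ K)ˣ) :
    ∃ n : ℕ, 0 < n ∧ ∀ M ∈ Gam 𝔞, ∀ i j, IsIntegral ℤ (n * M i j) := by
  obtain ⟨n, hn, h⟩ := exists_nat_mul_mem (𝔞 : FractionalIdeal (𝓞 K)⁰ K)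
  obtain ⟨k, hk, h'⟩ := exists_nat_mul_mem
    ((𝔞⁻¹ : (FractionalIdeal (𝓞 K)⁰ K)ˣ) : FractionalIdeal (𝓞 K)⁰ K)
  refine ⟨n * k, by positivity, ?_⟩
  rintro M ⟨h1, h2, h3, h4⟩ i j
  rw [mem_one_iff_isIntegral] at h1 h4
  push_cast
  fin_cases i <;> fin_cases j <;> simp only [Fin.zero_eta, Fin.mk_one, Fin.isValue]
  · exact ((isIntegral_natCast _).mul (isIntegral_natCast _)).mul h1
  · rw [mul_assoc]; exact (isIntegral_natCast _).mul (h' _ h2)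
  · rw [mul_comm (n : K), mul_assoc]; exact (isIntegral_natCast _).mul (h _ h3)
  · exact ((isIntegral_natCast _).mul (isIntegral_natCast _)).mul h4

section

variable (hK : Module.finrank ℚ K = 2) {σ} (hσ : σ ≠ AlgEquiv.refl)

include hK hσ

/-- Proper discontinuity: both real embeddings of the entries are bounded by `exists_entry_bound`
and their denominators by `exists_denom_Gam`, so `finite_bounded` applies to each entry. -/
theorem finite_act_dist_le (𝔞 : (FractionalIdeal (𝓞 K)⁰ K)ˣ) (z : ℍ × ℍ) (C : ℝ) :
    {M | M ∈ Gam 𝔞 ∧ dist (act ι σ M z).1 UpperHalfPlane.I +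
      dist (act ι σ M z).2 UpperHalfPlane.I ≤ C}.Finite := by
  obtain ⟨B1, hB1⟩ := exists_entry_bound z.1 C
  obtain ⟨B2, hB2⟩ := exists_entry_bound z.2 C
  obtain ⟨n, hn, hi⟩ := exists_denom_Gam 𝔞
  have hfin := finite_bounded hK hσ ι hn (max B1 B2)
  set S := {x : K | IsIntegral ℤ (n * x) ∧ |ι x| ≤ max B1 B2 ∧ |ι (σ x)| ≤ max B1 B2}
  have h1 : {A : Fin 2 → Fin 2 → K | ∀ i, A i ∈ {v : Fin 2 → K | ∀ j, v j ∈ S}}.Finite :=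
    Set.Finite.pi' fun i => Set.Finite.pi' fun j => hfin
  refine Set.Finite.of_finite_image (f := fun M : SL(2, K) => (M : Fin 2 → Fin 2 → K))
    (h1.subset ?_) (fun M _ N _ h => Subtype.ext h)
  rintro _ ⟨M, ⟨hM, hd⟩, rfl⟩ i j
  have d1 : dist (act ι σ M z).1 UpperHalfPlane.I ≤ C := by
    have := dist_nonneg (x := (act ι σ M z).2) (y := UpperHalfPlane.I); linarith
  have d2 : dist (act ι σ M z).2 UpperHalfPlane.I ≤ C := by
    have := dist_nonneg (x := (act ι σ M z).1) (y := UpperHalfPlane.I); linarith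
  exact ⟨hi M hM i j, (hB1 _ d1 i j).trans (le_max_left _ _),
    (hB2 _ d2 i j).trans (le_max_right _ _)⟩

/-- Every subgroup of the Hilbert modular group has a measurable transversal. -/
theorem exists_act_transversal (𝔞 : (FractionalIdeal (𝓞 K)⁰ K)ˣ) (G : Subgroup SL(2, K))
    (hG : G ≤ Gam 𝔞) : ∃ F : Set (ℍ × ℍ), MeasurableSet F ∧
      (∀ x ∈ F, ∀ M ∈ G, act ι σ M x ∈ F → act ι σ M x = x) ∧ ∀ x, ∃ M ∈ G, act ι σ M x ∈ F := by
  let r : Setoid (ℍ × ℍ) :=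
    { r := fun z w => ∃ M : G, act ι σ M z = w
      iseqv :=
        { refl := fun z => ⟨1, act_one ι σ z⟩
          symm := by
            rintro z w ⟨M, rfl⟩
            exact ⟨M⁻¹, by rw [← act_mul]; simp [act_one]⟩
          trans := by
            rintro z w v ⟨M, rfl⟩ ⟨N, rfl⟩
            exact ⟨N * M, act_mul ι σ N M z⟩ } }
  obtain ⟨F, h1, h2, h3⟩ := exists_transversal (fun M : G => act ι σ M)
    (fun M => measurable_act ι σ M) r (fun x y => Iff.rfl)
    (fun x => dist x.1 UpperHalfPlane.I + dist x.2 UpperHalfPlane.I)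
    (by
      apply Continuous.measurable
      fun_prop)
    (fun x C => by
      refine ((finite_act_dist_le ι hK hσ 𝔞 x C).image fun M => act ι σ M x).subset ?_
      rintro y ⟨⟨M, rfl⟩, hy⟩
      exact ⟨M, ⟨hG M.2, hy⟩, rfl⟩)
  refine ⟨F, h1, fun x hx M hM hMx => ?_, fun x => ?_⟩
  · exact (h2 x hx _ hMx ⟨⟨M, hM⟩, rfl⟩).symm
  · obtain ⟨M, hM⟩ := h3 x
    exact ⟨M, M.2, hM⟩

end

end

section

/-! ### Integrals of radial functions on the hyperbolic plane -/

theorem lintegral_eta {f : ℝ × ℝ → ENNReal} (hf : Measurable f) :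
    ∫⁻ z : ℍ, f (z.re, z.im) ∂eta = ENNReal.ofReal (1 / (4 * Real.pi)) *
      ∫⁻ p in {p : ℝ × ℝ | 0 < p.2}, ENNReal.ofReal (1 / p.2 ^ 2) * f p := by
  have hre : Measurable UpperHalfPlane.re := UpperHalfPlane.continuous_re.measurable
  have him : Measurable UpperHalfPlane.im := UpperHalfPlane.continuous_im.measurable
  rw [eta, lintegral_smul_measure, smul_eq_mul, UpperHalfPlane.volume_def]
  congr 1
  have hd : (fun z : ℍ => (((1 / NNReal.mk z.im z.im_pos.le : NNReal) ^ 2 : NNReal) : ENNReal)) =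
      fun z : ℍ => ENNReal.ofReal (1 / (z : ℂ).im ^ 2) := by
    ext z
    rw [ENNReal.ofReal, ENNReal.coe_inj]
    ext
    rw [Real.coe_toNNReal _ (by positivity)]
    simp
  have hd' : ∀ z : ℍ, (((1 / NNReal.mk z.im z.im_pos.le : NNReal) ^ 2 : NNReal) : ENNReal) =
      ENNReal.ofReal (1 / (z : ℂ).im ^ 2) := fun z => congrFun hd z
  simp only [hd']
  rw [lintegral_withDensity_eq_lintegral_mul _
    (by fun_prop) (by exact hf.comp (hre.prodMk him))]
  have h1 := UpperHalfPlane.measurableEmbedding_coe.lintegral_map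
    (μ := volume.comap UpperHalfPlane.coe)
    (fun z : ℂ => ENNReal.ofReal (1 / z.im ^ 2) * f (z.re, z.im))
  simp only [Pi.mul_apply]
  refine h1.symm.trans ?_
  rw [UpperHalfPlane.measurableEmbedding_coe.map_comap]
  have h2 : Set.range UpperHalfPlane.coe =
      Complex.measurableEquivRealProd ⁻¹' {p : ℝ × ℝ | 0 < p.2} := by
    ext z
    constructor
    · rintro ⟨w, rfl⟩; exact w.im_pos
    · intro hz; exact ⟨⟨z, hz⟩, rfl⟩
  rw [h2]
  exact Complex.volume_preserving_equiv_real_prod.setLIntegral_comp_preimage_emb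
    Complex.measurableEquivRealProd.measurableEmbedding
    (fun p => ENNReal.ofReal (1 / p.2 ^ 2) * f p) _

/-- Hyperboloid coordinates on the upper half-plane. -/
def hyperboloid (p : ℝ × ℝ) : ℝ × ℝ := (p.1 / p.2, (p.1 ^ 2 + p.2 ^ 2 - 1) / (2 * p.2))

theorem hyperboloid_sq {p : ℝ × ℝ} (hp : 0 < p.2) :
    √(1 + (hyperboloid p).1 ^ 2 + (hyperboloid p).2 ^ 2) =
      (p.1 ^ 2 + p.2 ^ 2 + 1) / (2 * p.2) := by
  rw [Real.sqrt_eq_iff_mul_self_eq (by positivity) (by positivity), hyperboloid]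
  field_simp; ring

/-- With T = √(1 + X² + Z²) one has T - Z = 1/y, which recovers y and then x. The inverse in
`hyperboloid_image` comes from the same relation. -/
theorem hyperboloid_injOn : Set.InjOn hyperboloid {p : ℝ × ℝ | 0 < p.2} := by
  intro p hp q hq h
  have h1 := hyperboloid_sq hp
  have h2 := hyperboloid_sq hq
  rw [h, h2] at h1
  have e1 := (Prod.ext_iff.1 h).1
  have e2 := (Prod.ext_iff.1 h).2
  simp only [hyperboloid] at e1 e2
  change 0 < p.2 at hp
  change 0 < q.2 at hq
  have e3 : 1 / p.2 = 1 / q.2 := by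
    have a : ∀ r : ℝ × ℝ, 0 < r.2 → 1 / r.2 = (r.1 ^ 2 + r.2 ^ 2 + 1) / (2 * r.2) -
        (r.1 ^ 2 + r.2 ^ 2 - 1) / (2 * r.2) := by
      intro r hr; field_simp; ring
    rw [a p hp, a q hq, e2, h1]
  have e4 : p.2 = q.2 := by simpa using e3
  rw [e4] at e1
  exact Prod.ext (by field_simp at e1; exact e1) e4

theorem hyperboloid_image : hyperboloid '' {p : ℝ × ℝ | 0 < p.2} = Set.univ := by
  rw [Set.eq_univ_iff_forall]
  rintro ⟨X, Z⟩
  set T := √(1 + X ^ 2 + Z ^ 2) with hT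
  have hT2 : T ^ 2 = 1 + X ^ 2 + Z ^ 2 := Real.sq_sqrt (by positivity)
  have hT0 : 0 ≤ T := Real.sqrt_nonneg _
  have hpos : 0 < T - Z := by
    rw [sub_pos]; apply lt_of_pow_lt_pow_left₀ 2 hT0; nlinarith [sq_nonneg X]
  refine ⟨(X / (T - Z), 1 / (T - Z)), by simpa using hpos, ?_⟩
  rw [hyperboloid]
  ext
  · field_simp
  · simp only; field_simp; nlinarith

theorem hyperboloid_hasFDerivAt {p : ℝ × ℝ} (hp : 0 < p.2) : HasFDerivAt hyperboloid
    ((Matrix.toLin (Module.Basis.finTwoProd ℝ) (Module.Basis.finTwoProd ℝ)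
      !![1 / p.2, -p.1 / p.2 ^ 2; p.1 / p.2, (p.2 ^ 2 - p.1 ^ 2 + 1) / (2 * p.2 ^ 2)]).toContinuousLinearMap)
    p := by
  rw [Matrix.toLin_finTwoProd_toContinuousLinearMap]
  have h1 : HasFDerivAt (Prod.fst : ℝ × ℝ → ℝ) (ContinuousLinearMap.fst ℝ ℝ ℝ) p := hasFDerivAt_fst
  have h2 : HasFDerivAt (Prod.snd : ℝ × ℝ → ℝ) (ContinuousLinearMap.snd ℝ ℝ ℝ) p := hasFDerivAt_snd
  have h3 : HasFDerivAt (fun q : ℝ × ℝ => q.2⁻¹)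
      ((-(p.2 ^ 2)⁻¹) • ContinuousLinearMap.snd ℝ ℝ ℝ) p :=
    (hasDerivAt_inv hp.ne').comp_hasFDerivAt p h2
  have h4 : hyperboloid = fun q => (q.1 * q.2⁻¹, (q.1 ^ 2 + q.2 ^ 2 - 1) * q.2⁻¹ * 2⁻¹) := by
    ext q
    · simp [hyperboloid, div_eq_mul_inv]
    · simp [hyperboloid, div_eq_mul_inv]; ring
  rw [h4]
  refine HasFDerivAt.prodMk ?_ ?_
  · refine (h1.mul h3).congr_fderiv ?_
    ext
    · simp
    · simp; field_simp
  · refine (((((h1.pow 2).add (h2.pow 2)).sub_const 1).mul h3).mul_const 2⁻¹).congr_fderiv ?_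
    ext
    · simp; field_simp
    · simp; field_simp; ring

/-- In polar coordinates T = √(1 + r²), and t = (T - 1)/2 has dt = r dr/(2T). So r dr/T = 2 dt, and
the angle contributes 2π. -/
theorem lintegral_radial_plane {k : ℝ → ENNReal} (hk : Measurable k) :
    ∫⁻ p : ℝ × ℝ, ENNReal.ofReal (1 / √(1 + p.1 ^ 2 + p.2 ^ 2)) *
      k ((√(1 + p.1 ^ 2 + p.2 ^ 2) - 1) / 2) =
      ENNReal.ofReal (4 * Real.pi) * ∫⁻ t in Set.Ioi 0, k t := by
  rw [← lintegral_comp_polarCoord_symm]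
  have h1 : ∀ p : ℝ × ℝ, (polarCoord.symm p).1 ^ 2 + (polarCoord.symm p).2 ^ 2 = p.1 ^ 2 := by
    intro p
    simp only [polarCoord_symm_apply]
    linear_combination p.1 ^ 2 * Real.sin_sq_add_cos_sq p.2
  simp only [add_assoc, h1, smul_eq_mul]
  rw [polarCoord_target, Measure.volume_eq_prod, ← Measure.prod_restrict]
  have hm : Measurable fun r : ℝ => ENNReal.ofReal r * (ENNReal.ofReal (1 / √(1 + r ^ 2)) *
      k ((√(1 + r ^ 2) - 1) / 2)) := by fun_prop
  rw [lintegral_prod _ (by fun_prop)]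
  simp only [lintegral_const, Measure.restrict_apply MeasurableSet.univ, Set.univ_inter,
    Real.volume_Ioo]
  rw [lintegral_mul_const _ hm]
  have hder : ∀ r ∈ Set.Ioi (0 : ℝ), HasDerivWithinAt (fun r : ℝ => (√(1 + r ^ 2) - 1) / 2)
      (r / (2 * √(1 + r ^ 2))) (Set.Ioi 0) r := by
    intro r _
    have h2 : HasDerivAt (fun r : ℝ => 1 + r ^ 2) (2 * r) r := by
      simpa using (hasDerivAt_pow 2 r).const_add 1
    have h3 := ((h2.sqrt (by positivity)).sub_const 1).div_const 2
    refine (h3.congr_deriv ?_).hasDerivWithinAt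
    field_simp
  have hsq : ∀ r : ℝ, √(1 + r ^ 2) ^ 2 = 1 + r ^ 2 := fun r => Real.sq_sqrt (by positivity)
  have himg : (fun r : ℝ => (√(1 + r ^ 2) - 1) / 2) '' Set.Ioi 0 = Set.Ioi 0 := by
    ext t
    constructor
    · rintro ⟨r, hr, rfl⟩
      have hr' : (0 : ℝ) < r := hr
      have : 1 < √(1 + r ^ 2) := by
        rw [Real.lt_sqrt zero_le_one]; nlinarith
      simp only [Set.mem_Ioi]; linarith
    · intro ht
      have ht' : (0 : ℝ) < t := ht
      refine ⟨√((2 * t + 1) ^ 2 - 1), Real.sqrt_pos.2 (by nlinarith), ?_⟩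
      simp only
      rw [Real.sq_sqrt (by nlinarith), add_sub_cancel, Real.sqrt_sq (by positivity)]; ring
  have hinj : Set.InjOn (fun r : ℝ => (√(1 + r ^ 2) - 1) / 2) (Set.Ioi 0) := by
    intro r hr s hs h
    have h4 : √(1 + r ^ 2) = √(1 + s ^ 2) := by simp only at h; linarith
    have h5 := hsq r
    rw [h4, hsq s] at h5
    exact (pow_left_inj₀ (le_of_lt hr) (le_of_lt hs) two_ne_zero).1 (by linarith)
  have hcv := lintegral_image_eq_lintegral_abs_deriv_mul measurableSet_Ioi hder hinj k
  rw [himg] at hcv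
  rw [hcv]
  have h5 : ∫⁻ r in Set.Ioi (0 : ℝ), ENNReal.ofReal r * (ENNReal.ofReal (1 / √(1 + r ^ 2)) *
      k ((√(1 + r ^ 2) - 1) / 2)) = 2 * ∫⁻ r in Set.Ioi (0 : ℝ),
        ENNReal.ofReal |r / (2 * √(1 + r ^ 2))| * k ((√(1 + r ^ 2) - 1) / 2) := by
    rw [← lintegral_const_mul _ (by fun_prop)]
    refine setLIntegral_congr_fun measurableSet_Ioi fun r hr => ?_
    have hr' : (0 : ℝ) < r := hr
    rw [abs_of_pos (by positivity), ← mul_assoc, ← mul_assoc, ← ENNReal.ofReal_mul hr'.le,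
      show (2 : ENNReal) = ENNReal.ofReal 2 by simp, ← ENNReal.ofReal_mul zero_le_two]
    congr 2
    field_simp
  rw [h5, mul_right_comm, show (2 : ENNReal) = ENNReal.ofReal 2 by simp,
    ← ENNReal.ofReal_mul zero_le_two]
  congr 2
  ring

/-- An isometry moves w to i. Hyperboloid coordinates then turn dx dy/y² into dX dZ/T, because the
Jacobian is T/y², and sinh²(d/2) into (T - 1)/2. The constant 4π cancels the normalisation of `eta`.
-/
theorem lintegral_radial {k : ℝ → ENNReal} (hk : Measurable k) (w : ℍ) :
    ∫⁻ z : ℍ, k (Real.sinh (dist z w / 2) ^ 2) ∂eta = ∫⁻ t in Set.Ioi 0, k t := by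
  have h0 : ∫⁻ z : ℍ, k (Real.sinh (dist z w / 2) ^ 2) ∂eta =
      ∫⁻ z : ℍ, k (Real.sinh (dist z UpperHalfPlane.I / 2) ^ 2) ∂eta := by
    rw [← (measurePreserving_sl w.toSL2R).lintegral_comp (f := fun z : ℍ =>
      k (Real.sinh (dist z w / 2) ^ 2)) (by
        apply hk.comp; apply Continuous.measurable; fun_prop)]
    congr 1; ext z
    have h := dist_smul w.toSL2R z UpperHalfPlane.I
    rw [w.toSL2R_smul_I] at h
    rw [h]
  have h1 : ∀ z : ℍ, Real.sinh (dist z UpperHalfPlane.I / 2) ^ 2 =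
      ((z.re ^ 2 + z.im ^ 2 + 1) / (2 * z.im) - 1) / 2 := by
    intro z
    have := z.im_pos
    rw [UpperHalfPlane.sinh_half_dist, div_pow, mul_pow, Real.sq_sqrt (by simp; positivity),
      Complex.dist_eq, ← Complex.normSq_eq_norm_sq, Complex.normSq_apply]
    simp
    field_simp
    ring
  simp only [h0, h1]
  rw [lintegral_eta (f := fun p => k (((p.1 ^ 2 + p.2 ^ 2 + 1) / (2 * p.2) - 1) / 2)) (by fun_prop)]
  have hcv := lintegral_image_eq_lintegral_abs_det_fderiv_mul volume
    (s := {p : ℝ × ℝ | 0 < p.2}) (measurableSet_lt measurable_const measurable_snd)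
    (fun p (hp : 0 < p.2) => (hyperboloid_hasFDerivAt hp).hasFDerivWithinAt) hyperboloid_injOn
    (fun p : ℝ × ℝ => ENNReal.ofReal (1 / √(1 + p.1 ^ 2 + p.2 ^ 2)) *
      k ((√(1 + p.1 ^ 2 + p.2 ^ 2) - 1) / 2))
  rw [hyperboloid_image, setLIntegral_univ, lintegral_radial_plane hk] at hcv
  have h2 : ∫⁻ p in {p : ℝ × ℝ | 0 < p.2}, ENNReal.ofReal (1 / p.2 ^ 2) *
      k (((p.1 ^ 2 + p.2 ^ 2 + 1) / (2 * p.2) - 1) / 2) =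
      ENNReal.ofReal (4 * Real.pi) * ∫⁻ t in Set.Ioi 0, k t := by
    rw [hcv]
    refine setLIntegral_congr_fun (measurableSet_lt measurable_const measurable_snd)
      fun p hp => ?_
    have hp' : 0 < p.2 := hp
    rw [hyperboloid_sq hp', ← mul_assoc, ← ENNReal.ofReal_mul (abs_nonneg _)]
    congr 2
    simp only [ContinuousLinearMap.det, LinearMap.coe_toContinuousLinearMap, LinearMap.det_toLin,
      Matrix.det_fin_two_of]
    have h3 : 1 / p.2 * ((p.2 ^ 2 - p.1 ^ 2 + 1) / (2 * p.2 ^ 2)) - -p.1 / p.2 ^ 2 * (p.1 / p.2) =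
        (p.1 ^ 2 + p.2 ^ 2 + 1) / (2 * p.2 ^ 3) := by field_simp; ring
    rw [h3, abs_of_pos (by positivity)]
    field_simp
  rw [h2, ← mul_assoc, ← ENNReal.ofReal_mul (by positivity)]
  have : 1 / (4 * Real.pi) * (4 * Real.pi) = 1 := by field_simp
  rw [this]; simp

end

section

/-! ### Unfolding -/

theorem tsum_eq_two_mul {β : Type*} {f : β → ENNReal} {v : ENNReal} (a b : β) (hab : a ≠ b)
    (ha : f a = v) (hb : f b = v) (h : ∀ c, c ≠ a → c ≠ b → f c = 0) : ∑' c, f c = 2 * v := by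
  classical
  rw [tsum_eq_sum (s := {a, b}), Finset.sum_pair hab, ha, hb, two_mul]
  intro c hc
  simp only [Finset.mem_insert, Finset.mem_singleton, not_or] at hc
  exact h c hc.1 hc.2

variable {K : Type*} [Field K] [NumberField K]

theorem ne_neg_sl (M : SL(2, K)) : M ≠ -M := by
  intro h
  have h1 : ∀ i j, M i j = 0 := fun i j => by
    have : M i j = -M i j := congrArg (fun N : SL(2, K) => N i j) h
    exact self_eq_neg.1 this
  have hd := M.det_coe
  rw [Matrix.det_fin_two] at hd
  simp [h1] at hd

section

variable (ι : K →+* ℝ) (σ : K ≃ₐ[ℚ] K)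

/-- A measurable set that meets each `Γ(𝔞)`-orbit in exactly one point. -/
structure IsTransversal (𝔞 : (FractionalIdeal (𝓞 K)⁰ K)ˣ) (F : Set (ℍ × ℍ)) : Prop where
  meas : MeasurableSet F
  inj : ∀ x ∈ F, ∀ M ∈ Gam 𝔞, act ι σ M x ∈ F → act ι σ M x = x
  cov : ∀ x, ∃ M ∈ Gam 𝔞, act ι σ M x ∈ F

variable {ι σ} {𝔞 : (FractionalIdeal (𝓞 K)⁰ K)ˣ} {F : Set (ℍ × ℍ)}

theorem IsTransversal.quotientMeasure_eq (hF : IsTransversal ι σ 𝔞 F) :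
    quotientMeasure (orbitSetoid ι σ 𝔞) omegaSq =
      (omegaSq.restrict F).map (Quotient.mk (orbitSetoid ι σ 𝔞)) := by
  refine quotientMeasure_eq_map _ _ hF.meas (fun x hx y hy h => ?_)
    (fun M : Gam 𝔞 => actEquiv ι σ M) (fun M => measurePreserving_act ι σ M)
    (fun M x => (orbitSetoid ι σ 𝔞).symm ⟨M, M.2, rfl⟩)
    (Filter.Eventually.of_forall fun x => ?_)
  · obtain ⟨M, hM, rfl⟩ := Quotient.exact h
    exact (hF.inj x hx M hM hy).symm
  · obtain ⟨M, hM, h⟩ := hF.cov x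
    exact ⟨⟨M, hM⟩, h⟩

/-- If M moves x into F, so does -M. Any further such element would give a nontrivial stabilizer,
which happens only on a null set. -/
theorem IsTransversal.ae_count (hF : IsTransversal ι σ 𝔞 F) : ∀ᵐ x ∂omegaSq,
    ∑' M : Gam 𝔞, F.indicator (1 : ℍ × ℍ → ENNReal) (act ι σ M x) = 2 := by
  filter_upwards [ae_act_stab_trivial ι σ] with x hx
  obtain ⟨M, hM, hMx⟩ := hF.cov x
  refine (tsum_eq_two_mul (v := 1) (⟨M, hM⟩ : Gam 𝔞) ⟨-M, neg_mem_Gam hM⟩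
    (fun h => ne_neg_sl M (congrArg Subtype.val h)) ?_ ?_ ?_).trans
    (mul_one 2)
  · simp [hMx]
  · simp [act_neg, hMx]
  · rintro ⟨N, hN⟩ h1 h2
    simp only [Set.indicator_apply_eq_zero]
    intro hNx
    exfalso
    have h3 := hF.inj _ hMx (N * M⁻¹) (mul_mem hN (inv_mem hM))
    rw [← act_mul, inv_mul_cancel_right] at h3
    have h4 : act ι σ (M⁻¹ * N) x = x := by
      rw [act_mul, h3 hNx, ← act_mul, inv_mul_cancel, act_one]
    rcases hx _ h4 with h5 | h5
    · exact h1 (Subtype.ext (inv_mul_eq_one.1 h5).symm)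
    · refine h2 (Subtype.ext ?_)
      rw [inv_mul_eq_iff_eq_mul] at h5
      simpa using h5

/-- Substitute M⁻¹x in each term to move the group element onto the indicator of F, interchange sum
and integral, and count by `ae_count`. -/
theorem IsTransversal.lintegral_tsum_act (hF : IsTransversal ι σ 𝔞 F) {ψ : ℍ × ℍ → ENNReal}
    (hψ : Measurable ψ) :
    ∫⁻ x in F, ∑' M : Gam 𝔞, ψ (act ι σ M x) ∂omegaSq = 2 * ∫⁻ x, ψ x ∂omegaSq := by
  have hind : Measurable (F.indicator (1 : ℍ × ℍ → ENNReal)) := measurable_one.indicator hF.meas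
  rw [lintegral_tsum (f := fun (M : Gam 𝔞) x => ψ (act ι σ M x))
    fun M => (hψ.comp (measurable_act ι σ M)).aemeasurable, ← lintegral_const_mul _ hψ]
  have h1 : ∀ M : Gam 𝔞, ∫⁻ x in F, ψ (act ι σ M x) ∂omegaSq =
      ∫⁻ x, F.indicator 1 (act ι σ (M⁻¹ : Gam 𝔞) x) * ψ x ∂omegaSq := by
    intro M
    have h2 := (measurePreserving_act ι σ M).lintegral_comp (f := fun x =>
      F.indicator 1 (act ι σ (M⁻¹ : Gam 𝔞) x) * ψ x)
      ((hind.comp (measurable_act ι σ _)).mul hψ)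
    rw [← h2, ← lintegral_indicator hF.meas]
    congr 1; ext x
    simp only [Subgroup.coe_inv, ← act_mul, inv_mul_cancel, act_one]
    by_cases hx : x ∈ F <;> simp [hx]
  have h3 := (Equiv.inv (Gam 𝔞)).tsum_eq fun M : Gam 𝔞 =>
    ∫⁻ x, F.indicator 1 (act ι σ M x) * ψ x ∂omegaSq
  simp only [Equiv.inv_apply] at h3
  simp only [h1]
  rw [h3, ← lintegral_tsum]
  · apply lintegral_congr_ae
    filter_upwards [hF.ae_count] with x hx
    rw [ENNReal.tsum_mul_right, hx]
  · exact fun M => ((hind.comp (measurable_act ι σ _)).mul hψ).aemeasurable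

/-- Up to a factor of `2`, the integral of an invariant function over a set whose translates cover
`ℍ × ℍ` is at least its integral over a transversal. -/
theorem IsTransversal.lintegral_le (hF : IsTransversal ι σ 𝔞 F) {h : ℍ × ℍ → ENNReal}
    (hh : Measurable h) (hinv : ∀ M ∈ Gam 𝔞, ∀ x, h (act ι σ M x) = h x) {S : Set (ℍ × ℍ)}
    (hS : MeasurableSet S) (hcov : ∀ x, ∃ M ∈ Gam 𝔞, act ι σ M x ∈ S) :
    ∫⁻ x in F, h x ∂omegaSq ≤ 2 * ∫⁻ x in S, h x ∂omegaSq := by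
  rw [← lintegral_indicator hS, ← hF.lintegral_tsum_act (hh.indicator hS)]
  apply lintegral_mono
  intro x
  obtain ⟨M, hM, hMx⟩ := hcov x
  refine le_trans ?_ (ENNReal.le_tsum (⟨M, hM⟩ : Gam 𝔞))
  simp [hMx, hinv M hM]

end

/-! ### Stabilizers, classes of matrices and the unfolded integral -/

section

variable {ι : K →+* ℝ} {σ : K ≃ₐ[ℚ] K} {𝔞 : (FractionalIdeal (𝓞 K)⁰ K)ˣ}
  {A : Matrix (Fin 2) (Fin 2) K}

/-- The stabilizer of ±A preserves T_A, so on this graph its action is determined by the second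
coordinate. -/
theorem moeb_act_snd (h : 0 < ι A.det) {M : SL(2, K)} (hM : M ∈ stab σ 𝔞 A) {x : ℍ × ℍ}
    (hx : x.1 = moeb ι A h • x.2) : (act ι σ M x).1 = moeb ι A h • (act ι σ M x).2 := by
  rw [← lin_eq_zero_iff h] at hx ⊢
  have h1 := (lin_vact_eq_zero_iff (ι := ι) (A := A) σ M x).2 hx
  rcases hM.2 with h2 | h2
  · rwa [h2] at h1
  · rwa [h2, lin_neg, neg_eq_zero] at h1

variable (ι) in
/-- A measurable set that meets each orbit of the stabilizer of `± A` on `ℍ` (through the conjugate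
embedding) in exactly one point. -/
structure IsStabTransversal (σ : K ≃ₐ[ℚ] K) (𝔞 : (FractionalIdeal (𝓞 K)⁰ K)ˣ)
    (A : Matrix (Fin 2) (Fin 2) K) (E : Set ℍ) : Prop where
  meas : MeasurableSet E
  inj : ∀ z ∈ E, ∀ M ∈ stab σ 𝔞 A, Matrix.SpecialLinearGroup.map (ι.comp (σ : K →+* K)) M • z ∈ E →
    Matrix.SpecialLinearGroup.map (ι.comp (σ : K →+* K)) M • z = z
  cov : ∀ z, ∃ M ∈ stab σ 𝔞 A, Matrix.SpecialLinearGroup.map (ι.comp (σ : K →+* K)) M • z ∈ E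

theorem exists_isTransversal (hK : Module.finrank ℚ K = 2) (hσ : σ ≠ AlgEquiv.refl) :
    ∃ F, IsTransversal ι σ 𝔞 F := by
  obtain ⟨F, h1, h2, h3⟩ := exists_act_transversal ι hK hσ 𝔞 (Gam 𝔞) le_rfl
  exact ⟨F, h1, h2, h3⟩

/-- Discreteness is inherited from ℍ²: a transversal there is intersected with the graph T_A, on
which the stabilizer acts, and read off in the second coordinate. -/
theorem exists_isStabTransversal (hK : Module.finrank ℚ K = 2) (hσ : σ ≠ AlgEquiv.refl)
    (h : 0 < ι A.det) : ∃ E, IsStabTransversal ι σ 𝔞 A E := by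
  obtain ⟨F, h1, h2, h3⟩ := exists_act_transversal ι hK hσ 𝔞 (stab σ 𝔞 A) fun M hM => hM.1
  have hact : ∀ M ∈ stab σ 𝔞 A, ∀ z : ℍ, act ι σ M (moeb ι A h • z, z) =
      (moeb ι A h • Matrix.SpecialLinearGroup.map (ι.comp (σ : K →+* K)) M • z,
        Matrix.SpecialLinearGroup.map (ι.comp (σ : K →+* K)) M • z) := by
    intro M hM z
    exact Prod.ext (moeb_act_snd (x := (moeb ι A h • z, z)) h hM rfl) rfl
  refine ⟨{z | (moeb ι A h • z, z) ∈ F},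
    ((measurePreserving_gl (moeb ι A h)).measurable.prodMk measurable_id) h1, ?_, ?_⟩
  · intro z hz M hM hMz
    have := h2 _ hz M hM (by rw [hact M hM]; exact hMz)
    exact congrArg Prod.snd this
  · intro z
    obtain ⟨M, hM, hMz⟩ := h3 (moeb ι A h • z, z)
    rw [hact M hM] at hMz
    exact ⟨M, hM, hMz⟩

/-- The action of `SL₂(ℝ)` on `ℍ` by measurable equivalences. -/
def slEquiv (M : SL(2, ℝ)) : ℍ ≃ᵐ ℍ where
  toFun z := M • z
  invFun z := M⁻¹ • z
  left_inv z := inv_smul_smul M z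
  right_inv z := smul_inv_smul M z
  measurable_toFun := (measurePreserving_sl M).measurable
  measurable_invFun := (measurePreserving_sl M⁻¹).measurable

theorem IsStabTransversal.quotientMeasure_univ {E : Set ℍ} (hE : IsStabTransversal ι σ 𝔞 A E) :
    quotientMeasure (MulAction.orbitRel (stabConj ι σ 𝔞 A) ℍ) eta Set.univ = eta E := by
  refine HilbertModular.quotientMeasure_univ _ _ hE.meas (fun z hz w hw h => ?_)
    (fun M : stab σ 𝔞 A => slEquiv (Matrix.SpecialLinearGroup.map (ι.comp (σ : K →+* K)) M))
    (fun M => measurePreserving_sl _)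
    (fun M x => ⟨⟨_, M, M.2, rfl⟩, rfl⟩)
    (Filter.Eventually.of_forall fun x => ?_)
  · obtain ⟨⟨_, M, hM, rfl⟩, h⟩ := Quotient.exact h
    change Matrix.SpecialLinearGroup.map (ι.comp (σ : K →+* K)) M • w = z at h
    rw [← h]
    exact hE.inj w hw M hM (h ▸ hz)
  · obtain ⟨M, hM, h⟩ := hE.cov x
    exact ⟨⟨M, hM⟩, h⟩

variable {m : ℕ}

theorem countable_Lm : Countable (Lm σ 𝔞 m) := by
  have : Countable K := countable_numberField
  have : Countable (Matrix (Fin 2) (Fin 2) K) := inferInstanceAs (Countable (Fin 2 → Fin 2 → K))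
  infer_instance

open Classical in
-- Count pairs (M, B) such that M.B = ±A and the second coordinate of Mx lies in E, with weight
-- k(g(B, x)) = k(g(A, Mx)). Each M belongs to two B and each B of the class to two M, so the
-- factors 2 cancel. Only the second coordinate of x needs a trivial stabilizer.
theorem tsum_class (hK : Module.finrank ℚ K = 2) (hσ : σ ≠ AlgEquiv.refl)
    (hm : 0 < m) (c : Components σ 𝔞 m) {E : Set ℍ}
    (hE : IsStabTransversal ι σ 𝔞 (c.out : Matrix (Fin 2) (Fin 2) K) E) (k : ℝ → ENNReal)
    {x : ℍ × ℍ} (hx : ∀ M : SL(2, K),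
      Matrix.SpecialLinearGroup.map (ι.comp (σ : K →+* K)) M • x.2 = x.2 → M = 1 ∨ M = -1) :
    ∑' B : Lm σ 𝔞 m, (if Quotient.mk (pmSetoid σ 𝔞 m) B = c then k (g ι B x) else 0) =
      ∑' M : Gam 𝔞, E.indicator (fun _ => k (g ι (c.out : Matrix (Fin 2) (Fin 2) K) (act ι σ M x)))
        (act ι σ M x).2 := by
  set A : Lm σ 𝔞 m := c.out with hA
  obtain ⟨d, hd, hdet⟩ := exists_det_pos hK σ ι 𝔞 hm
  have hc : Quotient.mk (pmSetoid σ 𝔞 m) A = c := Quotient.out_eq c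
  set rel : Gam 𝔞 → Lm σ 𝔞 m → Prop := fun M B =>
    vact σ M (B : Matrix (Fin 2) (Fin 2) K) = A ∨ vact σ M (B : Matrix (Fin 2) (Fin 2) K) = -A
    with hrel
  -- For fixed `M` there are two matrices `B` with `M.B = ± A`.
  have hB : ∀ M : Gam 𝔞, ∑' B : Lm σ 𝔞 m, (if rel M B then k (g ι B x) else 0) =
      2 * k (g ι A (act ι σ M x)) := by
    intro M
    have hA0 : (A : Matrix (Fin 2) (Fin 2) K) ≠ -A := by
      intro h
      have h0 : (A : Matrix (Fin 2) (Fin 2) K) = 0 := by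
        ext i j
        exact self_eq_neg.1 (congrFun (congrFun h i) j)
      have := hdet A A.2
      rw [h0] at this
      simp at this
      exact hd.ne this
    have hMi : vact σ M (vact σ (M : SL(2, K))⁻¹ A) = A := by
      rw [← vact_mul, mul_inv_cancel, vact_one]
    have hcancel : ∀ B : Matrix (Fin 2) (Fin 2) K, vact σ (M : SL(2, K))⁻¹ (vact σ M B) = B := by
      intro B; rw [← vact_mul, inv_mul_cancel, vact_one]
    refine tsum_eq_two_mul
      (⟨vact σ (M : SL(2, K))⁻¹ A, vact_mem_Lm hK hσ A.2 (inv_mem M.2)⟩ : Lm σ 𝔞 m)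
      ⟨-vact σ (M : SL(2, K))⁻¹ A, neg_mem_Lm (vact_mem_Lm hK hσ A.2 (inv_mem M.2))⟩ ?_ ?_ ?_ ?_
    · intro h
      have h1 := congrArg (fun B : Lm σ 𝔞 m => vact σ (M : SL(2, K)) B) h
      simp only [vact_neg, hMi] at h1
      exact hA0 h1
    · rw [if_pos (Or.inl hMi), ← g_vact σ M, hMi]
    · rw [if_pos (Or.inr (by rw [vact_neg, hMi])), g_neg, ← g_vact σ M, hMi]
    · intro B h1 h2
      rw [if_neg]
      rintro (h | h)
      · exact h1 (Subtype.ext (by rw [← hcancel B, h]))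
      · exact h2 (Subtype.ext (by rw [← hcancel B, h, vact_neg]))
  -- For fixed `B` in the class there are two matrices `M` with `M.B = ± A` that move `x` to `E`.
  have hM : ∀ B : Lm σ 𝔞 m, ∑' M : Gam 𝔞,
      (if rel M B then E.indicator (1 : ℍ → ENNReal) (act ι σ M x).2 else 0) =
      2 * (if Quotient.mk (pmSetoid σ 𝔞 m) B = c then 1 else 0) := by
    intro B
    by_cases hBc : Quotient.mk (pmSetoid σ 𝔞 m) B = c
    · rw [if_pos hBc]
      obtain ⟨M0, hM0, hMB⟩ := Quotient.exact (hBc.trans hc.symm)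
      obtain ⟨N, hN, hNx⟩ := hE.cov (act ι σ M0 x).2
      have h1 : vact σ (N * M0) (B : Matrix (Fin 2) (Fin 2) K) = A ∨
          vact σ (N * M0) (B : Matrix (Fin 2) (Fin 2) K) = -A := by
        rw [vact_mul]
        rcases hMB with h | h <;> rcases hN.2 with h' | h' <;> simp [h, h', vact_neg]
      have hNM : N * M0 ∈ Gam 𝔞 := mul_mem hN.1 hM0
      have h2 : (act ι σ (N * M0) x).2 ∈ E := by rw [act_mul]; exact hNx
      have hneg : ∀ M : SL(2, K), ∀ B : Matrix (Fin 2) (Fin 2) K, vact σ (-M) B = vact σ M B := by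
        intro M B
        rw [vact, vact, Matrix.SpecialLinearGroup.coe_neg]
        have : (-(M : Matrix (Fin 2) (Fin 2) K)).map σ = -(M : Matrix (Fin 2) (Fin 2) K).map σ := by
          ext i j; simp
        rw [this]; simp
      generalize N * M0 = P at h1 hNM h2
      refine tsum_eq_two_mul (⟨P, hNM⟩ : Gam 𝔞) ⟨-P, neg_mem_Gam hNM⟩
        (fun h => ne_neg_sl _ (congrArg Subtype.val h)) ?_ ?_ ?_
      · rw [if_pos h1]; simp [h2]
      · rw [if_pos (by simpa only [hrel, hneg] using h1)]; simp [act_neg, h2]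
      · rintro ⟨M, hMG⟩ e1 e2
        by_contra hne
        have h3 : rel ⟨M, hMG⟩ B := by by_contra h; rw [if_neg h] at hne; exact hne rfl
        rw [if_pos h3] at hne
        have h4 : (act ι σ M x).2 ∈ E := by
          by_contra h; exact hne (Set.indicator_of_notMem h _)
        -- Two solutions differ by an element of the stabilizer, so the transversal E leaves only
        -- the ambiguity of sign.
        have h5 : M * P⁻¹ ∈ stab σ 𝔞 (A : Matrix (Fin 2) (Fin 2) K) := by
          refine ⟨mul_mem hMG (inv_mem hNM), ?_⟩
          have h6 : vact σ P⁻¹ (vact σ P (B : Matrix (Fin 2) (Fin 2) K)) = B := by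
            rw [← vact_mul, inv_mul_cancel, vact_one]
          rw [vact_mul]
          rcases h1 with h | h <;> rw [h] at h6
          · rw [h6]; exact h3
          · rw [vact_neg, neg_eq_iff_eq_neg] at h6
            rw [h6, vact_neg]
            rcases h3 with h3 | h3
            · right; rw [h3]
            · left; rw [h3, neg_neg]
        have h7 := hE.inj _ h2 _ h5
        have h8 : Matrix.SpecialLinearGroup.map (ι.comp (σ : K →+* K)) (M * P⁻¹) •
            (act ι σ P x).2 = (act ι σ M x).2 := by
          have : act ι σ (M * P⁻¹) (act ι σ P x) = act ι σ M x := by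
            rw [← act_mul, inv_mul_cancel_right]
          rw [← this]; rfl
        rw [h8] at h7
        have h9 : (act ι σ (P⁻¹ * M) x).2 = x.2 := by
          have : (act ι σ (P⁻¹ * P) x).2 = x.2 := by rw [inv_mul_cancel, act_one]
          rw [← this, act_mul, act_mul]
          change _ • (act ι σ M x).2 = _ • (act ι σ P x).2
          rw [h7 h4]
        rcases hx _ h9 with h10 | h10
        · exact e1 (Subtype.ext (inv_mul_eq_one.1 h10).symm)
        · refine e2 (Subtype.ext ?_)
          rw [inv_mul_eq_iff_eq_mul] at h10
          simpa using h10
    · rw [if_neg hBc, mul_zero]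
      refine ENNReal.tsum_eq_zero.2 fun M => if_neg fun h => hBc ?_
      rw [← hc]
      exact Quotient.sound ⟨M, M.2, h⟩
  have key : 2 * ∑' B : Lm σ 𝔞 m,
      (if Quotient.mk (pmSetoid σ 𝔞 m) B = c then k (g ι B x) else 0) =
      2 * ∑' M : Gam 𝔞, E.indicator (fun _ => k (g ι (A : Matrix (Fin 2) (Fin 2) K)
        (act ι σ M x))) (act ι σ M x).2 := by
    rw [← ENNReal.tsum_mul_left, ← ENNReal.tsum_mul_left]
    calc _ = ∑' B : Lm σ 𝔞 m, ∑' M : Gam 𝔞, k (g ι B x) *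
          (if rel M B then E.indicator (1 : ℍ → ENNReal) (act ι σ M x).2 else 0) := by
          congr 1; ext B
          rw [ENNReal.tsum_mul_left, hM]
          split_ifs <;> ring
      _ = ∑' M : Gam 𝔞, ∑' B : Lm σ 𝔞 m, (E.indicator (1 : ℍ → ENNReal) (act ι σ M x).2) *
          (if rel M B then k (g ι B x) else 0) := by
          rw [ENNReal.tsum_comm]
          congr 1; ext M; congr 1; ext B
          split_ifs <;> ring
      _ = _ := by
          congr 1; ext M
          rw [ENNReal.tsum_mul_left, hB]
          by_cases h : (act ι σ M x).2 ∈ E <;> simp [h]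
  exact (ENNReal.mul_right_inj two_ne_zero ENNReal.ofNat_ne_top).1 key

theorem measurable_indicator_g {E : Set ℍ} (hE : MeasurableSet E) {k : ℝ → ENNReal}
    (hk : Measurable k) : Measurable fun x : ℍ × ℍ => E.indicator (fun _ => k (g ι A x)) x.2 :=
  (hk.comp measurable_g).indicator (measurable_snd hE)

/-- For fixed z₂ the integral over z₁ is radial around γ z₂, hence independent of z₂. The factor 2
is that of ω² = 2 η₁η₂. -/
theorem lintegral_g_fiber (h : 0 < ι A.det) {E : Set ℍ} (hE : MeasurableSet E) {k : ℝ → ENNReal}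
    (hk : Measurable k) : ∫⁻ x : ℍ × ℍ, E.indicator (fun _ => k (g ι A x)) x.2 ∂omegaSq =
      2 * (eta E * ∫⁻ t in Set.Ioi 0, k t) := by
  have hm1 := measurable_indicator_g (ι := ι) (A := A) hE hk
  rw [omegaSq, lintegral_smul_measure, smul_eq_mul, lintegral_prod_symm _ hm1.aemeasurable]
  congr 1
  have h1 : ∀ w : ℍ, ∫⁻ z : ℍ, E.indicator (fun _ => k (g ι A (z, w))) w ∂eta =
      E.indicator (fun _ => ∫⁻ t in Set.Ioi 0, k t) w := by
    intro w
    by_cases hw : w ∈ E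
    · simp only [Set.indicator_of_mem hw, g_eq_sinh h]
      exact lintegral_radial hk _
    · simp [Set.indicator_of_notMem hw]
  simp only [h1]
  rw [lintegral_indicator hE, setLIntegral_const, mul_comm]

/-- The unfolded integral of a sum over `A` of functions of `g(A, z)`. -/
theorem lintegral_tsum_g (hK : Module.finrank ℚ K = 2) (hσ : σ ≠ AlgEquiv.refl) (hm : 0 < m)
    {F : Set (ℍ × ℍ)} (hF : IsTransversal ι σ 𝔞 F) {k : ℝ → ENNReal} (hk : Measurable k) :
    ∫⁻ x in F, ∑' A : Lm σ 𝔞 m, k (g ι A x) ∂omegaSq =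
      4 * volT ι σ 𝔞 m * ∫⁻ t in Set.Ioi 0, k t := by
  classical
  have : Countable (Lm σ 𝔞 m) := countable_Lm
  obtain ⟨d, hd, hdet⟩ := exists_det_pos hK σ ι 𝔞 hm
  have hpos : ∀ c : Components σ 𝔞 m, 0 < ι (c.out : Matrix (Fin 2) (Fin 2) K).det :=
    fun c => by rw [hdet _ c.out.2]; exact hd
  choose E hE using fun c : Components σ 𝔞 m =>
    exists_isStabTransversal (𝔞 := 𝔞) hK hσ (hpos c)
  have hmeas : ∀ c : Components σ 𝔞 m, Measurable fun x : ℍ × ℍ =>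
      (E c).indicator (fun _ => k (g ι (c.out : Matrix (Fin 2) (Fin 2) K) x)) x.2 :=
    fun c => measurable_indicator_g (hE c).meas hk
  calc _ = ∫⁻ x in F, ∑' c : Components σ 𝔞 m, ∑' M : Gam 𝔞, (E c).indicator (fun _ =>
        k (g ι (c.out : Matrix (Fin 2) (Fin 2) K) (act ι σ M x))) (act ι σ M x).2 ∂omegaSq := by
        apply lintegral_congr_ae
        filter_upwards [ae_restrict_of_ae (ae_snd (ae_stab_trivial (ι.comp (σ : K →+* K))))]
          with x hx
        simp only [← tsum_class hK hσ hm _ (hE _) k hx]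
        -- Every B lies in exactly one class.
        rw [ENNReal.tsum_comm]
        congr 1; ext B
        rw [tsum_eq_single (Quotient.mk (pmSetoid σ 𝔞 m) B)]
        · simp
        · intro c hc; rw [if_neg hc.symm]
    -- The outer 2 counts M and -M, the inner one comes from ω².
    _ = ∑' c : Components σ 𝔞 m, 2 * (2 * (eta (E c) * ∫⁻ t in Set.Ioi 0, k t)) := by
        rw [lintegral_tsum]
        · congr 1; ext c
          rw [hF.lintegral_tsum_act (hmeas c), lintegral_g_fiber (hpos c) (hE c).meas hk]
        · intro c
          exact (Measurable.tsum fun M : Gam 𝔞 =>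
            (hmeas c).comp (measurable_act ι σ M)).aemeasurable
    _ = _ := by
        rw [volT, ENNReal.tsum_mul_left, ENNReal.tsum_mul_left, ENNReal.tsum_mul_right]
        simp only [(hE _).quotientMeasure_univ]
        ring

end

end

section

variable {K : Type*} [Field K] [NumberField K]

/-! ### Reduction theory -/

/-! ### Minkowski's theorem for bottom rows (c, d) -/

section Minkowski

/-- The linear map whose values at integral vectors `(c₀, c₁, d₀, d₁)` measure the size of
`c z + d` at both places, where `c = c₀ + c₁ α` and `d = d₀ + d₁ α` and `a` is the image of `α`. -/
def heightMatrix (a : ℝ) (z : ℍ × ℍ) : Matrix (Fin 4) (Fin 4) ℝ :=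
  !![√z.1.im, a * √z.1.im, 0, 0;
    z.1.re / √z.1.im, a * z.1.re / √z.1.im, 1 / √z.1.im, a / √z.1.im;
    √z.2.im, -a * √z.2.im, 0, 0;
    z.2.re / √z.2.im, -a * z.2.re / √z.2.im, 1 / √z.2.im, -a / √z.2.im]

theorem heightMatrix_det (a : ℝ) (z : ℍ × ℍ) : |(heightMatrix a z).det| = 4 * a ^ 2 := by
  have h1 : 0 < √z.1.im := Real.sqrt_pos.2 z.1.im_pos
  have h2 : 0 < √z.2.im := Real.sqrt_pos.2 z.2.im_pos
  have h : (heightMatrix a z).det = -(4 * a ^ 2) := by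
    simp [heightMatrix, Matrix.det_succ_row_zero, Fin.sum_univ_succ, Fin.succAbove,
      Matrix.submatrix]
    field_simp
    ring
  rw [h, abs_neg, abs_of_nonneg (by positivity)]

/-- Minkowski's theorem for ℤ⁴ and the preimage of a sup-norm ball. Its volume condition is (2a +
1)⁴ > 4a², where 4a² is the absolute value of the determinant. -/
theorem exists_small_vector {a : ℝ} (ha : 0 < a) (z : ℍ × ℍ) :
    ∃ v : Fin 4 → ℤ, v ≠ 0 ∧ ∀ i,
      |(heightMatrix a z).mulVec (fun j => (v j : ℝ)) i| < 2 * a + 1 := by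
  set b := Pi.basisFun ℝ (Fin 4) with hb
  set T := Matrix.toLin' (heightMatrix a z) with hT
  have hdet : |LinearMap.det T| = 4 * a ^ 2 := by
    rw [hT, LinearMap.det_toLin', heightMatrix_det]
  have hdet0 : LinearMap.det T ≠ 0 := by
    intro h; rw [h] at hdet; simp at hdet; exact ha.ne' hdet
  set s := T ⁻¹' Metric.ball 0 (2 * a + 1) with hs
  have hvol : (volume : Measure (Fin 4 → ℝ)) (ZSpan.fundamentalDomain b) *
      2 ^ Module.finrank ℝ (Fin 4 → ℝ) < volume s := by
    rw [ZSpan.volume_fundamentalDomain, hs, Measure.addHaar_preimage_linearMap _ hdet0,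
      Real.volume_pi_ball _ (by positivity), abs_inv, hdet]
    have h1 : (Matrix.of b).det = 1 := by
      have : Matrix.of b = (1 : Matrix (Fin 4) (Fin 4) ℝ) := by
        ext i j; simp [hb, Matrix.one_apply, Pi.single_apply, eq_comm]
      rw [this, Matrix.det_one]
    rw [h1, ← ENNReal.ofReal_mul (by positivity)]
    simp only [abs_one, ENNReal.ofReal_one, one_mul, Module.finrank_fintype_fun_eq_card,
      Fintype.card_fin]
    rw [show (2 : ENNReal) ^ 4 = ENNReal.ofReal 16 by norm_num,
      ENNReal.ofReal_lt_ofReal_iff (by positivity), inv_mul_eq_div, lt_div_iff₀ (by positivity)]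
    have : 0 < a ^ 2 := by positivity
    have : 0 < a ^ 3 := by positivity
    have : 0 < a ^ 4 := by positivity
    ring_nf
    nlinarith
  have hsymm : ∀ x ∈ s, -x ∈ s := by
    intro x hx
    simpa [hs] using hx
  have hconv : Convex ℝ s := (convex_ball (0 : Fin 4 → ℝ) (2 * a + 1)).is_linear_preimage T.isLinear
  have : Countable (Submodule.span ℤ (Set.range b)).toAddSubgroup :=
    inferInstanceAs (Countable (Submodule.span ℤ (Set.range b)))
  obtain ⟨x, hx0, hx⟩ := exists_ne_zero_mem_lattice_of_measure_mul_two_pow_lt_measure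
    (ZSpan.isAddFundamentalDomain' b volume) hsymm hconv hvol
  have hmem : (x : Fin 4 → ℝ) ∈ Submodule.span ℤ (Set.range b) := x.2
  rw [Module.Basis.mem_span_iff_repr_mem] at hmem
  choose v hv using hmem
  have hxv : (x : Fin 4 → ℝ) = fun j => (v j : ℝ) := by
    ext j
    have := hv j
    simp [hb] at this
    exact this.symm
  refine ⟨v, ?_, fun i => ?_⟩
  · rintro rfl
    apply hx0
    ext j
    rw [hxv]; simp
  · rw [hs, Set.mem_preimage, mem_ball_zero_iff, hxv, hT, Matrix.toLin'_apply,
      pi_norm_lt_iff (by positivity)] at hx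
    exact hx i

end Minkowski

/-! ### Cusps, ideal classes and Siegel sets -/

section Reduction

variable (hK : Module.finrank ℚ K = 2) {σ : K ≃ₐ[ℚ] K} (hσ : σ ≠ AlgEquiv.refl) (ι : K →+* ℝ)

include hK hσ in
/-- Every point is close to a cusp. -/
theorem exists_close_cusp : ∃ C : ℝ, 0 < C ∧ ∀ z : ℍ × ℍ, ∃ c d : K, IsIntegral ℤ c ∧
    IsIntegral ℤ d ∧ (c ≠ 0 ∨ d ≠ 0) ∧
    ‖(ι c * z.1 + ι d : ℂ)‖ ^ 2 * ‖(ι (σ c) * z.2 + ι (σ d) : ℂ)‖ ^ 2 ≤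
      C * (z.1.im * z.2.im) := by
  obtain ⟨α, δ, h1, h2, h3, h4, h5, h6⟩ := exists_sqrt hK hσ ι
  -- Each place contributes at most 2R² times its imaginary part, with R = 2α + 1.
  refine ⟨4 * (2 * ι α + 1) ^ 4, by positivity, fun z => ?_⟩
  obtain ⟨v, hv0, hv⟩ := exists_small_vector h2 z
  set R := 2 * ι α + 1 with hR
  have hα : α ≠ 0 := by rintro rfl; simp at h2
  have hinj : ∀ p q : ℤ, (p : K) + q * α = 0 → p = 0 ∧ q = 0 := by
    intro p q h
    have h' := congrArg σ h
    simp only [map_add, map_mul, map_intCast, h1, map_zero] at h'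
    have e1 : (p : K) = 0 := by
      have : (2 : K) * p = 0 := by linear_combination h + h'
      simpa using this
    have e2 : (q : K) = 0 := by
      rw [e1, zero_add] at h
      exact (mul_eq_zero.1 h).resolve_right hα
    exact ⟨by exact_mod_cast e1, by exact_mod_cast e2⟩
  have y1 := z.1.im_pos
  have y2 := z.2.im_pos
  have s1 : 0 < √z.1.im := Real.sqrt_pos.2 y1
  have s2 : 0 < √z.2.im := Real.sqrt_pos.2 y2
  have q1 : √z.1.im ^ 2 = z.1.im := Real.sq_sqrt y1.le
  have q2 : √z.2.im ^ 2 = z.2.im := Real.sq_sqrt y2.le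
  have n0 := hv 0
  have n1 := hv 1
  have n2 := hv 2
  have n3 := hv 3
  simp [heightMatrix, Matrix.mulVec, dotProduct, Fin.sum_univ_succ] at n0 n1 n2 n3
  refine ⟨v 0 + v 1 * α, v 2 + v 3 * α, (isIntegral_intCast _).add ((isIntegral_intCast _).mul h3),
    (isIntegral_intCast _).add ((isIntegral_intCast _).mul h3), ?_, ?_⟩
  · by_contra! h
    obtain ⟨e0, e1⟩ := hinj _ _ h.1
    obtain ⟨e2, e3⟩ := hinj _ _ h.2
    apply hv0
    ext j
    fin_cases j <;> simp [e0, e1, e2, e3]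
  · have hsq : ∀ x : ℝ, |x| < R → x ^ 2 ≤ R ^ 2 := fun x hx =>
      sq_le_sq' (by have := neg_abs_le x; linarith) ((le_abs_self x).trans hx.le)
    -- The squares of the first two coordinates add up to |c z₁ + d|²/y₁; the last two play the same
    -- role at the other place.
    have b1 : ‖(ι (v 0 + v 1 * α) * z.1 + ι (v 2 + v 3 * α) : ℂ)‖ ^ 2 ≤ 2 * R ^ 2 * z.1.im := by
      have k0 := hsq _ n0
      have k1 := hsq _ n1
      rw [← Complex.normSq_eq_norm_sq, Complex.normSq_apply]
      simp
      generalize √z.1.im = s at *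
      rw [← q1]
      have e1 : (↑(v 0) + ↑(v 1) * ι α) * z.1.re + (↑(v 2) + ↑(v 3) * ι α) =
          (z.1.re / s * ↑(v 0) + (ι α * z.1.re / s * ↑(v 1) + (s⁻¹ * ↑(v 2) +
            ι α / s * ↑(v 3)))) * s := by field_simp; ring
      have e2 : (↑(v 0) + ↑(v 1) * ι α) * s = s * ↑(v 0) + ι α * s * ↑(v 1) := by ring
      rw [e1]
      nlinarith [mul_le_mul_of_nonneg_right k0 (sq_nonneg s),
        mul_le_mul_of_nonneg_right k1 (sq_nonneg s)]
    have b2 : ‖(ι (σ (v 0 + v 1 * α)) * z.2 + ι (σ (v 2 + v 3 * α)) : ℂ)‖ ^ 2 ≤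
        2 * R ^ 2 * z.2.im := by
      have k0 := hsq _ n2
      have k1 := hsq _ n3
      rw [← Complex.normSq_eq_norm_sq, Complex.normSq_apply]
      simp [h1]
      generalize √z.2.im = s at *
      rw [← q2]
      have e1 : (↑(v 0) + -(↑(v 1) * ι α)) * z.2.re + (↑(v 2) + -(↑(v 3) * ι α)) =
          (z.2.re / s * ↑(v 0) + (-(ι α * z.2.re) / s * ↑(v 1) + (s⁻¹ * ↑(v 2) +
            -ι α / s * ↑(v 3)))) * s := by field_simp; ring
      rw [e1]
      nlinarith [mul_le_mul_of_nonneg_right k0 (sq_nonneg s),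
        mul_le_mul_of_nonneg_right k1 (sq_nonneg s)]
    calc _ ≤ (2 * R ^ 2 * z.1.im) * (2 * R ^ 2 * z.2.im) := by gcongr
      _ = _ := by ring

/-- Matrices that move the cusp with ideal `J` to infinity. -/
def IsCuspMatrix (𝔞 J : (FractionalIdeal (𝓞 K)⁰ K)ˣ) (N : SL(2, K)) : Prop :=
  N 0 0 ∈ ((J⁻¹ : (FractionalIdeal (𝓞 K)⁰ K)ˣ) : FractionalIdeal (𝓞 K)⁰ K) ∧
  N 0 1 ∈ (((𝔞 * J)⁻¹ : (FractionalIdeal (𝓞 K)⁰ K)ˣ) : FractionalIdeal (𝓞 K)⁰ K) ∧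
  N 1 0 ∈ ((𝔞 * J : (FractionalIdeal (𝓞 K)⁰ K)ˣ) : FractionalIdeal (𝓞 K)⁰ K) ∧
  N 1 1 ∈ (J : FractionalIdeal (𝓞 K)⁰ K)

theorem unit_mul_mem {I J L : (FractionalIdeal (𝓞 K)⁰ K)ˣ} {x y : K} (h : I * J = L)
    (hx : x ∈ (I : FractionalIdeal (𝓞 K)⁰ K)) (hy : y ∈ (J : FractionalIdeal (𝓞 K)⁰ K)) :
    x * y ∈ (L : FractionalIdeal (𝓞 K)⁰ K) := by
  rw [← h, Units.val_mul]; exact FractionalIdeal.mul_mem_mul hx hy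

/-- All cusp matrices for one J lie in a single coset NΓ(𝔞), so one fixed matrix per ideal class
will do. -/
theorem IsCuspMatrix.inv_mul_mem {𝔞 J : (FractionalIdeal (𝓞 K)⁰ K)ˣ} {N P : SL(2, K)}
    (hN : IsCuspMatrix 𝔞 J N) (hP : IsCuspMatrix 𝔞 J P) : N⁻¹ * P ∈ Gam 𝔞 := by
  obtain ⟨n1, n2, n3, n4⟩ := hN
  obtain ⟨p1, p2, p3, p4⟩ := hP
  have one : ∀ {x : K}, x ∈ ((1 : (FractionalIdeal (𝓞 K)⁰ K)ˣ) : FractionalIdeal (𝓞 K)⁰ K) →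
      x ∈ (1 : FractionalIdeal (𝓞 K)⁰ K) := fun h => by simpa using h
  have e : ((N⁻¹ * P : SL(2, K)) : Matrix (Fin 2) (Fin 2) K) =
      !![N 1 1 * P 0 0 + -(N 0 1 * P 1 0), N 1 1 * P 0 1 + -(N 0 1 * P 1 1);
        -(N 1 0 * P 0 0) + N 0 0 * P 1 0, -(N 1 0 * P 0 1) + N 0 0 * P 1 1] := by
    rw [Matrix.SpecialLinearGroup.coe_mul, Matrix.SpecialLinearGroup.coe_inv,
      Matrix.adjugate_fin_two]
    ext i j
    fin_cases i <;> fin_cases j <;> simp [Matrix.mul_apply, Fin.sum_univ_two]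
  change (N⁻¹ * P : SL(2, K)).1 0 0 ∈ _ ∧ (N⁻¹ * P : SL(2, K)).1 0 1 ∈ _ ∧
    (N⁻¹ * P : SL(2, K)).1 1 0 ∈ _ ∧ (N⁻¹ * P : SL(2, K)).1 1 1 ∈ _
  rw [e]
  refine ⟨frac_add_mem (one (unit_mul_mem (by simp) n4 p1))
      (frac_neg_mem (one (unit_mul_mem (by simp) n2 p3))),
    frac_add_mem (unit_mul_mem (by simp) n4 p2) (frac_neg_mem (unit_mul_mem (by simp) n2 p4)),
    frac_add_mem (frac_neg_mem (unit_mul_mem (by simp) n3 p1)) (unit_mul_mem ?_ n1 p3),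
    frac_add_mem (frac_neg_mem (one (unit_mul_mem (by simp) n3 p2)))
      (one (unit_mul_mem (by simp) n1 p4))⟩
  rw [mul_comm 𝔞, inv_mul_cancel_left]

/-- The matrix `(u, t; 0, u⁻¹)`. -/
def upperTri (u t : K) (hu : u ≠ 0) : SL(2, K) :=
  ⟨!![u, t; 0, u⁻¹], by rw [Matrix.det_fin_two_of]; field_simp; simp⟩

/-- The freedom at the cusp: units and translations by suitable fractional ideals act from the left
without changing the shape of the matrix. -/
theorem IsCuspMatrix.upperTri_mul {𝔞 J : (FractionalIdeal (𝓞 K)⁰ K)ˣ} {N : SL(2, K)}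
    (hN : IsCuspMatrix 𝔞 J N) {u t : K} (hu : u ≠ 0) (hui : IsIntegral ℤ u)
    (hui' : IsIntegral ℤ u⁻¹)
    (ht : t ∈ (((𝔞 * J * J)⁻¹ : (FractionalIdeal (𝓞 K)⁰ K)ˣ) : FractionalIdeal (𝓞 K)⁰ K)) :
    IsCuspMatrix 𝔞 J (upperTri u t hu * N) := by
  obtain ⟨n1, n2, n3, n4⟩ := hN
  have e : ((upperTri u t hu * N : SL(2, K)) : Matrix (Fin 2) (Fin 2) K) =
      !![u * N 0 0 + t * N 1 0, u * N 0 1 + t * N 1 1; u⁻¹ * N 1 0, u⁻¹ * N 1 1] := by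
    rw [Matrix.SpecialLinearGroup.coe_mul, upperTri]
    ext i j
    fin_cases i <;> fin_cases j <;> simp [Matrix.mul_apply, Fin.sum_univ_two]
  change (upperTri u t hu * N : SL(2, K)).1 0 0 ∈ _ ∧ (upperTri u t hu * N : SL(2, K)).1 0 1 ∈ _ ∧
    (upperTri u t hu * N : SL(2, K)).1 1 0 ∈ _ ∧ (upperTri u t hu * N : SL(2, K)).1 1 1 ∈ _
  rw [e]
  refine ⟨frac_add_mem (mul_mem_of_isIntegral hui n1) (unit_mul_mem ?_ ht n3),
    frac_add_mem (mul_mem_of_isIntegral hui n2) (unit_mul_mem ?_ ht n4),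
    mul_mem_of_isIntegral hui' n3, mul_mem_of_isIntegral hui' n4⟩
  · rw [mul_inv_rev (𝔞 * J), inv_mul_cancel_right]
  · rw [mul_inv_rev (𝔞 * J), mul_comm J⁻¹, inv_mul_cancel_right]

/-- Multiplying the hypothesis by J⁻¹ exhibits 1 as an element of c(𝔞J)⁻¹ + dJ⁻¹; the two
coefficients form the top row. -/
theorem exists_cuspMatrix {𝔞 J : (FractionalIdeal (𝓞 K)⁰ K)ˣ} {c d : K}
    (h : (J : FractionalIdeal (𝓞 K)⁰ K) = FractionalIdeal.spanSingleton (𝓞 K)⁰ c *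
      ((𝔞⁻¹ : (FractionalIdeal (𝓞 K)⁰ K)ˣ) : FractionalIdeal (𝓞 K)⁰ K) +
        FractionalIdeal.spanSingleton (𝓞 K)⁰ d) :
    ∃ N : SL(2, K), IsCuspMatrix 𝔞 J N ∧ N 1 0 = c ∧ N 1 1 = d := by
  have hc : c ∈ ((𝔞 * J : (FractionalIdeal (𝓞 K)⁰ K)ˣ) : FractionalIdeal (𝓞 K)⁰ K) := by
    have h1 : FractionalIdeal.spanSingleton (𝓞 K)⁰ c *
      ((𝔞⁻¹ : (FractionalIdeal (𝓞 K)⁰ K)ˣ) : FractionalIdeal (𝓞 K)⁰ K) ≤ J := by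
      rw [h]; exact le_sup_left
    have h2 := mul_le_mul_left h1 (𝔞 : FractionalIdeal (𝓞 K)⁰ K)
    rw [mul_assoc, Units.inv_mul, mul_one] at h2
    have h3 := h2 (FractionalIdeal.mem_spanSingleton_self _ c)
    rw [Units.val_mul, mul_comm]
    exact h3
  have hd : d ∈ (J : FractionalIdeal (𝓞 K)⁰ K) := by
    rw [h]
    exact (le_sup_right : FractionalIdeal.spanSingleton (𝓞 K)⁰ d ≤ _)
      (FractionalIdeal.mem_spanSingleton_self _ d)
  have h1 : (1 : K) ∈ FractionalIdeal.spanSingleton (𝓞 K)⁰ c *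
      (((𝔞 * J)⁻¹ : (FractionalIdeal (𝓞 K)⁰ K)ˣ) : FractionalIdeal (𝓞 K)⁰ K) +
      FractionalIdeal.spanSingleton (𝓞 K)⁰ d *
      ((J⁻¹ : (FractionalIdeal (𝓞 K)⁰ K)ˣ) : FractionalIdeal (𝓞 K)⁰ K) := by
    have e : FractionalIdeal.spanSingleton (𝓞 K)⁰ c *
        (((𝔞 * J)⁻¹ : (FractionalIdeal (𝓞 K)⁰ K)ˣ) : FractionalIdeal (𝓞 K)⁰ K) +
        FractionalIdeal.spanSingleton (𝓞 K)⁰ d *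
        ((J⁻¹ : (FractionalIdeal (𝓞 K)⁰ K)ˣ) : FractionalIdeal (𝓞 K)⁰ K) = 1 := by
      rw [mul_inv, Units.val_mul, ← mul_assoc, ← add_mul, ← h, Units.mul_inv]
    rw [e]; exact FractionalIdeal.one_mem_one _
  rw [FractionalIdeal.mem_add] at h1
  obtain ⟨p, hp, q, hq, hpq⟩ := h1
  rw [FractionalIdeal.mem_singleton_mul] at hp hq
  obtain ⟨p', hp', rfl⟩ := hp
  obtain ⟨q', hq', rfl⟩ := hq
  refine ⟨⟨!![q', -p'; c, d], by rw [Matrix.det_fin_two_of]; linear_combination hpq⟩,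
    ⟨?_, ?_, ?_, ?_⟩, by simp, by simp⟩
  · simpa using hq'
  · simpa using frac_neg_mem hp'
  · simpa using hc
  · simpa using hd

theorem exists_class_representative (J : (FractionalIdeal (𝓞 K)⁰ K)ˣ) :
    ∃ x : Kˣ, J = toPrincipalIdeal (𝓞 K) K x *
      Quotient.out (QuotientGroup.mk J : (FractionalIdeal (𝓞 K)⁰ K)ˣ ⧸
        (toPrincipalIdeal (𝓞 K) K).range) := by
  have h := QuotientGroup.out_eq' (QuotientGroup.mk J : (FractionalIdeal (𝓞 K)⁰ K)ˣ ⧸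
        (toPrincipalIdeal (𝓞 K) K).range)
  rw [QuotientGroup.eq] at h
  obtain ⟨x, hx⟩ := h
  exact ⟨x, by rw [hx, mul_comm, mul_inv_cancel_left]⟩

/-- A neighbourhood of the cusp at infinity, modulo its stabilizer. -/
def Siegel (c E B : ℝ) : Set (ℍ × ℍ) :=
  {w | c ≤ w.1.im * w.2.im ∧ w.2.im ≤ w.1.im ∧ w.1.im ≤ E * w.2.im ∧ |w.1.re| ≤ B ∧ |w.2.re| ≤ B}

theorem measurableSet_Siegel (c E B : ℝ) : MeasurableSet (Siegel c E B) := by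
  have h1 : Continuous fun w : ℍ × ℍ => w.1.im := UpperHalfPlane.continuous_im.comp continuous_fst
  have h2 : Continuous fun w : ℍ × ℍ => w.2.im := UpperHalfPlane.continuous_im.comp continuous_snd
  have h3 : Continuous fun w : ℍ × ℍ => w.1.re := UpperHalfPlane.continuous_re.comp continuous_fst
  have h4 : Continuous fun w : ℍ × ℍ => w.2.re := UpperHalfPlane.continuous_re.comp continuous_snd
  apply IsClosed.measurableSet
  simp only [Siegel, Set.ofPred_and]
  exact (isClosed_le continuous_const (h1.mul h2)).inter <| (isClosed_le h2 h1).inter <|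
    (isClosed_le h1 (continuous_const.mul h2)).inter <| (isClosed_le h3.abs continuous_const).inter
    (isClosed_le h4.abs continuous_const)

theorem upperTri_smul (φ : K →+* ℝ) (u t : K) (hu : u ≠ 0) (z : ℍ) :
    (Matrix.SpecialLinearGroup.map φ (upperTri u t hu) • z).im = φ u ^ 2 * z.im ∧
    (Matrix.SpecialLinearGroup.map φ (upperTri u t hu) • z).re =
      φ u ^ 2 * z.re + φ u * φ t := by
  have hu' : φ u ≠ 0 := (map_ne_zero φ).2 hu
  have h : ((Matrix.SpecialLinearGroup.map φ (upperTri u t hu) • z : ℍ) : ℂ) =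
      ((φ u ^ 2 : ℝ) : ℂ) * z + ((φ u * φ t : ℝ) : ℂ) := by
    rw [coe_sl_smul]
    have hu2 : (φ u : ℂ) ≠ 0 := by exact_mod_cast hu'
    have e00 : Matrix.SpecialLinearGroup.map φ (upperTri u t hu) 0 0 = φ u := rfl
    have e01 : Matrix.SpecialLinearGroup.map φ (upperTri u t hu) 0 1 = φ t := rfl
    have e10 : Matrix.SpecialLinearGroup.map φ (upperTri u t hu) 1 0 = φ 0 := rfl
    have e11 : Matrix.SpecialLinearGroup.map φ (upperTri u t hu) 1 1 = φ u⁻¹ := rfl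
    rw [e00, e01, e10, e11, map_zero, map_inv₀]
    push_cast
    field_simp
    ring
  constructor
  · rw [← UpperHalfPlane.coe_im, h]; simp [-Complex.ofReal_pow]
  · rw [← UpperHalfPlane.coe_re, h]; simp [-Complex.ofReal_pow]

/-- The diagonal matrix with entries u^k and u^(-k) at the first place, and inverse entries at the
second, multiplies y₁/y₂ by u^(4k), so the ratio can be brought into [1, u⁴]. -/
theorem exists_zpow_normalization {u : ℝ} (hu : 1 < u) {y1 y2 : ℝ} (h1 : 0 < y1) (h2 : 0 < y2) :
    ∃ k : ℤ, (u ^ k)⁻¹ ^ 2 * y2 ≤ (u ^ k) ^ 2 * y1 ∧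
      (u ^ k) ^ 2 * y1 ≤ u ^ 4 * ((u ^ k)⁻¹ ^ 2 * y2) := by
  have hu0 : 0 < u := by linarith
  obtain ⟨k, k1, k2⟩ := exists_mem_Ico_zpow (div_pos h1 h2)
    (one_lt_pow₀ hu (four_ne_zero) : 1 < u ^ 4)
  rw [le_div_iff₀ h2] at k1
  rw [div_lt_iff₀ h2, zpow_add_one₀ (by positivity)] at k2
  refine ⟨-k, ?_⟩
  have hP : (u ^ 4) ^ k = (u ^ k) ^ 4 := by
    rw [← zpow_natCast, ← zpow_natCast, ← zpow_mul, ← zpow_mul, mul_comm]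
  rw [hP] at k1 k2
  rw [zpow_neg, inv_inv]
  have hp : 0 < u ^ k := zpow_pos hu0 k
  generalize u ^ k = p at *
  constructor
  · rw [inv_pow, le_inv_mul_iff₀ (by positivity)]
    calc _ = p ^ 4 * y2 := by ring
      _ ≤ y1 := k1
  · rw [inv_pow, inv_mul_le_iff₀ (by positivity)]
    calc _ ≤ p ^ 4 * u ^ 4 * y2 := k2.le
      _ = _ := by ring

/-- Round the coordinates of (X₁, X₂) with respect to the basis (n, n), (na, -na) of the plane. -/
theorem exists_translation_normalization {n a : ℝ} (hn : 0 < n) (ha : 0 < a) (X1 X2 : ℝ) :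
    ∃ p q : ℤ, |X1 + n * (p + q * a)| ≤ n * (1 + a) ∧ |X2 + n * (p - q * a)| ≤ n * (1 + a) := by
  have key : ∀ f1 f2 : ℝ, |f1| ≤ 1 / 2 → |f2| ≤ 1 / 2 → |-n * (f1 + a * f2)| ≤ n * (1 + a) := by
    intro f1 f2 h1 h2
    rw [abs_mul, abs_neg, abs_of_pos hn]
    refine mul_le_mul_of_nonneg_left ((abs_add_le _ _).trans ?_) hn.le
    rw [abs_mul, abs_of_pos ha]
    have := mul_le_mul_of_nonneg_left h2 ha.le
    linarith
  have a1 := abs_sub_round (-(X1 + X2) / (2 * n))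
  have a2 := abs_sub_round (-(X1 - X2) / (2 * a * n))
  refine ⟨round (-(X1 + X2) / (2 * n)), round (-(X1 - X2) / (2 * a * n)), ?_, ?_⟩
  · convert key _ _ a1 a2 using 2
    field_simp; ring
  · rw [← abs_neg] at a2
    convert key _ _ a1 a2 using 2
    field_simp; ring

theorem exists_natCast_mem (I : (FractionalIdeal (𝓞 K)⁰ K)ˣ) :
    ∃ n : ℕ, 0 < n ∧ (n : K) ∈ (I : FractionalIdeal (𝓞 K)⁰ K) := by
  obtain ⟨x, hx, hx0⟩ : ∃ x ∈ (I : FractionalIdeal (𝓞 K)⁰ K), x ≠ 0 := by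
    by_contra! h
    exact Units.ne_zero _ (FractionalIdeal.eq_zero_iff.2 h)
  obtain ⟨n, hn, hni⟩ := exists_nat_mul_isIntegral x⁻¹
  refine ⟨n, hn, ?_⟩
  have := mul_mem_of_isIntegral hni hx
  rwa [mul_assoc, inv_mul_cancel₀ hx0, mul_one] at this

include hK hσ in
/-- Normalization at a cusp by units and translations. -/
theorem exists_siegel_normalization (𝔞 J : (FractionalIdeal (𝓞 K)⁰ K)ˣ) : ∃ E B : ℝ,
    ∀ N : SL(2, K), IsCuspMatrix 𝔞 J N → ∀ c : ℝ, ∀ z : ℍ × ℍ,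
      c ≤ (act ι σ N z).1.im * (act ι σ N z).2.im →
      ∃ P : SL(2, K), IsCuspMatrix 𝔞 J P ∧ act ι σ P z ∈ Siegel c E B := by
  obtain ⟨ε, hεi, hε, hε1⟩ := exists_unit hK hσ ι
  obtain ⟨α, δ, h1, h2, h3, h4, h5, h6⟩ := exists_sqrt hK hσ ι
  obtain ⟨n, hn, hna⟩ := exists_natCast_mem (𝔞 * J * J)⁻¹
  have hn' : (0 : ℝ) < n := by exact_mod_cast hn
  have hε0 : ε ≠ 0 := by rintro rfl; simp at hε
  have hσε : σ ε = ε⁻¹ := eq_inv_of_mul_eq_one_right hε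
  have hpow : ∀ k : ℤ, IsIntegral ℤ (ε ^ k) := by
    intro k
    obtain ⟨j, rfl | rfl⟩ := k.eq_nat_or_neg
    · rw [zpow_natCast]; exact hεi.pow j
    · rw [zpow_neg, zpow_natCast, ← inv_pow, ← hσε]; exact (isIntegral_sigma hεi).pow j
  refine ⟨ι ε ^ 4, n * (1 + ι α), fun N hN c z hz => ?_⟩
  generalize hw : act ι σ N z = w at hz
  obtain ⟨k, k1, k2⟩ := exists_zpow_normalization hε1 w.1.im_pos w.2.im_pos
  have he0 : ι ε ^ k ≠ 0 := (zpow_pos (by linarith) _).ne'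
  obtain ⟨p, q, b1, b2⟩ := exists_translation_normalization hn' h2
    ((ι ε ^ k) ^ 2 * w.1.re) ((ι ε ^ k)⁻¹ ^ 2 * w.2.re)
  have hεk : ε ^ k ≠ 0 := zpow_ne_zero _ hε0
  -- The matrix `upperTri u t` translates by ut, so t carries the factor ε^(-k) to produce the
  -- translation n(p + qα).
  have htm : ((n : K) * (p + q * α)) * (ε ^ k)⁻¹ ∈
      (((𝔞 * J * J)⁻¹ : (FractionalIdeal (𝓞 K)⁰ K)ˣ) : FractionalIdeal (𝓞 K)⁰ K) := by
    rw [mul_comm ((n : K) * (p + q * α)), mul_comm (n : K), ← zpow_neg]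
    exact mul_mem_of_isIntegral (hpow _) (mul_mem_of_isIntegral
      ((isIntegral_intCast _).add ((isIntegral_intCast _).mul h3)) hna)
  refine ⟨_, hN.upperTri_mul hεk (hpow _) (by rw [← zpow_neg]; exact hpow _) htm, ?_⟩
  rw [act_mul, hw]
  obtain ⟨i1, r1⟩ := upperTri_smul ι (ε ^ k) ((n : K) * (p + q * α) * (ε ^ k)⁻¹) hεk w.1
  obtain ⟨i2, r2⟩ := upperTri_smul (ι.comp (σ : K →+* K)) (ε ^ k)
    ((n : K) * (p + q * α) * (ε ^ k)⁻¹) hεk w.2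
  simp only [RingHom.comp_apply, RingHom.coe_coe, map_mul, map_add, map_inv₀, map_zpow₀, hσε,
    map_natCast, map_intCast, h1, map_neg, inv_zpow, inv_inv] at i1 r1 i2 r2
  have e1 : (ι ε ^ k) ^ 2 * w.1.re + ι ε ^ k * ((n * (p + q * ι α)) * (ι ε ^ k)⁻¹) =
      (ι ε ^ k) ^ 2 * w.1.re + n * (p + q * ι α) := by field_simp
  have e2 : (ι ε ^ k)⁻¹ ^ 2 * w.2.re + (ι ε ^ k)⁻¹ * ((n * (p + q * -ι α)) * ι ε ^ k) =
      (ι ε ^ k)⁻¹ ^ 2 * w.2.re + n * (p - q * ι α) := by field_simp; ring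
  rw [e1] at r1
  rw [e2] at r2
  refine ⟨?_, ?_, ?_, ?_, ?_⟩ <;> simp only [act]
  · rw [i1, i2]
    convert hz using 1; field_simp
  · rw [i1, i2]; exact k1
  · rw [i1, i2]; exact k2
  · rw [r1]; exact b1
  · rw [r2]; exact b2

include hK hσ in
theorem one_le_abs_norm {x : K} (hx : IsIntegral ℤ x) (hx0 : x ≠ 0) : 1 ≤ |ι x * ι (σ x)| := by
  obtain ⟨n, hn⟩ := eq_int_of_fixed hK hσ (x := x * σ x)
    (by rw [map_mul, sigma_sigma hK hσ]; ring) (hx.mul (isIntegral_sigma hx))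
  have hn0 : n ≠ 0 := by
    rintro rfl
    rw [Int.cast_zero, mul_eq_zero, map_eq_zero, or_self] at hn
    exact hx0 hn
  rw [← map_mul, hn, map_intCast]
  exact_mod_cast Int.one_le_abs hn0

include hK hσ in
/-- Finitely many Siegel sets cover `ℍ × ℍ` modulo the Hilbert modular group. -/
theorem exists_siegel_cover (𝔞 : (FractionalIdeal (𝓞 K)⁰ K)ˣ) :
    ∃ (κ : Type) (_ : Finite κ) (N : κ → SL(2, K)) (c E B : κ → ℝ), (∀ i, 0 < c i) ∧
      ∀ z : ℍ × ℍ, ∃ M ∈ Gam 𝔞, ∃ i, act ι σ (N i) (act ι σ M z) ∈ Siegel (c i) (E i) (B i) := by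
  classical
  obtain ⟨C, hC, hcusp⟩ := exists_close_cusp hK hσ ι
  obtain ⟨n, hn, hni⟩ := exists_nat_mul_mem
    ((𝔞⁻¹ : (FractionalIdeal (𝓞 K)⁰ K)ˣ) : FractionalIdeal (𝓞 K)⁰ K)
  set Q := (FractionalIdeal (𝓞 K)⁰ K)ˣ ⧸ (toPrincipalIdeal (𝓞 K) K).range with hQ
  have hfin : Finite Q := Finite.of_equiv _ (ClassGroup.equiv (R := 𝓞 K) K).toEquiv
  have hex : ∀ q : Q, ∃ t ∈ ((Quotient.out q : (FractionalIdeal (𝓞 K)⁰ K)ˣ) :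
      FractionalIdeal (𝓞 K)⁰ K), t ≠ 0 := by
    intro q
    by_contra! h
    exact Units.ne_zero _ (FractionalIdeal.eq_zero_iff.2 h)
  choose t ht ht0 using hex
  choose E B hEB using fun q : Q => exists_siegel_normalization hK hσ ι 𝔞 (Quotient.out q)
  -- Replacing the bottom row (a, b) by x⁻¹(a, b) multiplies the height by the square of the norm of
  -- x. As nx·t(q) is integral and nonzero, |N(x)| ≥ 1/(n²|N(t(q))|), and the original height is at
  -- least 1/C.
  set c : Q → ℝ := fun q => ((n ^ 2 * |ι (t q) * ι (σ (t q))|) ^ 2 * C)⁻¹ with hc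
  have hcpos : ∀ q, 0 < c q := by
    intro q
    have h1 : ι (t q) ≠ 0 := (map_ne_zero ι).2 (ht0 q)
    have h2 : ι (σ (t q)) ≠ 0 := (map_ne_zero ι).2 ((map_ne_zero σ).2 (ht0 q))
    have h3 : 0 < |ι (t q) * ι (σ (t q))| := abs_pos.2 (mul_ne_zero h1 h2)
    have h4 : (0 : ℝ) < n := by exact_mod_cast hn
    simp only [hc]; positivity
  -- The choice must depend on the class alone, not on z. The value 1 is a dummy: whenever a class
  -- is used, P below is a cusp matrix for it.
  set N : Q → SL(2, K) := fun q =>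
    if h : ∃ N, IsCuspMatrix 𝔞 (Quotient.out q) N then h.choose else 1 with hN
  have key : ∀ z : ℍ × ℍ, ∃ M ∈ Gam 𝔞, ∃ i,
      act ι σ (N i) (act ι σ M z) ∈ Siegel (c i) (E i) (B i) := by
    intro z
    obtain ⟨a, b, ha, hb, hab, hsmall⟩ := hcusp z
    set I : FractionalIdeal (𝓞 K)⁰ K := FractionalIdeal.spanSingleton (𝓞 K)⁰ a *
      ((𝔞⁻¹ : (FractionalIdeal (𝓞 K)⁰ K)ˣ) : FractionalIdeal (𝓞 K)⁰ K) +
        FractionalIdeal.spanSingleton (𝓞 K)⁰ b with hI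
    have hI0 : I ≠ 0 := by
      intro h0
      have e1 : FractionalIdeal.spanSingleton (𝓞 K)⁰ a *
          ((𝔞⁻¹ : (FractionalIdeal (𝓞 K)⁰ K)ˣ) : FractionalIdeal (𝓞 K)⁰ K) = 0 :=
        le_antisymm (h0 ▸ le_sup_left) (FractionalIdeal.zero_le _)
      have e2 : FractionalIdeal.spanSingleton (𝓞 K)⁰ b = 0 :=
        le_antisymm (h0 ▸ le_sup_right) (FractionalIdeal.zero_le _)
      rcases hab with h | h
      · rcases mul_eq_zero.1 e1 with h' | h'
        · exact h (FractionalIdeal.spanSingleton_eq_zero_iff.1 h')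
        · exact Units.ne_zero _ h'
      · exact h (FractionalIdeal.spanSingleton_eq_zero_iff.1 e2)
    obtain ⟨x, hx⟩ := exists_class_representative (Units.mk0 I hI0)
    set q : Q := QuotientGroup.mk (Units.mk0 I hI0) with hq
    set J : (FractionalIdeal (𝓞 K)⁰ K)ˣ := Quotient.out q with hJ
    have hIJ : I = FractionalIdeal.spanSingleton (𝓞 K)⁰ (x : K) * J := by
      have := congrArg Units.val hx
      rwa [Units.val_mk0, Units.val_mul, coe_toPrincipalIdeal] at this
    have hJI : (J : FractionalIdeal (𝓞 K)⁰ K) =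
        FractionalIdeal.spanSingleton (𝓞 K)⁰ ((x : K)⁻¹ * a) *
        ((𝔞⁻¹ : (FractionalIdeal (𝓞 K)⁰ K)ˣ) : FractionalIdeal (𝓞 K)⁰ K) +
        FractionalIdeal.spanSingleton (𝓞 K)⁰ ((x : K)⁻¹ * b) := by
      rw [← FractionalIdeal.spanSingleton_mul_spanSingleton,
        ← FractionalIdeal.spanSingleton_mul_spanSingleton, mul_assoc, ← mul_add, ← hI, hIJ,
        ← mul_assoc, FractionalIdeal.spanSingleton_mul_spanSingleton, inv_mul_cancel₀ x.ne_zero,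
        FractionalIdeal.spanSingleton_one, one_mul]
    obtain ⟨P, hP, hP1, hP2⟩ := exists_cuspMatrix hJI
    -- The lower bound for the norm of `x`.
    have hxt : IsIntegral ℤ (n * ((x : K) * t q)) := by
      have hmem : (x : K) * t q ∈ I := by
        rw [hIJ]
        exact FractionalIdeal.mul_mem_mul (FractionalIdeal.mem_spanSingleton_self _ _) (ht q)
      rw [hI, FractionalIdeal.mem_add] at hmem
      obtain ⟨u, hu, v, hv, huv⟩ := hmem
      rw [FractionalIdeal.mem_singleton_mul] at hu
      obtain ⟨u', hu', rfl⟩ := hu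
      rw [FractionalIdeal.mem_spanSingleton] at hv
      obtain ⟨v', rfl⟩ := hv
      rw [← huv, mul_add, mul_left_comm]
      refine (ha.mul (hni _ hu')).add ((isIntegral_natCast n).mul ?_)
      rw [Algebra.smul_def]
      exact v'.isIntegral_coe.mul hb
    have hn0 : (n : K) ≠ 0 := by exact_mod_cast hn.ne'
    have hnorm := one_le_abs_norm hK hσ ι hxt (mul_ne_zero hn0 (mul_ne_zero x.ne_zero (ht0 q)))
    simp only [map_mul, map_natCast] at hnorm
    set T := |ι (t q) * ι (σ (t q))| with hT
    set X := |ι x * ι (σ x)| with hX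
    have hnorm' : 1 ≤ X * (n ^ 2 * T) := by
      refine hnorm.trans (le_of_eq ?_)
      rw [hX, hT, ← abs_of_nonneg (sq_nonneg (n : ℝ)), ← abs_mul, ← abs_mul]
      congr 1; ring
    -- The height of the transformed point.
    have hx1 : ι x ≠ 0 := (map_ne_zero ι).2 x.ne_zero
    have hx2 : ι (σ x) ≠ 0 := (map_ne_zero ι).2 ((map_ne_zero σ).2 x.ne_zero)
    have hheight : c q ≤ (act ι σ P z).1.im * (act ι σ P z).2.im := by
      have d1 := sl_denom_ne (Matrix.SpecialLinearGroup.map ι P) z.1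
      have d2 := sl_denom_ne (Matrix.SpecialLinearGroup.map (ι.comp (σ : K →+* K)) P) z.2
      have i1 := sl_im (Matrix.SpecialLinearGroup.map ι P) z.1
      have i2 := sl_im (Matrix.SpecialLinearGroup.map (ι.comp (σ : K →+* K)) P) z.2
      simp only [Matrix.SpecialLinearGroup.map_apply_coe, RingHom.mapMatrix_apply,
        Matrix.map_apply, hP1, hP2, RingHom.comp_apply, RingHom.coe_coe, map_mul, map_inv₀]
        at i1 i2 d1 d2
      have f1 : (((ι x)⁻¹ * ι a : ℝ) * z.1 + ((ι x)⁻¹ * ι b : ℝ) : ℂ) =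
          ((ι x)⁻¹ : ℝ) * (ι a * z.1 + ι b) := by push_cast; ring
      have f2 : (((ι (σ x))⁻¹ * ι (σ a) : ℝ) * z.2 + ((ι (σ x))⁻¹ * ι (σ b) : ℝ) : ℂ) =
          ((ι (σ x))⁻¹ : ℝ) * (ι (σ a) * z.2 + ι (σ b)) := by push_cast; ring
      rw [f1] at i1 d1
      rw [f2] at i2 d2
      have d1' := norm_pos_iff.2 (mul_ne_zero_iff.1 d1).2
      have d2' := norm_pos_iff.2 (mul_ne_zero_iff.1 d2).2
      rw [norm_mul, Complex.norm_real, mul_pow, Real.norm_eq_abs, sq_abs] at i1 i2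
      simp only [act]
      rw [i1, i2]
      set W1 := ‖(ι a * z.1 + ι b : ℂ)‖
      set W2 := ‖(ι (σ a) * z.2 + ι (σ b) : ℂ)‖
      have y1 := z.1.im_pos
      have y2 := z.2.im_pos
      have e1 : z.1.im / ((ι x)⁻¹ ^ 2 * W1 ^ 2) * (z.2.im / ((ι (σ x))⁻¹ ^ 2 * W2 ^ 2)) =
          X ^ 2 * ((z.1.im * z.2.im) / (W1 ^ 2 * W2 ^ 2)) := by
        rw [hX, sq_abs]; field_simp
      rw [e1]
      have e2 : 1 / C ≤ (z.1.im * z.2.im) / (W1 ^ 2 * W2 ^ 2) := by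
        rw [div_le_div_iff₀ hC (by positivity)]; linarith
      have hT0 : 0 < n ^ 2 * T := by
        by_contra hcon
        have hX0 : 0 ≤ X := abs_nonneg _
        push Not at hcon
        nlinarith
      have hcq : c q = (1 / (n ^ 2 * T)) ^ 2 * (1 / C) := by
        change ((n ^ 2 * T) ^ 2 * C)⁻¹ = _
        rw [mul_inv, one_div, one_div, inv_pow]
      calc c q = (1 / (n ^ 2 * T)) ^ 2 * (1 / C) := hcq
        _ ≤ X ^ 2 * ((z.1.im * z.2.im) / (W1 ^ 2 * W2 ^ 2)) := by
          gcongr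
          rwa [div_le_iff₀ hT0]
    obtain ⟨R, hR, hRz⟩ := hEB q P hP (c q) z hheight
    have hex : ∃ N, IsCuspMatrix 𝔞 (Quotient.out q) N := ⟨P, hP⟩
    have hNq : IsCuspMatrix 𝔞 (Quotient.out q) (N q) := by
      simp only [hN, dif_pos hex]; exact hex.choose_spec
    refine ⟨(N q)⁻¹ * R, hNq.inv_mul_mem hR, q, ?_⟩
    rwa [← act_mul, mul_inv_cancel_left]
  obtain ⟨k, ⟨e⟩⟩ := Finite.exists_equiv_fin Q
  refine ⟨Fin k, inferInstance, N ∘ e.symm, c ∘ e.symm, E ∘ e.symm, B ∘ e.symm,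
    fun i => hcpos _, fun z => ?_⟩
  obtain ⟨M, hM, q, hq⟩ := key z
  exact ⟨M, hM, e q, by simpa using hq⟩

end Reduction

end

section

variable {K : Type*} [Field K] [NumberField K] {ι : K →+* ℝ} {σ : K ≃ₐ[ℚ] K}
  {𝔞 : (FractionalIdeal (𝓞 K)⁰ K)ˣ} {A : Matrix (Fin 2) (Fin 2) K} {m : ℕ}

/-! ### Finiteness of the volume -/

theorem one_le_one_add_g (h : 0 < ι A.det) (z : ℍ × ℍ) : 1 ≤ 1 + g ι A z := by
  have := g_nonneg h z; linarith

/-- At (iy, iy), adding 2 det A · y² to |lin|² cancels the mixed terms and gives exactly the sum of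
squares on the left. Thus 1 + g dominates a positive definite majorant of the determinant form. -/
theorem entries_le_on_imaginary_axis (h : 0 < ι A.det) {y : ℝ} (hy : 0 < y) :
    ι (A 0 0) ^ 2 + ι (A 1 1) ^ 2 * y ^ 4 + (ι (A 1 0) ^ 2 + ι (A 0 1) ^ 2) * y ^ 2 ≤
      4 * ι A.det * y ^ 2 * (1 + g ι A (⟨⟨0, y⟩, hy⟩, ⟨⟨0, y⟩, hy⟩)) := by
  have hl : lin ι A (⟨⟨0, y⟩, hy⟩, ⟨⟨0, y⟩, hy⟩) =
      ⟨ι (A 0 0) - ι (A 1 1) * y ^ 2, -(ι (A 1 0) + ι (A 0 1)) * y⟩ := by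
    apply Complex.ext <;> simp [lin]
    · ring
    · ring
  have hn : ‖lin ι A (⟨⟨0, y⟩, hy⟩, ⟨⟨0, y⟩, hy⟩)‖ ^ 2 =
      (ι (A 0 0) - ι (A 1 1) * y ^ 2) ^ 2 + ((ι (A 1 0) + ι (A 0 1)) * y) ^ 2 := by
    rw [hl, ← Complex.normSq_eq_norm_sq, Complex.normSq_mk]; ring
  have hdet : ι A.det = ι (A 0 0) * ι (A 1 1) - ι (A 0 1) * ι (A 1 0) := by
    rw [Matrix.det_fin_two, map_sub, map_mul, map_mul]
  have key : 4 * ι A.det * y ^ 2 * (1 + g ι A (⟨⟨0, y⟩, hy⟩, ⟨⟨0, y⟩, hy⟩)) =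
      4 * ι A.det * y ^ 2 + ((ι (A 0 0) - ι (A 1 1) * y ^ 2) ^ 2 +
        ((ι (A 1 0) + ι (A 0 1)) * y) ^ 2) := by
    rw [g, hn]
    simp only [UpperHalfPlane.im]
    field_simp
  have key' : ι (A 0 0) ^ 2 + ι (A 1 1) ^ 2 * y ^ 4 + (ι (A 1 0) ^ 2 + ι (A 0 1) ^ 2) * y ^ 2 =
      2 * ι A.det * y ^ 2 + ((ι (A 0 0) - ι (A 1 1) * y ^ 2) ^ 2 +
        ((ι (A 1 0) + ι (A 0 1)) * y) ^ 2) := by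
    rw [hdet]; ring
  rw [key, key']
  have : 0 < ι A.det * y ^ 2 := by positivity
  linarith

/-- The distance of points of a Siegel set to the diagonal part of the imaginary axis is bounded. -/
theorem exists_siegel_dist_bound {c : ℝ} (hc : 0 < c) (E B : ℝ) : ∃ y0 > 0, ∃ Δ : ℝ,
    ∀ w ∈ Siegel c E B, y0 ≤ w.2.im ∧
      dist (⟨⟨0, w.2.im⟩, w.2.im_pos⟩ : ℍ) w.1 + dist (⟨⟨0, w.2.im⟩, w.2.im_pos⟩ : ℍ) w.2 ≤ Δ := by
  by_cases hE : 0 < E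
  swap
  -- For E ≤ 0 the Siegel set is empty.
  · refine ⟨1, one_pos, 0, fun w hw => ?_⟩
    obtain ⟨h1, h2, h3, h4, h5⟩ := hw
    have := w.1.im_pos
    have := w.2.im_pos
    nlinarith
  -- The lower bound on y₂ comes from c ≤ y₁y₂ ≤ E y₂², the distance from d(z, w) ≤ |z - w|/√(Im z
  -- Im w).
  refine ⟨√(c / E), by positivity, (B / √(c / E) + E) + B / √(c / E), fun w hw => ?_⟩
  obtain ⟨h1, h2, h3, h4, h5⟩ := hw
  have p1 := w.1.im_pos
  have p2 := w.2.im_pos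
  have hy : √(c / E) ≤ w.2.im := by
    rw [Real.sqrt_le_left p2.le, div_le_iff₀ hE]
    nlinarith
  have hy0 : 0 < √(c / E) := by positivity
  have hB : 0 ≤ B := (abs_nonneg _).trans h4
  have hBy : B / w.2.im ≤ B / √(c / E) := by gcongr
  refine ⟨hy, add_le_add ?_ ?_⟩
  · refine (UpperHalfPlane.dist_le_dist_coe_div_sqrt _ _).trans ?_
    have e1 : w.2.im ≤ √(w.2.im * w.1.im) := by
      rw [Real.le_sqrt' p2, sq]; gcongr
    have e2 : dist (⟨0, w.2.im⟩ : ℂ) w.1 ≤ B + E * w.2.im := by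
      rw [dist_comm, dist_eq_norm]
      refine (Complex.norm_le_abs_re_add_abs_im _).trans ?_
      simp only [Complex.sub_re, Complex.sub_im, sub_zero, UpperHalfPlane.coe_re,
        UpperHalfPlane.coe_im]
      refine add_le_add h4 ?_
      rw [abs_of_nonneg (by linarith)]; linarith
    calc _ ≤ (B + E * w.2.im) / w.2.im := by
          exact div_le_div₀ (by positivity) e2 p2 e1
      _ = B / w.2.im + E := by field_simp
      _ ≤ _ := by linarith
  · refine (UpperHalfPlane.dist_le_dist_coe_div_sqrt _ _).trans ?_
    have e1 : √(w.2.im * w.2.im) = w.2.im := Real.sqrt_mul_self p2.le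
    have e2 : dist (⟨0, w.2.im⟩ : ℂ) w.2 ≤ B := by
      rw [dist_comm, dist_eq_norm]
      refine (Complex.norm_le_abs_re_add_abs_im _).trans ?_
      simpa using h5
    change dist (⟨0, w.2.im⟩ : ℂ) w.2 / √(w.2.im * w.2.im) ≤ _
    rw [e1]
    exact (by gcongr : _ ≤ B / w.2.im).trans hBy

/-- On a Siegel set, `1 + g` controls the entries of `A`. -/
theorem exists_siegel_entry_bound {c : ℝ} (hc : 0 < c) (E B : ℝ) {d : ℝ} (hd : 0 < d) :
    ∃ C > 0, ∀ A : Matrix (Fin 2) (Fin 2) K, ι A.det = d → ∀ w ∈ Siegel c E B,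
      ι (A 0 0) ^ 2 ≤ C * (w.2.im ^ 2 * (1 + g ι A w)) ∧ ι (A 1 1) ^ 2 ≤ C * (1 + g ι A w) ∧
      ι (A 1 0) ^ 2 + ι (A 0 1) ^ 2 ≤ C * (1 + g ι A w) ∧ 1 ≤ C * w.2.im ^ 2 ∧ 1 ≤ C := by
  obtain ⟨y0, hy0, Δ, h⟩ := exists_siegel_dist_bound hc E B
  -- With R = 4d exp Δ, the summand R serves a, λ and λ', R/y₀² serves b, and 1/y₀² and 1 serve the
  -- last two bounds.
  refine ⟨1 + 4 * d * Real.exp Δ + 4 * d * Real.exp Δ / y0 ^ 2 + 1 / y0 ^ 2, by positivity,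
    fun A hA w hw => ?_⟩
  obtain ⟨hy, hΔ⟩ := h w hw
  have hdet : 0 < ι A.det := by rw [hA]; exact hd
  have p2 := w.2.im_pos
  have hb := entries_le_on_imaginary_axis hdet p2
  have hg := one_add_g_le hdet (⟨⟨0, w.2.im⟩, p2⟩, ⟨⟨0, w.2.im⟩, p2⟩) w
  have hu := one_le_one_add_g hdet w
  have hg' : 4 * d * w.2.im ^ 2 * (1 + g ι A (⟨⟨0, w.2.im⟩, p2⟩, ⟨⟨0, w.2.im⟩, p2⟩)) ≤
      4 * d * w.2.im ^ 2 * (Real.exp Δ * (1 + g ι A w)) := by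
    gcongr
    refine hg.trans ?_
    gcongr
  rw [hA] at hb
  have hb' := hb.trans hg'
  clear hb hg hg' hΔ
  generalize g ι A w = G at *
  generalize w.2.im = y at *
  set u := 1 + G
  set R := 4 * d * Real.exp Δ with hR
  have hR0 : 0 < R := by positivity
  have hu0 : 0 < u := by linarith
  have hle : ∀ {a b : ℝ}, 0 ≤ b → a ≤ R * b → a ≤ (1 + R + R / y0 ^ 2 + 1 / y0 ^ 2) * b := by
    intro a b hb hab
    refine hab.trans (mul_le_mul_of_nonneg_right ?_ hb)
    have : 0 < R / y0 ^ 2 := by positivity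
    have : 0 < 1 / y0 ^ 2 := by positivity
    linarith
  have hy2 : y0 ^ 2 ≤ y ^ 2 := by gcongr
  have hsq1 := sq_nonneg (ι (A 0 0))
  have hsq2 := sq_nonneg (ι (A 1 1))
  have hsq3 := sq_nonneg (ι (A 1 0))
  have hsq4 := sq_nonneg (ι (A 0 1))
  have hyy : 0 < y ^ 2 := by positivity
  have t2 : 0 ≤ ι (A 1 1) ^ 2 * y ^ 4 := by positivity
  have t3 : 0 ≤ (ι (A 1 0) ^ 2 + ι (A 0 1) ^ 2) * y ^ 2 := by positivity
  refine ⟨hle (by positivity) ?_, ?_, hle (by positivity) ?_, ?_, ?_⟩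
  · rw [hR]; linarith
  · have e1 : ι (A 1 1) ^ 2 * y ^ 2 ≤ R * u := by
      refine le_of_mul_le_mul_right ?_ hyy
      calc _ = ι (A 1 1) ^ 2 * y ^ 4 := by ring
        _ ≤ _ := by rw [hR]; linarith
    have e2 : ι (A 1 1) ^ 2 ≤ R / y0 ^ 2 * u := by
      rw [div_mul_eq_mul_div, le_div_iff₀ (by positivity)]
      exact (mul_le_mul_of_nonneg_left hy2 hsq2).trans e1
    refine e2.trans (mul_le_mul_of_nonneg_right ?_ hu0.le)
    have : 0 < 1 / y0 ^ 2 := by positivity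
    linarith
  · refine le_of_mul_le_mul_right ?_ hyy
    rw [hR]; linarith
  · have : 1 ≤ 1 / y0 ^ 2 * y ^ 2 := by
      rw [one_div, inv_mul_eq_div, one_le_div (by positivity)]; exact hy2
    refine this.trans (mul_le_mul_of_nonneg_right ?_ hyy.le)
    have : 0 < R / y0 ^ 2 := by positivity
    linarith
  · have : 0 < R / y0 ^ 2 := by positivity
    have : 0 < 1 / y0 ^ 2 := by positivity
    linarith

theorem summable_int_weight : ∑' v : ℤ, ENNReal.ofReal ((1 + (v : ℝ) ^ 2) ^ (-(3 / 4) : ℝ)) ≠ ⊤ := by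
  have hs : Summable fun v : ℤ => (1 + (v : ℝ) ^ 2) ^ (-(3 / 4) : ℝ) := by
    refine Summable.of_norm_bounded_eventually
      (Real.summable_abs_int_rpow (b := 3 / 2) (by norm_num)) ?_
    rw [Filter.eventually_cofinite]
    refine (Set.finite_singleton (0 : ℤ)).subset fun v hv => ?_
    by_contra h0
    apply hv
    have h0' : (v : ℝ) ≠ 0 := by exact_mod_cast h0
    have : 0 < |(v : ℝ)| := abs_pos.2 h0'
    rw [Real.norm_of_nonneg (by positivity)]
    calc (1 + (v : ℝ) ^ 2) ^ (-(3 / 4) : ℝ) ≤ (|(v : ℝ)| ^ (2 : ℝ)) ^ (-(3 / 4) : ℝ) := by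
          apply Real.rpow_le_rpow_of_nonpos (by positivity) _ (by norm_num)
          rw [Real.rpow_two, sq_abs]; linarith
      _ = _ := by rw [← Real.rpow_mul this.le]; norm_num
  exact hs.tsum_ofReal_ne_top

theorem one_add_sq_le {n : ℕ} {C u x a : ℝ} (hx : x = n * a) (ha : a ^ 2 ≤ C * u) (hu : 1 ≤ C * u) :
    1 + x ^ 2 ≤ (1 + n ^ 2) * (C * u) := by
  rw [hx, mul_pow]
  nlinarith [sq_nonneg (n : ℝ)]

/-- Integral coordinates on the vectors of `Lm` near a cusp, with a bound on a Siegel set. -/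
theorem exists_coordinates (hK : Module.finrank ℚ K = 2) (hσ : σ ≠ AlgEquiv.refl) (hm : 0 < m)
    (N : SL(2, K)) {c : ℝ} (hc : 0 < c) (E B : ℝ) :
    ∃ (e : Lm σ 𝔞 m → ℤ × ℤ × ℤ × ℤ) (C : ℝ), Function.Injective e ∧ 0 < C ∧
      ∀ (A : Lm σ 𝔞 m), ∀ w ∈ Siegel c E B,
        (1 + ((e A).1 : ℝ) ^ 2) * ((1 + ((e A).2.1 : ℝ) ^ 2) * ((1 + ((e A).2.2.1 : ℝ) ^ 2) *
          (1 + ((e A).2.2.2 : ℝ) ^ 2))) ≤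
        C * (w.1.im * w.2.im) * (1 + g ι (vact σ N A) w) ^ 4 := by
  obtain ⟨d, hd, hdet⟩ := exists_det_pos hK σ ι 𝔞 hm
  obtain ⟨C, hC, hbound⟩ := exists_siegel_entry_bound (K := K) (ι := ι) hc E B hd
  obtain ⟨n, hn, hni⟩ := exists_denom_vact hK hσ ι 𝔞 N
  obtain ⟨α, δ, h1, h2, h3, -⟩ := exists_sqrt hK hσ ι
  have hα : α ≠ 0 := by rintro rfl; simp at h2
  have hn0 : (n : K) ≠ 0 := by exact_mod_cast hn.ne'
  have hV : ∀ A : Lm σ 𝔞 m, vact σ N A ∈ V σ := fun A => vact_mem_V hK hσ A.2.1.1 N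
  simp only [mem_V_iff hK hσ] at hV
  -- The coordinates are na, nb, n(λ + λ') and n(λ - λ')α, which are integral and fixed by σ.
  have c1 : ∀ A : Lm σ 𝔞 m, ∃ p : ℤ, n * vact σ N A 0 0 = p := fun A =>
    eq_int_of_fixed hK hσ (by rw [map_mul, map_natCast, (hV A).1]) (hni A A.2.1 0 0)
  have c2 : ∀ A : Lm σ 𝔞 m, ∃ p : ℤ, n * vact σ N A 1 1 = p := fun A =>
    eq_int_of_fixed hK hσ (by rw [map_mul, map_natCast, (hV A).2.2.2]) (hni A A.2.1 1 1)
  have c3 : ∀ A : Lm σ 𝔞 m, ∃ p : ℤ, n * vact σ N A 1 0 + n * vact σ N A 0 1 = p := fun A =>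
    eq_int_of_fixed hK hσ
      (by rw [map_add, map_mul, map_mul, map_natCast, (hV A).2.1, (hV A).2.2.1, add_comm])
      ((hni A A.2.1 1 0).add (hni A A.2.1 0 1))
  have c4 : ∀ A : Lm σ 𝔞 m, ∃ p : ℤ, (n * vact σ N A 1 0 - n * vact σ N A 0 1) * α = p := fun A =>
    eq_int_of_fixed hK hσ
      (by rw [map_mul, map_sub, map_mul, map_mul, map_natCast, (hV A).2.1, (hV A).2.2.1, h1]; ring)
      (((hni A A.2.1 1 0).sub (hni A A.2.1 0 1)).mul h3)
  choose p1 hp1 using c1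
  choose p2 hp2 using c2
  choose p3 hp3 using c3
  choose p4 hp4 using c4
  set Q : ℝ := (1 + n ^ 2) * C with hQ
  have hQ0 : 0 < Q := by positivity
  set S : ℝ := 1 + (2 * n ^ 2 * (1 + ι α ^ 2)) with hS
  refine ⟨fun A => (p1 A, p2 A, p3 A, p4 A), Q * Q * (S * C) * (S * C), ?_, by positivity, ?_⟩
  · intro A A' h
    simp only [Prod.mk.injEq] at h
    obtain ⟨e1, e2, e3, e4⟩ := h
    have f1 : vact σ N A 0 0 = vact σ N A' 0 0 := by
      have := hp1 A; rw [e1, ← hp1 A'] at this; exact mul_left_cancel₀ hn0 this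
    have f2 : vact σ N A 1 1 = vact σ N A' 1 1 := by
      have := hp2 A; rw [e2, ← hp2 A'] at this; exact mul_left_cancel₀ hn0 this
    have f3 : n * vact σ N A 1 0 + n * vact σ N A 0 1 =
        n * vact σ N A' 1 0 + n * vact σ N A' 0 1 := by
      rw [hp3, hp3, e3]
    have f4 : n * vact σ N A 1 0 - n * vact σ N A 0 1 =
        n * vact σ N A' 1 0 - n * vact σ N A' 0 1 := by
      refine mul_right_cancel₀ hα ?_
      rw [hp4, hp4, e4]
    have f5 : vact σ N A 1 0 = vact σ N A' 1 0 := by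
      refine mul_left_cancel₀ (mul_ne_zero two_ne_zero hn0) ?_
      linear_combination f3 + f4
    have f6 : vact σ N A 0 1 = vact σ N A' 0 1 := by
      refine mul_left_cancel₀ (mul_ne_zero two_ne_zero hn0) ?_
      linear_combination f3 - f4
    have hAA : vact σ N A = vact σ N (A' : Matrix (Fin 2) (Fin 2) K) := by
      ext i j
      fin_cases i <;> fin_cases j <;> assumption
    have := congrArg (vact σ N⁻¹) hAA
    rw [← vact_mul, ← vact_mul, inv_mul_cancel, vact_one, vact_one] at this
    exact Subtype.ext this
  · intro A w hw
    have hdA : ι (vact σ N A).det = d := by rw [det_vact]; exact hdet A A.2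
    obtain ⟨b1, b2, b3, b4, b5⟩ := hbound _ hdA w hw
    have hu := one_le_one_add_g (by rw [hdA]; exact hd : 0 < ι (vact σ N A).det) w
    have r1 : (p1 A : ℝ) = n * ι (vact σ N A 0 0) := by
      have := congrArg ι (hp1 A); simpa using this.symm
    have r2 : (p2 A : ℝ) = n * ι (vact σ N A 1 1) := by
      have := congrArg ι (hp2 A); simpa using this.symm
    have r3 : (p3 A : ℝ) = n * (ι (vact σ N A 1 0) + ι (vact σ N A 0 1)) := by
      have := congrArg ι (hp3 A); rw [mul_add]; simpa using this.symm
    have r4 : (p4 A : ℝ) = n * ((ι (vact σ N A 1 0) - ι (vact σ N A 0 1)) * ι α) := by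
      have := congrArg ι (hp4 A); rw [← mul_assoc, mul_sub]; simpa using this.symm
    have y2 := w.2.im_pos
    have hy : w.2.im ^ 2 ≤ w.1.im * w.2.im := by rw [sq]; exact mul_le_mul_of_nonneg_right hw.2.1 y2.le
    generalize ι (vact σ N A 0 0) = a at *
    generalize ι (vact σ N A 1 1) = b at *
    generalize ι (vact σ N A 1 0) = l at *
    generalize ι (vact σ N A 0 1) = l' at *
    generalize 1 + g ι (vact σ N A) w = u at *
    have hu0 : 0 < u := by linarith
    -- Only the corner a grows with the height; its factor y₂² is at most y₁y₂.
    have k1 : 1 + (p1 A : ℝ) ^ 2 ≤ Q * (w.2.im ^ 2 * u) := by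
      rw [hQ, mul_assoc]
      refine one_add_sq_le r1 b1 ?_
      rw [← mul_assoc]; nlinarith
    have k2 : 1 + (p2 A : ℝ) ^ 2 ≤ Q * u := by
      rw [hQ, mul_assoc]
      exact one_add_sq_le r2 b2 (by nlinarith)
    have hCu : 1 ≤ C * u := by nlinarith
    have k3 : 1 + (p3 A : ℝ) ^ 2 ≤ S * C * u := by
      have hsq : (l + l') ^ 2 ≤ 2 * (C * u) := by nlinarith [sq_nonneg (l - l')]
      calc 1 + (p3 A : ℝ) ^ 2 ≤ C * u + n ^ 2 * (2 * (C * u)) := by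
            rw [r3, mul_pow]; gcongr
        _ ≤ C * u + n ^ 2 * (2 * (C * u)) + 2 * n ^ 2 * ι α ^ 2 * (C * u) :=
            le_add_of_nonneg_right (by positivity)
        _ = _ := by rw [hS]; ring
    have k4 : 1 + (p4 A : ℝ) ^ 2 ≤ S * C * u := by
      have hsq : (l - l') ^ 2 ≤ 2 * (C * u) := by nlinarith [sq_nonneg (l + l')]
      calc 1 + (p4 A : ℝ) ^ 2 ≤ C * u + n ^ 2 * ((2 * (C * u)) * ι α ^ 2) := by
            rw [r4, mul_pow, mul_pow _ (ι α)]; gcongr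
        _ ≤ C * u + n ^ 2 * ((2 * (C * u)) * ι α ^ 2) + 2 * n ^ 2 * (C * u) :=
            le_add_of_nonneg_right (by positivity)
        _ = _ := by rw [hS]; ring
    calc _ ≤ (Q * (w.2.im ^ 2 * u)) * ((Q * u) * ((S * C * u) * (S * C * u))) := by gcongr
      _ = Q * Q * (S * C) * (S * C) * w.2.im ^ 2 * u ^ 4 := by ring
      _ ≤ _ := by gcongr

/-- Raising to the power -3/4 makes the weights (1 + v²)^(-3/4) summable over ℤ, since 3/2 > 1, and
leaves the height with exponent 3/4 < 1, small enough for integrability on Siegel sets. -/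
theorem rpow_neg_three_le {X C Y u : ℝ} (hX : 0 < X) (hC : 0 < C) (hY : 0 < Y) (hu : 0 < u)
    (h : X ≤ C * Y * u ^ 4) :
    u ^ (-3 : ℝ) ≤ C ^ (3 / 4 : ℝ) * Y ^ (3 / 4 : ℝ) * X ^ (-(3 / 4) : ℝ) := by
  have h1 : u ^ (-3 : ℝ) = (u ^ 4) ^ (-(3 / 4) : ℝ) := by
    rw [← Real.rpow_natCast, ← Real.rpow_mul hu.le]; norm_num
  have h2 : (C * Y) ^ (-(3 / 4) : ℝ) * (u ^ 4) ^ (-(3 / 4) : ℝ) ≤ X ^ (-(3 / 4) : ℝ) := by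
    rw [← Real.mul_rpow (by positivity) (by positivity)]
    exact Real.rpow_le_rpow_of_nonpos hX h (by norm_num)
  rw [h1, ← Real.mul_rpow hC.le hY.le]
  rw [Real.rpow_neg (by positivity), inv_mul_le_iff₀ (by positivity)] at h2
  exact h2

/-- On a Siegel set, the series `∑ (1 + g)⁻³` is bounded by a power of the height. -/
theorem exists_siegel_series_bound (hK : Module.finrank ℚ K = 2) (hσ : σ ≠ AlgEquiv.refl)
    (hm : 0 < m) (N : SL(2, K)) {c : ℝ} (hc : 0 < c) (E B : ℝ) :
    ∃ C : ENNReal, C ≠ ⊤ ∧ ∀ w ∈ Siegel c E B,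
      ∑' A : Lm σ 𝔞 m, ENNReal.ofReal ((1 + g ι (vact σ N A) w) ^ (-3 : ℝ)) ≤
        C * (ENNReal.ofReal (w.1.im ^ (3 / 4 : ℝ)) * ENNReal.ofReal (w.2.im ^ (3 / 4 : ℝ))) := by
  obtain ⟨d, hd, hdet⟩ := exists_det_pos hK σ ι 𝔞 hm
  obtain ⟨e, C, he, hC, h⟩ := exists_coordinates (ι := ι) (𝔞 := 𝔞) hK hσ hm N hc E B
  set r : ℤ → ENNReal := fun v => ENNReal.ofReal ((1 + (v : ℝ) ^ 2) ^ (-(3 / 4) : ℝ)) with hr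
  set P : ℤ × ℤ × ℤ × ℤ → ENNReal := fun v => r v.1 * (r v.2.1 * (r v.2.2.1 * r v.2.2.2)) with hP
  have hP' : ∑' v, P v = (∑' v, r v) * ((∑' v, r v) * ((∑' v, r v) * (∑' v, r v))) := by
    simp only [hP, ENNReal.tsum_prod', ENNReal.tsum_mul_left, ENNReal.tsum_mul_right]
  have hr' : ∑' v, r v ≠ ⊤ := summable_int_weight
  refine ⟨ENNReal.ofReal (C ^ (3 / 4 : ℝ)) * ∑' v, P v, ?_, fun w hw => ?_⟩
  · rw [hP']
    exact ENNReal.mul_ne_top ENNReal.ofReal_ne_top (ENNReal.mul_ne_top hr'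
      (ENNReal.mul_ne_top hr' (ENNReal.mul_ne_top hr' hr')))
  · have y1 := w.1.im_pos
    have y2 := w.2.im_pos
    set Y : ENNReal := ENNReal.ofReal (w.1.im ^ (3 / 4 : ℝ)) * ENNReal.ofReal (w.2.im ^ (3 / 4 : ℝ))
      with hY
    calc _ ≤ ∑' A : Lm σ 𝔞 m, ENNReal.ofReal (C ^ (3 / 4 : ℝ)) * Y * P (e A) := by
          refine ENNReal.tsum_le_tsum fun A => ?_
          have hdA : 0 < ι (vact σ N A).det := by rw [det_vact, hdet A A.2]; exact hd
          have hu := one_le_one_add_g hdA w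
          have hb := rpow_neg_three_le (by positivity) hC (mul_pos y1 y2) (by linarith) (h A w hw)
          refine (ENNReal.ofReal_le_ofReal hb).trans (le_of_eq ?_)
          rw [Real.mul_rpow (x := w.1.im) y1.le y2.le, Real.mul_rpow (by positivity) (by positivity),
            Real.mul_rpow (by positivity) (by positivity),
            Real.mul_rpow (by positivity) (by positivity), ENNReal.ofReal_mul (by positivity),
            ENNReal.ofReal_mul (by positivity), ENNReal.ofReal_mul (by positivity),
            ENNReal.ofReal_mul (by positivity), ENNReal.ofReal_mul (by positivity),
            ENNReal.ofReal_mul (by positivity)]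
      _ = ENNReal.ofReal (C ^ (3 / 4 : ℝ)) * Y * ∑' A : Lm σ 𝔞 m, P (e A) := ENNReal.tsum_mul_left
      _ ≤ ENNReal.ofReal (C ^ (3 / 4 : ℝ)) * Y * ∑' v, P v := by
          gcongr
          exact ENNReal.tsum_comp_le_tsum_of_injective he P
      _ = _ := by ring

/-- Against dx dy/y² the weight y^(3/4) becomes y^(-5/4), which is integrable at infinity. -/
theorem lintegral_strip_ne_top {y0 : ℝ} (hy0 : 0 < y0) (B : ℝ) :
    ∫⁻ z in {z : ℍ | |z.re| ≤ B ∧ y0 ≤ z.im}, ENNReal.ofReal (z.im ^ (3 / 4 : ℝ)) ∂eta ≠ ⊤ := by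
  set f : ℝ × ℝ → ENNReal := fun p => (Set.Icc (-B) B).indicator 1 p.1 *
    (Set.Ici y0).indicator (fun y => ENNReal.ofReal (y ^ (3 / 4 : ℝ))) p.2 with hf
  have m1 : Measurable ((Set.Icc (-B) B).indicator (1 : ℝ → ENNReal)) :=
    measurable_one.indicator measurableSet_Icc
  have m2 : Measurable ((Set.Ici y0).indicator (fun y : ℝ => ENNReal.ofReal (y ^ (3 / 4 : ℝ)))) :=
    Measurable.indicator (by fun_prop) measurableSet_Ici
  have hfm : Measurable f := (m1.comp measurable_fst).mul (m2.comp measurable_snd)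
  have hS : MeasurableSet {z : ℍ | |z.re| ≤ B ∧ y0 ≤ z.im} :=
    ((isClosed_le UpperHalfPlane.continuous_re.abs continuous_const).inter
      (isClosed_le continuous_const UpperHalfPlane.continuous_im)).measurableSet
  have h1 : ∫⁻ z in {z : ℍ | |z.re| ≤ B ∧ y0 ≤ z.im}, ENNReal.ofReal (z.im ^ (3 / 4 : ℝ)) ∂eta =
      ∫⁻ z : ℍ, f (z.re, z.im) ∂eta := by
    rw [← lintegral_indicator hS]
    congr 1
    ext z
    by_cases hz1 : |z.re| ≤ B <;> by_cases hz2 : y0 ≤ z.im <;>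
      simp [hf, Set.indicator, hz1, hz2, ← abs_le]
  rw [h1, lintegral_eta hfm]
  refine ENNReal.mul_ne_top ENNReal.ofReal_ne_top (ne_top_of_le_ne_top ?_ (setLIntegral_le_lintegral _ _))
  have h2 : ∀ p : ℝ × ℝ, ENNReal.ofReal (1 / p.2 ^ 2) * f p = (Set.Icc (-B) B).indicator 1 p.1 *
      (Set.Ici y0).indicator (fun y => ENNReal.ofReal (y ^ (-(5 / 4) : ℝ))) p.2 := by
    intro p
    rw [hf, mul_left_comm]
    congr 1
    by_cases hp : y0 ≤ p.2
    · have : 0 < p.2 := hy0.trans_le hp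
      have hp' : p.2 ∈ Set.Ici y0 := hp
      rw [Set.indicator_of_mem hp', Set.indicator_of_mem hp', ← ENNReal.ofReal_mul (by positivity),
        one_div, ← Real.rpow_natCast, ← Real.rpow_neg this.le, ← Real.rpow_add this]
      norm_num
    · have hp' : p.2 ∉ Set.Ici y0 := hp
      rw [Set.indicator_of_notMem hp', Set.indicator_of_notMem hp', mul_zero]
  simp only [h2]
  have m3 : Measurable ((Set.Ici y0).indicator (fun y : ℝ => ENNReal.ofReal (y ^ (-(5 / 4) : ℝ)))) :=
    Measurable.indicator (by fun_prop) measurableSet_Ici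
  rw [Measure.volume_eq_prod, lintegral_prod_mul m1.aemeasurable m3.aemeasurable,
    lintegral_indicator_one measurableSet_Icc, lintegral_indicator measurableSet_Ici]
  refine ENNReal.mul_ne_top (by rw [Real.volume_Icc]; exact ENNReal.ofReal_ne_top) ?_
  have hint : IntegrableOn (fun t : ℝ => t ^ (-(5 / 4) : ℝ)) (Set.Ici y0) :=
    (integrableOn_Ici_iff_integrableOn_Ioi).2 (integrableOn_Ioi_rpow_of_lt (by norm_num) hy0)
  have := hint.lintegral_lt_top
  exact this.ne

theorem lintegral_siegel_ne_top {c : ℝ} (hc : 0 < c) (E B : ℝ) :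
    ∫⁻ w in Siegel c E B, ENNReal.ofReal (w.1.im ^ (3 / 4 : ℝ)) *
      ENNReal.ofReal (w.2.im ^ (3 / 4 : ℝ)) ∂omegaSq ≠ ⊤ := by
  obtain ⟨y0, hy0, Δ, h⟩ := exists_siegel_dist_bound hc E B
  set S := {z : ℍ | |z.re| ≤ B ∧ y0 ≤ z.im} with hS
  have hm : Measurable fun z : ℍ => ENNReal.ofReal (z.im ^ (3 / 4 : ℝ)) := by
    have := UpperHalfPlane.continuous_im.measurable
    fun_prop
  have hsub : Siegel c E B ⊆ S ×ˢ S := fun w hw =>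
    ⟨⟨hw.2.2.2.1, (h w hw).1.trans hw.2.1⟩, ⟨hw.2.2.2.2, (h w hw).1⟩⟩
  refine ne_top_of_le_ne_top ?_ (lintegral_mono_set hsub)
  rw [omegaSq, Measure.restrict_smul, lintegral_smul_measure, ← Measure.prod_restrict,
    lintegral_prod_mul hm.aemeasurable hm.aemeasurable]
  exact ENNReal.mul_ne_top (by norm_num) (ENNReal.mul_ne_top (lintegral_strip_ne_top hy0 B)
    (lintegral_strip_ne_top hy0 B))

/-- The permutation of `Lm` induced by an element of the Hilbert modular group. -/
def vactEquiv (hK : Module.finrank ℚ K = 2) (hσ : σ ≠ AlgEquiv.refl)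
    (𝔞 : (FractionalIdeal (𝓞 K)⁰ K)ˣ) (m : ℕ) {M : SL(2, K)} (hM : M ∈ Gam 𝔞) :
    Lm σ 𝔞 m ≃ Lm σ 𝔞 m where
  toFun A := ⟨vact σ M A, vact_mem_Lm hK hσ A.2 hM⟩
  invFun A := ⟨vact σ M⁻¹ A, vact_mem_Lm hK hσ A.2 (inv_mem hM)⟩
  left_inv A := Subtype.ext (by
    change vact σ M⁻¹ (vact σ M A) = A
    rw [← vact_mul, inv_mul_cancel, vact_one])
  right_inv A := Subtype.ext (by
    change vact σ M (vact σ M⁻¹ A) = A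
    rw [← vact_mul, mul_inv_cancel, vact_one])

/-- The unfolding identity is used in reverse: its left side is finite for k = (1+t)⁻³ by the bounds
on Siegel sets, and ∫ k > 0, so the volume cannot be infinite. -/
theorem volT_ne_top (hK : Module.finrank ℚ K = 2) (hσ : σ ≠ AlgEquiv.refl) (hm : 0 < m) :
    volT ι σ 𝔞 m ≠ ⊤ := by
  obtain ⟨F, hF⟩ := exists_isTransversal (ι := ι) (𝔞 := 𝔞) hK hσ
  obtain ⟨κ, hκ, N, c, E, B, hc, hcov⟩ := exists_siegel_cover hK hσ ι 𝔞
  have := countable_Lm (σ := σ) (𝔞 := 𝔞) (m := m)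
  set k : ℝ → ENNReal := fun t => ENNReal.ofReal ((1 + t) ^ (-3 : ℝ)) with hk
  have hkm : Measurable k := by fun_prop
  set S : κ → Set (ℍ × ℍ) := fun i => act ι σ (N i) ⁻¹' Siegel (c i) (E i) (B i) with hS
  have hSm : ∀ i, MeasurableSet (S i) := fun i =>
    measurable_act ι σ (N i) (measurableSet_Siegel _ _ _)
  set h : ℍ × ℍ → ENNReal := fun x => ∑' A : Lm σ 𝔞 m, k (g ι A x) with hh
  have hhm : Measurable h := Measurable.tsum fun A => hkm.comp measurable_g
  have hinv : ∀ M ∈ Gam 𝔞, ∀ x, h (act ι σ M x) = h x := by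
    intro M hM x
    change ∑' A : Lm σ 𝔞 m, k (g ι A (act ι σ M x)) = ∑' A : Lm σ 𝔞 m, k (g ι A x)
    rw [← (vactEquiv hK hσ 𝔞 m hM).tsum_eq]
    exact tsum_congr fun A => congrArg k (g_vact σ M A x)
  have hbound := hF.lintegral_le hhm hinv (MeasurableSet.iUnion hSm)
    (fun x => by
      obtain ⟨M, hM, i, hi⟩ := hcov x
      exact ⟨M, hM, Set.mem_iUnion.2 ⟨i, hi⟩⟩)
  have hfin : ∀ i, ∫⁻ x in S i, h x ∂omegaSq ≠ ⊤ := by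
    intro i
    obtain ⟨C, hC, hCb⟩ := exists_siegel_series_bound (ι := ι) (𝔞 := 𝔞) hK hσ hm (N i) (hc i) (E i)
      (B i)
    set G : ℍ × ℍ → ENNReal := fun w =>
      C * (ENNReal.ofReal (w.1.im ^ (3 / 4 : ℝ)) * ENNReal.ofReal (w.2.im ^ (3 / 4 : ℝ))) with hG
    have him := UpperHalfPlane.continuous_im.measurable
    have hGm' : Measurable fun w : ℍ × ℍ =>
        ENNReal.ofReal (w.1.im ^ (3 / 4 : ℝ)) * ENNReal.ofReal (w.2.im ^ (3 / 4 : ℝ)) := by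
      fun_prop
    have hGm : Measurable G := hGm'.const_mul C
    have hle : ∫⁻ x in S i, h x ∂omegaSq ≤ ∫⁻ x in S i, G (act ι σ (N i) x) ∂omegaSq := by
      refine setLIntegral_mono (hGm.comp (measurable_act ι σ (N i))) fun x hx => ?_
      refine le_trans (le_of_eq ?_) (hCb _ hx)
      exact tsum_congr fun A => by rw [g_vact]
    refine ne_top_of_le_ne_top ?_ hle
    rw [(measurePreserving_act ι σ (N i)).setLIntegral_comp_preimage
      (measurableSet_Siegel _ _ _) hGm, hG, lintegral_const_mul _ hGm']
    exact ENNReal.mul_ne_top hC (lintegral_siegel_ne_top (hc i) _ _)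
  have htot : ∫⁻ x in F, h x ∂omegaSq ≠ ⊤ := by
    refine ne_top_of_le_ne_top (ENNReal.mul_ne_top (by norm_num) ?_) hbound
    have := Fintype.ofFinite κ
    refine ne_top_of_le_ne_top ?_ (lintegral_iUnion_le S h)
    rw [tsum_fintype]
    exact ENNReal.sum_ne_top.2 fun i _ => hfin i
  rw [lintegral_tsum_g hK hσ hm hF hkm] at htot
  have hpos : ∫⁻ t in Set.Ioi 0, k t ≠ 0 := by
    have hsupp : Function.support k ∩ Set.Ioi 0 = Set.Ioi 0 := by
      refine Set.inter_eq_right.2 fun t ht => ?_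
      have ht' : (0 : ℝ) < t := ht
      have : 0 < (1 + t) ^ (-3 : ℝ) := by positivity
      simpa [hk] using this
    refine ((setLIntegral_pos_iff hkm).2 ?_).ne'
    rw [hsupp, Real.volume_Ioi]
    exact ENNReal.zero_lt_top
  intro htop
  rw [htop, ENNReal.mul_top (by norm_num), ENNReal.top_mul hpos] at htot
  exact htot rfl

end

section

/-! ### Series of functions in a compact smooth family -/

section SmoothFamily

variable {P E : Type*} [NormedAddCommGroup P] [NormedSpace ℝ P]
  [NormedAddCommGroup E] [NormedSpace ℝ E]

theorem norm_iteratedFDeriv_slice_le {G : P × E → ℂ} (hG : ContDiff ℝ ∞ G) (p : P) (z : E) (k : ℕ) :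
    ‖iteratedFDeriv ℝ k (fun z => G (p, z)) z‖ ≤
      ‖iteratedFDeriv ℝ k G (p, z)‖ * ‖ContinuousLinearMap.inr ℝ P E‖ ^ k := by
  have h : (fun z => G (p, z)) =
      (fun q => G ((p, 0) + q)) ∘ (ContinuousLinearMap.inr ℝ P E) := by
    ext z; simp
  have hG' : ContDiff ℝ ∞ (fun q => G ((p, (0 : E)) + q)) := by fun_prop
  rw [h, (ContinuousLinearMap.inr ℝ P E).iteratedFDeriv_comp_right hG' z
    (by exact_mod_cast le_top), iteratedFDeriv_comp_add_left]
  refine (ContinuousMultilinearMap.norm_compContinuousLinearMap_le _ _).trans (le_of_eq ?_)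
  simp

/-- On the compact set S × supp χ each derivative is bounded uniformly in the parameter, so the
derived series are dominated by multiples of ∑ ‖c a‖. -/
theorem contDiff_tsum_of_isCompact {α : Type*} {χ : E → ℂ} (hχ : ContDiff ℝ ∞ χ)
    (hχc : HasCompactSupport χ) {H : P × E → ℂ} (hH : ContDiff ℝ ∞ H) {S : Set P}
    (hS : IsCompact S) {x : α → P} (hx : ∀ a, x a ∈ S) {c : α → ℂ} (hc : Summable fun a => ‖c a‖) :
    ContDiff ℝ ∞ fun z => ∑' a, c a * (χ z * H (x a, z)) := by
  set G : P × E → ℂ := fun q => χ q.2 * H q with hG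
  have hGs : ContDiff ℝ ∞ G := (hχ.comp contDiff_snd).mul hH
  have hbd : ∀ k : ℕ, ∃ C : ℝ, ∀ p ∈ S, ∀ z, ‖iteratedFDeriv ℝ k (fun z => G (p, z)) z‖ ≤ C := by
    intro k
    obtain ⟨C, hC⟩ := (hS.prod hχc).exists_bound_of_continuousOn
      (hGs.continuous_iteratedFDeriv (m := k) (by exact_mod_cast le_top)).continuousOn
    refine ⟨|C| * ‖ContinuousLinearMap.inr ℝ P E‖ ^ k, fun p hp z => ?_⟩
    by_cases hz : z ∈ tsupport χ
    · refine (norm_iteratedFDeriv_slice_le hGs p z k).trans ?_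
      gcongr
      exact (hC (p, z) ⟨hp, hz⟩).trans (le_abs_self C)
    · have h0 : iteratedFDeriv ℝ k (fun z => G (p, z)) z = 0 := by
        by_contra hne
        refine hz (tsupport_mul_subset_left (f := χ) (g := fun z => H (p, z))
          (support_iteratedFDeriv_subset k hne))
      rw [h0, norm_zero]; positivity
  choose C hC using hbd
  refine contDiff_tsum (N := ⊤) (v := fun k a => ‖c a‖ * C k) (fun a => ?_)
    (fun k _ => hc.mul_right _) (fun k a z _ => ?_)
  · have : ContDiff ℝ ∞ fun z => G (x a, z) := hGs.comp (contDiff_const.prodMk contDiff_id)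
    exact contDiff_const.mul this
  · have h1 : ContDiff ℝ ∞ fun z => G (x a, z) := hGs.comp (contDiff_const.prodMk contDiff_id)
    have h2 : (fun z => c a * (χ z * H (x a, z))) = c a • fun z => G (x a, z) := by
      ext z; simp [hG]
    rw [h2, iteratedFDeriv_const_smul_apply ((h1.of_le (by exact_mod_cast le_top)).contDiffAt),
      norm_smul]
    gcongr
    exact hC k _ (hx a) z

theorem ofReal_cpow_eq_exp {u : ℝ} (hu : 0 < u) (s : ℂ) :
    (u : ℂ) ^ s = Complex.exp (Real.log u * s) := by
  rw [Complex.cpow_def_of_ne_zero (by exact_mod_cast hu.ne'), Complex.ofReal_log hu.le]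

theorem contDiffAt_ofReal_cpow {u : ℝ} (hu : 0 < u) (s : ℂ) :
    ContDiffAt ℝ ∞ (fun u : ℝ => (u : ℂ) ^ s) u := by
  have h : ContDiffAt ℝ ∞ (fun u : ℝ => Complex.exp (Real.log u * s)) u :=
    ((Complex.ofRealCLM.contDiff.contDiffAt.comp u (Real.contDiffAt_log.2 hu.ne')).mul
      contDiffAt_const).cexp
  refine h.congr_of_eventuallyEq ?_
  filter_upwards [lt_mem_nhds hu] with v hv
  exact ofReal_cpow_eq_exp hv s

/-- A smooth function on `ℝ` that agrees with `u ↦ u ^ s` for `u ≥ c`. -/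
theorem exists_smooth_cpow {c : ℝ} (hc : 0 < c) (s : ℂ) : ∃ φ : ℝ → ℂ, ContDiff ℝ ∞ φ ∧
    ∀ u, c ≤ u → φ u = (u : ℂ) ^ s := by
  -- The cutoff vanishes for u ≤ c/2, away from the singularity at 0, and is 1 from c on.
  refine ⟨fun u => (Real.smoothTransition ((u - c / 2) / (c / 2)) : ℂ) * (u : ℂ) ^ s, ?_, ?_⟩
  · rw [contDiff_iff_contDiffAt]
    intro u
    rcases lt_or_ge u (c / 2) with hu | hu
    · refine (contDiffAt_const (c := (0 : ℂ))).congr_of_eventuallyEq ?_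
      filter_upwards [gt_mem_nhds hu] with v hv
      rw [Real.smoothTransition.zero_of_nonpos
        (div_nonpos_of_nonpos_of_nonneg (by linarith) (by linarith))]
      simp
    · refine ContDiffAt.mul ?_ (contDiffAt_ofReal_cpow (by linarith) s)
      have : ContDiff ℝ ∞ fun u : ℝ => Real.smoothTransition ((u - c / 2) / (c / 2)) :=
        Real.smoothTransition.contDiff.comp (by fun_prop)
      exact (Complex.ofRealCLM.contDiff.comp this).contDiffAt
  · intro u hu
    dsimp only
    rw [Real.smoothTransition.one_of_one_le (by rw [one_le_div (by linarith)]; linarith)]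
    simp

end SmoothFamily

/-! ### Convergence and smoothness of the series -/

variable {K : Type*} [Field K] [NumberField K] {ι : K →+* ℝ} {σ : K ≃ₐ[ℚ] K}
  {𝔞 : (FractionalIdeal (𝓞 K)⁰ K)ˣ} {A : Matrix (Fin 2) (Fin 2) K} {m : ℕ}

theorem lintegral_one_add_rpow_ne_top {τ : ℝ} (hτ : 1 < τ) :
    ∫⁻ t in Set.Ioi (0 : ℝ), ENNReal.ofReal ((1 + t) ^ (-τ)) ≠ ⊤ := by
  have h := integrableOn_add_rpow_Ioi_of_lt (a := -τ) (c := 0) (m := 1) (by linarith) (by norm_num)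
  have := h.lintegral_lt_top
  simp only [add_comm _ (1 : ℝ)] at this
  exact this.ne

/-- If F were null, unfolding the constant 1 would give total mass zero. -/
theorem IsTransversal.measure_ne_zero {F : Set (ℍ × ℍ)} (hF : IsTransversal ι σ 𝔞 F) :
    omegaSq F ≠ 0 := by
  intro h0
  have h := hF.lintegral_tsum_act (ψ := fun _ => 1) measurable_const
  rw [Measure.restrict_eq_zero.2 h0, lintegral_zero_measure, lintegral_one, eq_comm, mul_eq_zero,
    omegaSq, Measure.smul_apply, smul_eq_mul, mul_eq_zero, ← Set.univ_prod_univ,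
    Measure.prod_prod, mul_self_eq_zero, Measure.measure_univ_eq_zero] at h
  simp [eta_univ_ne_zero] at h

theorem rpow_one_add_g_le (h : 0 < ι A.det) {τ : ℝ} (hτ : 0 < τ) (z w : ℍ × ℍ) :
    (1 + g ι A z) ^ (-τ) ≤ Real.exp (dist w.1 z.1 + dist w.2 z.2) ^ τ * (1 + g ι A w) ^ (-τ) := by
  have h1 := one_add_g_le h w z
  have hz := one_le_one_add_g h z
  have hw := one_le_one_add_g h w
  have h2 := Real.rpow_le_rpow_of_nonpos (by linarith) h1 (by linarith : -τ ≤ 0)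
  rw [Real.mul_rpow (Real.exp_pos _).le (by linarith), Real.rpow_neg (Real.exp_pos _).le,
    inv_mul_le_iff₀ (by positivity)] at h2
  exact h2

/-- A finite integral over F gives convergence almost everywhere, hence at some w because F is not
null. The bounded ratio in `one_add_g_le` carries convergence from w to z. -/
theorem summable_rpow (hK : Module.finrank ℚ K = 2) (hσ : σ ≠ AlgEquiv.refl) (hm : 0 < m)
    {τ : ℝ} (hτ : 1 < τ) (z : ℍ × ℍ) :
    Summable fun A : Lm σ 𝔞 m => (1 + g ι A z) ^ (-τ) := by
  obtain ⟨F, hF⟩ := exists_isTransversal (ι := ι) (𝔞 := 𝔞) hK hσ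
  have := countable_Lm (σ := σ) (𝔞 := 𝔞) (m := m)
  obtain ⟨d, hd, hdet⟩ := exists_det_pos hK σ ι 𝔞 hm
  have hdet' : ∀ A : Lm σ 𝔞 m, 0 < ι (A : Matrix (Fin 2) (Fin 2) K).det := fun A => by
    rw [hdet A A.2]; exact hd
  set k : ℝ → ENNReal := fun t => ENNReal.ofReal ((1 + t) ^ (-τ)) with hk
  have hkm : Measurable k := by fun_prop
  have hfin : ∫⁻ x in F, ∑' A : Lm σ 𝔞 m, k (g ι A x) ∂omegaSq ≠ ⊤ := by
    rw [lintegral_tsum_g hK hσ hm hF hkm]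
    exact ENNReal.mul_ne_top (ENNReal.mul_ne_top (by norm_num) (volT_ne_top hK hσ hm))
      (lintegral_one_add_rpow_ne_top hτ)
  have hae := ae_lt_top (Measurable.tsum fun A : Lm σ 𝔞 m => hkm.comp measurable_g) hfin
  have : NeZero (omegaSq.restrict F) := ⟨fun h => hF.measure_ne_zero (Measure.restrict_eq_zero.1 h)⟩
  obtain ⟨w, hw⟩ := hae.exists
  have hs : Summable fun A : Lm σ 𝔞 m => (1 + g ι A w) ^ (-τ) := by
    have := ENNReal.summable_toReal hw.ne
    refine this.congr fun A => ?_
    have := one_le_one_add_g (hdet' A) w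
    exact ENNReal.toReal_ofReal (by positivity)
  refine Summable.of_nonneg_of_le (fun A => ?_) (fun A => ?_)
    (hs.mul_left (Real.exp (dist w.1 z.1 + dist w.2 z.2) ^ τ))
  · have := one_le_one_add_g (hdet' A) z
    positivity
  · exact rpow_one_add_g_le (hdet' A) (by linarith) z w

theorem norm_psiTerm (h : 0 < ι A.det) (s : ℂ) (z : ℍ × ℍ) :
    ‖psiTerm ι s A z‖ = (1 + g ι A z) ^ (-s.re) := by
  have := one_le_one_add_g h z
  rw [psiTerm, Complex.norm_cpow_eq_rpow_re_of_pos (by linarith), Complex.neg_re]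

theorem summable_norm_psiTerm (hK : Module.finrank ℚ K = 2) (hσ : σ ≠ AlgEquiv.refl) (hm : 0 < m)
    {s : ℂ} (hs : 1 < s.re) (z : ℍ × ℍ) :
    Summable fun A : Lm σ 𝔞 m => ‖psiTerm ι s A z‖ := by
  obtain ⟨d, hd, hdet⟩ := exists_det_pos hK σ ι 𝔞 hm
  refine (summable_rpow (ι := ι) (𝔞 := 𝔞) hK hσ hm hs z).congr fun A => ?_
  rw [norm_psiTerm (by rw [hdet A A.2]; exact hd)]

/-- `|b z₁ z₂ - λ z₁ - λ' z₂ + a|² + 4 y₁ y₂ t` as a polynomial map of `(a, b, λ, λ', t)` and `z`. -/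
def quad (q : (ℝ × ℝ × ℝ × ℝ × ℝ) × (ℂ × ℂ)) : ℝ :=
  Complex.normSq (q.1.2.1 * q.2.1 * q.2.2 - q.1.2.2.1 * q.2.1 - q.1.2.2.2.1 * q.2.2 + q.1.1) +
    4 * q.2.1.im * q.2.2.im * q.1.2.2.2.2

theorem contDiff_quad : ContDiff ℝ ∞ quad := by
  have hre : ContDiff ℝ ∞ Complex.re := Complex.reCLM.contDiff
  have him : ContDiff ℝ ∞ Complex.im := Complex.imCLM.contDiff
  have hof : ContDiff ℝ ∞ (fun x : ℝ => (x : ℂ)) := Complex.ofRealCLM.contDiff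
  unfold quad
  simp only [Complex.normSq_apply]
  fun_prop

/-- The coordinates of `A` divided by `r`. -/
def coords (ι : K →+* ℝ) (A : Matrix (Fin 2) (Fin 2) K) (r : ℝ) : ℝ × ℝ × ℝ × ℝ × ℝ :=
  (ι (A 0 0) / r, ι (A 1 1) / r, ι (A 1 0) / r, ι (A 0 1) / r, ι A.det / r ^ 2)

theorem quad_coords (h : 0 < ι A.det) {r : ℝ} (hr : 0 < r) (z : ℍ × ℍ) :
    quad (coords ι A r, ((z.1 : ℂ), (z.2 : ℂ))) =
      4 * z.1.im * z.2.im * ι A.det * (1 + g ι A z) / r ^ 2 := by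
  have y1 := z.1.im_pos
  have y2 := z.2.im_pos
  have hlin : ((ι (A 1 1) / r : ℝ) * z.1 * z.2 - (ι (A 1 0) / r : ℝ) * z.1 -
      (ι (A 0 1) / r : ℝ) * z.2 + (ι (A 0 0) / r : ℝ) : ℂ) = ((1 / r : ℝ) : ℂ) * lin ι A z := by
    rw [lin]; push_cast; ring
  rw [quad, coords]
  simp only
  rw [hlin, Complex.normSq_mul, Complex.normSq_ofReal, Complex.normSq_eq_norm_sq, g]
  simp only [UpperHalfPlane.coe_im]
  field_simp
  ring

/-- The entries of A are bounded by a multiple of √(1 + g(A, (i, i))), which is comparable with √(1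
+ g(A, z)) uniformly in A. -/
theorem exists_coords_bound {d : ℝ} (hd : 0 < d) (z : ℍ × ℍ) : ∃ R : ℝ,
    ∀ A : Matrix (Fin 2) (Fin 2) K, ι A.det = d →
      coords ι A √(1 + g ι A z) ∈ Metric.closedBall 0 R := by
  set w : ℍ × ℍ := (⟨⟨0, 1⟩, one_pos⟩, ⟨⟨0, 1⟩, one_pos⟩) with hw
  set D := Real.exp (dist w.1 z.1 + dist w.2 z.2) with hD
  have hD0 : 0 < D := Real.exp_pos _
  refine ⟨√(4 * d * D) + d, fun A hA => ?_⟩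
  have hdet : 0 < ι A.det := by rw [hA]; exact hd
  have h1 := entries_le_on_imaginary_axis hdet one_pos
  have h2 := one_add_g_le hdet w z
  have hu := one_le_one_add_g hdet z
  have hr2 : √(1 + g ι A z) ^ 2 = 1 + g ι A z := Real.sq_sqrt (by linarith)
  have hr : 0 < √(1 + g ι A z) := Real.sqrt_pos.2 (by linarith)
  have hsum : ι (A 0 0) ^ 2 + ι (A 1 1) ^ 2 + (ι (A 1 0) ^ 2 + ι (A 0 1) ^ 2) ≤
      4 * d * D * (1 + g ι A z) := by
    rw [hA] at h1
    calc _ ≤ 4 * d * (1 + g ι A w) := by simpa using h1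
      _ ≤ 4 * d * (D * (1 + g ι A z)) := by gcongr
      _ = _ := by ring
  have key : ∀ x : ℝ, x ^ 2 ≤ 4 * d * D * (1 + g ι A z) →
      ‖x / √(1 + g ι A z)‖ ≤ √(4 * d * D) + d := by
    intro x hx
    have : ‖x / √(1 + g ι A z)‖ ≤ √(4 * d * D) := by
      apply Real.abs_le_sqrt
      rw [div_pow, hr2, div_le_iff₀ (by linarith)]
      exact hx
    linarith
  rw [mem_closedBall_zero_iff, coords]
  simp only [Prod.norm_def, sup_le_iff]
  refine ⟨key _ ?_, key _ ?_, key _ ?_, key _ ?_, ?_⟩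
  · nlinarith [sq_nonneg (ι (A 1 1)), sq_nonneg (ι (A 1 0)), sq_nonneg (ι (A 0 1))]
  · nlinarith [sq_nonneg (ι (A 0 0)), sq_nonneg (ι (A 1 0)), sq_nonneg (ι (A 0 1))]
  · nlinarith [sq_nonneg (ι (A 0 0)), sq_nonneg (ι (A 1 1)), sq_nonneg (ι (A 0 1))]
  · nlinarith [sq_nonneg (ι (A 0 0)), sq_nonneg (ι (A 1 1)), sq_nonneg (ι (A 1 0))]
  · rw [hr2, hA, Real.norm_of_nonneg (by positivity)]
    have : d / (1 + g ι A z) ≤ d := div_le_self hd.le hu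
    have := Real.sqrt_nonneg (4 * d * D)
    linarith

/-- This separates a common factor, a coefficient depending on r, and a function of bounded
parameters. All bases are positive reals, so complex powers multiply. -/
theorem psiTerm_eq (h : 0 < ι A.det) {r : ℝ} (hr : 0 < r) (s : ℂ) (z : ℍ × ℍ) :
    psiTerm ι s A z = ((4 * z.1.im * z.2.im * ι A.det : ℝ) : ℂ) ^ s *
      (((r ^ 2 : ℝ) : ℂ) ^ (-s) *
        ((quad (coords ι A r, ((z.1 : ℂ), (z.2 : ℂ))) : ℝ) : ℂ) ^ (-s)) := by
  have y1 := z.1.im_pos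
  have y2 := z.2.im_pos
  have hu := one_le_one_add_g h z
  rw [quad_coords h hr, ← Complex.mul_cpow_ofReal_nonneg (by positivity) (by positivity),
    ← Complex.ofReal_mul, mul_div_cancel₀ _ (by positivity), Complex.ofReal_mul _ (1 + g ι A z),
    Complex.mul_cpow_ofReal_nonneg (by positivity) (by linarith), ← mul_assoc, ← Complex.cpow_add
    _ _ (by exact_mod_cast (by positivity : 4 * z.1.im * z.2.im * ι A.det ≠ 0)),
    add_neg_cancel, Complex.cpow_zero, one_mul, psiTerm]

/-- With r² = 1 + g(A, z₀), the coefficients in `psiTerm_eq` are the terms of the series at z₀ and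
the parameters lie in a compact ball. Near z₀ the bump function is 1 and φ agrees with the power, so
`contDiff_tsum_of_isCompact` applies. -/
theorem contDiffAt_Psi (hK : Module.finrank ℚ K = 2) (hσ : σ ≠ AlgEquiv.refl) (hm : 0 < m)
    {s : ℂ} (hs : 1 < s.re) (z₀ : ℍ × ℍ) :
    ContDiffAt ℝ ∞ (fun z : ℂ × ℂ =>
      Psi ι σ 𝔞 m s (UpperHalfPlane.ofComplex z.1, UpperHalfPlane.ofComplex z.2))
      ((z₀.1 : ℂ), (z₀.2 : ℂ)) := by
  obtain ⟨d, hd, hdet⟩ := exists_det_pos hK σ ι 𝔞 hm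
  have hdet' : ∀ A : Lm σ 𝔞 m, 0 < ι (A : Matrix (Fin 2) (Fin 2) K).det := fun A => by
    rw [hdet A A.2]; exact hd
  obtain ⟨R, hR⟩ := exists_coords_bound (K := K) (ι := ι) hd z₀
  have y1 := z₀.1.im_pos
  have y2 := z₀.2.im_pos
  -- At z₀ the value of `quad` is 4y₁y₂d for every A. Half of it remains a lower bound near z₀,
  -- uniformly in A, by `one_add_g_le`.
  set c : ℝ := 2 * z₀.1.im * z₀.2.im * d with hc
  have hc0 : 0 < c := by positivity
  obtain ⟨φ, hφ, hφc⟩ := exists_smooth_cpow hc0 (-s)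
  let b : ContDiffBump ((z₀.1 : ℂ), (z₀.2 : ℂ)) := ⟨1, 2, one_pos, one_lt_two⟩
  have hb : ContDiff ℝ ∞ fun z : ℂ × ℂ => ((b z : ℝ) : ℂ) :=
    Complex.ofRealCLM.contDiff.comp b.contDiff
  have hbc : HasCompactSupport fun z : ℂ × ℂ => ((b z : ℝ) : ℂ) :=
    b.hasCompactSupport.comp_left (g := fun x : ℝ => (x : ℂ)) Complex.ofReal_zero
  have hcoef : Summable fun A : Lm σ 𝔞 m => ‖psiTerm ι s A z₀‖ := summable_norm_psiTerm hK hσ hm hs z₀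
  have hsmooth := contDiff_tsum_of_isCompact hb hbc (hφ.comp contDiff_quad)
    (isCompact_closedBall (0 : ℝ × ℝ × ℝ × ℝ × ℝ) R) (fun A : Lm σ 𝔞 m => hR A (hdet A A.2)) hcoef
  have hfac : ContDiffAt ℝ ∞ (fun z : ℂ × ℂ => ((4 * z.1.im * z.2.im * d : ℝ) : ℂ) ^ s)
      ((z₀.1 : ℂ), (z₀.2 : ℂ)) := by
    have him : ContDiff ℝ ∞ Complex.im := Complex.imCLM.contDiff
    have : ContDiff ℝ ∞ (fun z : ℂ × ℂ => 4 * z.1.im * z.2.im * d) := by fun_prop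
    exact (contDiffAt_ofReal_cpow (by simp only [UpperHalfPlane.coe_im]; positivity) s).comp _
      this.contDiffAt
  refine (hfac.mul hsmooth.contDiffAt).congr_of_eventuallyEq ?_
  have e1 : ∀ᶠ z : ℂ × ℂ in nhds ((z₀.1 : ℂ), (z₀.2 : ℂ)), 0 < z.1.im ∧ 0 < z.2.im :=
    (isOpen_lt continuous_const (Complex.continuous_im.comp continuous_fst)).inter
      (isOpen_lt continuous_const (Complex.continuous_im.comp continuous_snd)) |>.mem_nhds
      ⟨z₀.1.im_pos, z₀.2.im_pos⟩
  have e2 : ∀ᶠ z : ℂ × ℂ in nhds ((z₀.1 : ℂ), (z₀.2 : ℂ)), b z = 1 := b.eventuallyEq_one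
  have e3 : ∀ᶠ z : ℂ × ℂ in nhds ((z₀.1 : ℂ), (z₀.2 : ℂ)), c < 4 * z.1.im * z.2.im * d *
      Real.exp (-(dist z₀.1 (UpperHalfPlane.ofComplex z.1) +
        dist z₀.2 (UpperHalfPlane.ofComplex z.2))) := by
    have t1 : ContinuousAt UpperHalfPlane.ofComplex (z₀.1 : ℂ) :=
      (UpperHalfPlane.contMDiffAt_ofComplex (n := 0) z₀.1.im_pos).continuousAt
    have t2 : ContinuousAt UpperHalfPlane.ofComplex (z₀.2 : ℂ) :=
      (UpperHalfPlane.contMDiffAt_ofComplex (n := 0) z₀.2.im_pos).continuousAt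
    have t1' : ContinuousAt (fun z : ℂ × ℂ => UpperHalfPlane.ofComplex z.1)
      ((z₀.1 : ℂ), (z₀.2 : ℂ)) := ContinuousAt.comp (f := Prod.fst) t1 continuousAt_fst
    have t2' : ContinuousAt (fun z : ℂ × ℂ => UpperHalfPlane.ofComplex z.2)
      ((z₀.1 : ℂ), (z₀.2 : ℂ)) := ContinuousAt.comp (f := Prod.snd) t2 continuousAt_snd
    have him := Complex.continuous_im
    have hcont : ContinuousAt (fun z : ℂ × ℂ => 4 * z.1.im * z.2.im * d *
      Real.exp (-(dist z₀.1 (UpperHalfPlane.ofComplex z.1) +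
        dist z₀.2 (UpperHalfPlane.ofComplex z.2)))) ((z₀.1 : ℂ), (z₀.2 : ℂ)) := by
      fun_prop
    refine hcont.eventually (lt_mem_nhds ?_)
    simp only [UpperHalfPlane.ofComplex_apply, dist_self, add_zero, neg_zero, Real.exp_zero,
      mul_one, UpperHalfPlane.coe_im]
    rw [hc]
    have : 0 < z₀.1.im * z₀.2.im * d := by positivity
    linarith
  filter_upwards [e1, e2, e3] with z hz hbz hcz
  rw [UpperHalfPlane.ofComplex_apply_of_im_pos hz.1, UpperHalfPlane.ofComplex_apply_of_im_pos hz.2]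
    at *
  rw [Psi, ← tsum_mul_left]
  refine tsum_congr fun A => ?_
  have hu := one_le_one_add_g (hdet' A) z₀
  have hr2 : √(1 + g ι A z₀) ^ 2 = 1 + g ι A z₀ := Real.sq_sqrt (by linarith)
  have hr : 0 < √(1 + g ι A z₀) := Real.sqrt_pos.2 (by linarith)
  rw [psiTerm_eq (hdet' A) hr, hr2, hdet A A.2, hbz, Complex.ofReal_one, one_mul]
  congr 2
  refine (hφc _ ?_).symm
  rw [quad_coords (z := (⟨z.1, hz.1⟩, ⟨z.2, hz.2⟩)) (hdet' A) hr, hr2, hdet A A.2]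
  refine hcz.le.trans ?_
  have hg := one_add_g_le (hdet' A) z₀ (⟨z.1, hz.1⟩, ⟨z.2, hz.2⟩)
  rw [mul_div_assoc]
  have hz1 : 0 < z.1.im := hz.1
  have hz2 : 0 < z.2.im := hz.2
  refine mul_le_mul_of_nonneg_left ?_ (by positivity)
  rw [Real.exp_neg, le_div_iff₀ (by linarith), inv_mul_le_iff₀ (Real.exp_pos _)]
  exact hg

theorem contDiffOn_Psi (hK : Module.finrank ℚ K = 2) (hσ : σ ≠ AlgEquiv.refl) (hm : 0 < m)
    {s : ℂ} (hs : 1 < s.re) :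
    ContDiffOn ℝ ∞ (fun z : ℂ × ℂ =>
      Psi ι σ 𝔞 m s (UpperHalfPlane.ofComplex z.1, UpperHalfPlane.ofComplex z.2))
      {z : ℂ × ℂ | 0 < z.1.im ∧ 0 < z.2.im} := fun z hz =>
  (contDiffAt_Psi hK hσ hm hs (⟨z.1, hz.1⟩, ⟨z.2, hz.2⟩)).contDiffWithinAt

end

section

variable {K : Type*} [Field K] [NumberField K] {ι : K →+* ℝ} {σ : K ≃ₐ[ℚ] K}
  {𝔞 : (FractionalIdeal (𝓞 K)⁰ K)ˣ} {A : Matrix (Fin 2) (Fin 2) K} {m : ℕ}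

/-! ### The area of the divisor -/

/-- The second projection from `T_A` to `ℍ`. -/
def curveEquiv (h : 0 < ι A.det) : curve ι A ≃ᵐ ℍ where
  toFun z := (z : ℍ × ℍ).2
  invFun w := ⟨(moeb ι A h • w, w), (lin_eq_zero_iff h _).2 rfl⟩
  left_inv z := Subtype.ext (Prod.ext ((lin_eq_zero_iff h _).1 z.2).symm rfl)
  right_inv _ := rfl
  measurable_toFun := measurable_snd.comp measurable_subtype_coe
  measurable_invFun := Measurable.subtype_mk
    ((measurePreserving_gl (moeb ι A h)).measurable.prodMk measurable_id)

/-- The action of `GL₂(ℝ)` on `ℍ` by measurable equivalences. -/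
def glEquiv (M : GL (Fin 2) ℝ) : ℍ ≃ᵐ ℍ where
  toFun z := M • z
  invFun z := M⁻¹ • z
  left_inv z := inv_smul_smul M z
  right_inv z := smul_inv_smul M z
  measurable_toFun := (measurePreserving_gl M).measurable
  measurable_invFun := (measurePreserving_gl M⁻¹).measurable

/-- The first coordinate is the second followed by `moeb`, which preserves `eta`, so both pullbacks
agree. -/
theorem curveArea_eq (h : 0 < ι A.det) :
    curveArea ι A = (2 : ENNReal) • eta.map (curveEquiv h).symm := by
  have h1 : (fun z : curve ι A => (z : ℍ × ℍ).1) = (curveEquiv h).trans (glEquiv (moeb ι A h)) := by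
    ext z : 1
    exact (lin_eq_zero_iff h _).1 z.2
  have h2 : (fun z : curve ι A => (z : ℍ × ℍ).2) = curveEquiv h := rfl
  have h3 : eta.map (glEquiv (moeb ι A h)).symm = eta := (measurePreserving_gl (moeb ι A h)⁻¹).map_eq
  rw [curveArea, h1, h2, ← MeasurableEquiv.map_symm, ← MeasurableEquiv.map_symm, two_smul]
  congr 1
  conv_rhs => rw [← h3]
  rw [Measure.map_map (curveEquiv h).symm.measurable (glEquiv (moeb ι A h)).symm.measurable]
  rfl

/-- Two different curves of the same determinant meet in at most one point. -/
theorem subsingleton_inter_curve {B : Matrix (Fin 2) (Fin 2) K} (h : 0 < ι A.det)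
    (hdet : ι B.det = ι A.det) (h1 : B ≠ A) (h2 : B ≠ -A) :
    {w : ℍ | lin ι B (moeb ι A h • w, w) = 0}.Subsingleton := by
  have hB : 0 < ι B.det := by rw [hdet]; exact h
  have hset : {w : ℍ | lin ι B (moeb ι A h • w, w) = 0} =
      {w : ℍ | ((moeb ι B hB)⁻¹ * moeb ι A h) • w = w} := by
    ext w
    rw [Set.mem_ofPred_eq, Set.mem_ofPred_eq, lin_eq_zero_iff hB, mul_smul, inv_smul_eq_iff]
  rw [hset]
  refine subsingleton_fixed ?_ ?_
  · rw [← Matrix.GeneralLinearGroup.val_det_apply, map_mul, map_inv, Units.val_mul, moeb_det,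
      Units.val_inv_eq_inv_val, moeb_det]
    positivity
  -- A central quotient would give A = cB, and equal determinants force c² = 1.
  · intro hc
    rw [Matrix.GeneralLinearGroup.mem_center_iff_val_mem_range_scalar] at hc
    obtain ⟨c, hc⟩ := hc
    have hmul : (moeb ι A h : Matrix (Fin 2) (Fin 2) ℝ) =
        (moeb ι B hB : Matrix (Fin 2) (Fin 2) ℝ) * Matrix.scalar (Fin 2) c := by
      rw [hc, ← Units.val_mul, mul_inv_cancel_left]
    rw [moeb_coe, moeb_coe] at hmul
    have e := fun i j => congrFun (congrFun hmul i) j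
    have e00 := e 0 0
    have e01 := e 0 1
    have e10 := e 1 0
    have e11 := e 1 1
    simp [Matrix.mul_apply, Matrix.diagonal_apply] at e00 e01 e10 e11
    have hd : ι A.det = c ^ 2 * ι B.det := by
      rw [Matrix.det_fin_two, Matrix.det_fin_two]
      simp only [map_sub, map_mul]
      rw [e00, e10, e11, e01]; ring
    have hc2 : c ^ 2 = 1 := by
      rw [hdet] at hd
      exact mul_right_cancel₀ h.ne' (by rw [← hd, one_mul])
    have hinj := ι.injective
    rcases sq_eq_one_iff.1 hc2 with rfl | rfl
    · apply h1
      ext i j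
      fin_cases i <;> fin_cases j <;> apply hinj <;> simp [e00, e01, e10, e11]
    · apply h2
      ext i j
      fin_cases i <;> fin_cases j <;> apply hinj <;> simp [e00, e01, e10, e11]

/-- The points of `ℍ` over which `T_A` meets another component of the divisor. -/
def crossings (σ : K ≃ₐ[ℚ] K) (𝔞 : (FractionalIdeal (𝓞 K)⁰ K)ˣ) (m : ℕ) (h : 0 < ι A.det) :
    Set ℍ :=
  ⋃ B : {B : Lm σ 𝔞 m // (B : Matrix (Fin 2) (Fin 2) K) ≠ A ∧ (B : Matrix (Fin 2) (Fin 2) K) ≠ -A},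
    {w : ℍ | lin ι (B : Lm σ 𝔞 m) (moeb ι A h • w, w) = 0}

theorem countable_crossings (hK : Module.finrank ℚ K = 2) (hm : 0 < m) (h : 0 < ι A.det) (hA : A ∈ Lm σ 𝔞 m) :
    (crossings σ 𝔞 m h).Countable := by
  obtain ⟨d, hd, hdet⟩ := exists_det_pos hK σ ι 𝔞 hm
  have := countable_Lm (σ := σ) (𝔞 := 𝔞) (m := m)
  exact Set.countable_iUnion fun B => (subsingleton_inter_curve h
    (by rw [hdet _ B.1.2, hdet _ hA]) B.2.1 B.2.2).countable

/-- If M maps a point of T_A to y in T_A, then y also lies on the curve of M.A. Unless M stabilizes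
±A, this is a crossing. Removing the countable null set Z from E therefore leaves a transversal for
Γ(𝔞)-equivalence on T_A. -/
theorem quotientMeasure_curveArea (hK : Module.finrank ℚ K = 2) (hσ : σ ≠ AlgEquiv.refl)
    (hm : 0 < m) (h : 0 < ι A.det) (hA : A ∈ Lm σ 𝔞 m) {E : Set ℍ}
    (hE : IsStabTransversal ι σ 𝔞 A E) :
    quotientMeasure (Setoid.comap (Subtype.val : curve ι A → ℍ × ℍ) (orbitSetoid ι σ 𝔞))
      (curveArea ι A) Set.univ = 2 * eta E := by
  have hZ := countable_crossings hK hm h hA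
  set Z := crossings σ 𝔞 m h with hZdef
  have hZm : MeasurableSet Z := hZ.measurableSet
  have hZ0 : eta Z = 0 := hZ.measure_zero eta
  set e := curveEquiv h with he
  set sl := fun M : SL(2, K) => Matrix.SpecialLinearGroup.map (ι.comp (σ : K →+* K)) M with hsl
  have hact : ∀ M ∈ stab σ 𝔞 A, ∀ x : curve ι A,
      act ι σ M x = (e.symm (sl M • e x) : curve ι A) := by
    intro M hM x
    exact Prod.ext (moeb_act_snd h hM ((lin_eq_zero_iff h _).1 x.2)) rfl
  have hFm : MeasurableSet (e ⁻¹' (E \ Z)) := e.measurable (hE.meas.diff hZm)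
  have hmeas : curveArea ι A (e ⁻¹' (E \ Z)) = 2 * eta E := by
    rw [curveArea_eq h, Measure.smul_apply, smul_eq_mul,
      Measure.map_apply e.symm.measurable hFm, ← Set.preimage_comp, MeasurableEquiv.self_comp_symm,
      Set.preimage_id, measure_sdiff_null hZ0]
  rw [← hmeas]
  refine quotientMeasure_univ _ _ hFm ?_
    (fun M : stab σ 𝔞 A => (e.trans (slEquiv (sl M))).trans e.symm) (fun M => ?_) (fun M x => ?_) ?_
  · intro x hx y hy hxy
    obtain ⟨M, hM, hMx⟩ : ∃ M ∈ Gam 𝔞, act ι σ M x = (y : ℍ × ℍ) := Quotient.exact hxy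
    have hMA : M ∈ stab σ 𝔞 A := by
      refine ⟨hM, ?_⟩
      by_contra! hcon
      refine hy.2 (Set.mem_iUnion.2 ⟨⟨⟨vact σ M A, vact_mem_Lm hK hσ hA hM⟩, hcon⟩, ?_⟩)
      have h1 : lin ι (vact σ M A) y = 0 := by
        rw [← hMx, lin_vact_eq_zero_iff]; exact x.2
      have h2 : (moeb ι A h • e y, e y) = (y : ℍ × ℍ) :=
        Prod.ext ((lin_eq_zero_iff h _).1 y.2).symm rfl
      change lin ι (vact σ M A) (moeb ι A h • e y, e y) = 0
      rw [h2, h1]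
    have h3 : sl M • e x = e y := congrArg Prod.snd hMx
    have h4 := hE.inj (e x) hx.1 M hMA (by change sl M • e x ∈ E; rw [h3]; exact hy.1)
    exact e.injective (h4.symm.trans h3)
  · rw [curveArea_eq h]
    refine MeasurePreserving.smul_measure ?_ 2
    have h1 : MeasurePreserving e.symm eta (eta.map e.symm) := ⟨e.symm.measurable, rfl⟩
    have h2 : MeasurePreserving e (eta.map e.symm) eta := by
      refine ⟨e.measurable, by rw [MeasurableEquiv.map_map_symm]⟩
    exact h1.comp ((measurePreserving_sl (sl M)).comp h2)
  · refine Setoid.symm' _ ⟨M, M.2.1, ?_⟩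
    exact hact M M.2 x
  · rw [curveArea_eq h]
    refine Measure.ae_smul_measure ?_ 2
    -- The translates of Z under the countable stabilizer are null, so almost every orbit avoids Z
    -- altogether.
    have hbad : ∀ᵐ w ∂eta, ∀ M : stab σ 𝔞 A, sl M • w ∉ Z := by
      rw [ae_all_iff]
      intro M
      exact measure_eq_zero_iff_ae_notMem.1
        ((measurePreserving_sl (sl M)).quasiMeasurePreserving.preimage_null hZ0)
    have hq : Measure.QuasiMeasurePreserving e (eta.map e.symm) eta :=
      ⟨e.measurable, by rw [MeasurableEquiv.map_map_symm]⟩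
    filter_upwards [hq.ae hbad] with x hx
    obtain ⟨M, hM, hMx⟩ := hE.cov (e x)
    exact ⟨⟨M, hM⟩, hMx, hx ⟨M, hM⟩⟩

theorem areaT_eq (hK : Module.finrank ℚ K = 2) (hσ : σ ≠ AlgEquiv.refl) (hm : 0 < m) :
    areaT ι σ 𝔞 m = 2 * volT ι σ 𝔞 m := by
  obtain ⟨d, hd, hdet⟩ := exists_det_pos hK σ ι 𝔞 hm
  rw [areaT, volT, ← ENNReal.tsum_mul_left]
  refine tsum_congr fun c => ?_
  have h : 0 < ι (c.out : Matrix (Fin 2) (Fin 2) K).det := by rw [hdet _ c.out.2]; exact hd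
  obtain ⟨E, hE⟩ := exists_isStabTransversal (𝔞 := 𝔞) hK hσ h
  rw [quotientMeasure_curveArea hK hσ hm h c.out.2 hE, hE.quotientMeasure_univ]

/-! ### The integral of the series -/

theorem integral_one_add_cpow {s : ℂ} (hs : 1 < s.re) :
    ∫ t in Set.Ioi (0 : ℝ), ((1 + t : ℝ) : ℂ) ^ (-s) = 1 / (s - 1) := by
  have h := integral_Ioi_cpow_of_lt (a := -s) (by simpa using hs) one_pos
  have hs1 : s - 1 ≠ 0 := by
    intro h0
    have := congrArg Complex.re h0
    simp at this; linarith
  have hs2 : -s + 1 ≠ 0 := by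
    intro h0; apply hs1; linear_combination -h0
  have hshift := (measurePreserving_add_left volume (1 : ℝ)).setIntegral_preimage_emb
    (measurableEmbedding_addLeft (1 : ℝ)) (fun t : ℝ => (t : ℂ) ^ (-s)) (Set.Ioi 1)
  rw [Set.preimage_const_add_Ioi, sub_self] at hshift
  rw [hshift, h, Complex.ofReal_one, Complex.one_cpow]
  field_simp
  ring

theorem Psi_act (hK : Module.finrank ℚ K = 2) (hσ : σ ≠ AlgEquiv.refl) (s : ℂ) {M : SL(2, K)}
    (hM : M ∈ Gam 𝔞) (z : ℍ × ℍ) : Psi ι σ 𝔞 m s (act ι σ M z) = Psi ι σ 𝔞 m s z := by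
  rw [Psi, Psi, ← (vactEquiv hK hσ 𝔞 m hM).tsum_eq]
  refine tsum_congr fun A => ?_
  change psiTerm ι s (vact σ M A) _ = _
  rw [psiTerm, g_vact, psiTerm]

theorem measurable_psiTerm (s : ℂ) : Measurable (psiTerm ι s A) := by
  have := measurable_g (ι := ι) (A := A)
  unfold psiTerm
  fun_prop

/-- The unfolding identity for indicator functions, stated as an equality of measures, so that
complex-valued functions can be integrated against both sides. -/
theorem sum_map_g (hK : Module.finrank ℚ K = 2) (hσ : σ ≠ AlgEquiv.refl) (hm : 0 < m)
    {F : Set (ℍ × ℍ)} (hF : IsTransversal ι σ 𝔞 F) :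
    Measure.sum (fun A : Lm σ 𝔞 m => (omegaSq.restrict F).map (g ι A)) =
      (4 * volT ι σ 𝔞 m) • volume.restrict (Set.Ioi (0 : ℝ)) := by
  have := countable_Lm (σ := σ) (𝔞 := 𝔞) (m := m)
  ext S hS
  have h := lintegral_tsum_g hK hσ hm hF (measurable_one.indicator hS : Measurable
    (S.indicator (1 : ℝ → ENNReal)))
  rw [lintegral_indicator_one hS] at h
  rw [Measure.sum_apply _ hS, Measure.smul_apply, smul_eq_mul, ← h, lintegral_tsum]
  · refine tsum_congr fun A => ?_
    rw [← lintegral_indicator_one hS, lintegral_map (measurable_one.indicator hS) measurable_g]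
  · exact fun A => ((measurable_one.indicator hS).comp measurable_g).aemeasurable

theorem lintegral_norm_psiTerm (hK : Module.finrank ℚ K = 2) (hσ : σ ≠ AlgEquiv.refl) (hm : 0 < m)
    {F : Set (ℍ × ℍ)} (hF : IsTransversal ι σ 𝔞 F) {s : ℂ} (hs : 1 < s.re) :
    ∫⁻ x in F, ∑' A : Lm σ 𝔞 m, ‖psiTerm ι s A x‖ₑ ∂omegaSq ≠ ⊤ := by
  obtain ⟨d, hd, hdet⟩ := exists_det_pos hK σ ι 𝔞 hm
  have h := lintegral_tsum_g hK hσ hm hF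
    (by fun_prop : Measurable fun t : ℝ => ENNReal.ofReal ((1 + t) ^ (-s.re)))
  have e : ∀ (A : Lm σ 𝔞 m) (x : ℍ × ℍ), ‖psiTerm ι s A x‖ₑ =
      ENNReal.ofReal ((1 + g ι A x) ^ (-s.re)) := by
    intro A x
    rw [← ofReal_norm, norm_psiTerm (by rw [hdet A A.2]; exact hd)]
  simp only [e]
  rw [h]
  exact ENNReal.mul_ne_top (ENNReal.mul_ne_top (by norm_num) (volT_ne_top hK hσ hm))
    (lintegral_one_add_rpow_ne_top hs)

theorem integrableOn_one_add_cpow {s : ℂ} (hs : 1 < s.re) :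
    IntegrableOn (fun t : ℝ => ((1 + t : ℝ) : ℂ) ^ (-s)) (Set.Ioi 0) := by
  have hm : Measurable fun t : ℝ => ((1 + t : ℝ) : ℂ) ^ (-s) := by fun_prop
  refine ⟨hm.aestronglyMeasurable, ?_⟩
  rw [hasFiniteIntegral_iff_enorm]
  refine lt_of_le_of_lt (le_of_eq ?_) (lintegral_one_add_rpow_ne_top hs).lt_top
  refine setLIntegral_congr_fun measurableSet_Ioi fun t ht => ?_
  have ht' : (0 : ℝ) < t := ht
  rw [← ofReal_norm, Complex.norm_cpow_eq_rpow_re_of_pos (by linarith), Complex.neg_re]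

/-- Absolute convergence allows termwise integration; each term is an integral against the image of
ω² under g, and `sum_map_g` adds these images up. -/
theorem integral_Psi (hK : Module.finrank ℚ K = 2) (hσ : σ ≠ AlgEquiv.refl) (hm : 0 < m)
    {F : Set (ℍ × ℍ)} (hF : IsTransversal ι σ 𝔞 F) {s : ℂ} (hs : 1 < s.re) :
    ∫ x in F, Psi ι σ 𝔞 m s x ∂omegaSq = 4 / (s - 1) * ((volT ι σ 𝔞 m).toReal : ℂ) := by
  have := countable_Lm (σ := σ) (𝔞 := 𝔞) (m := m)
  have hmeas : Measurable fun t : ℝ => ((1 + t : ℝ) : ℂ) ^ (-s) := by fun_prop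
  have hsum := sum_map_g hK hσ hm hF
  have hint : Integrable (fun t : ℝ => ((1 + t : ℝ) : ℂ) ^ (-s))
      (Measure.sum (fun A : Lm σ 𝔞 m => (omegaSq.restrict F).map (g ι A))) := by
    rw [hsum]
    exact (integrableOn_one_add_cpow hs).smul_measure
      (ENNReal.mul_ne_top (by norm_num) (volT_ne_top hK hσ hm))
  have h1 := integral_sum_measure hint
  rw [hsum, integral_smul_measure, integral_one_add_cpow hs] at h1
  have h2 : ∫ x in F, Psi ι σ 𝔞 m s x ∂omegaSq = ∑' A : Lm σ 𝔞 m,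
      ∫ x in F, psiTerm ι s A x ∂omegaSq := by
    refine integral_tsum (fun A => (measurable_psiTerm s).aestronglyMeasurable) ?_
    rw [← lintegral_tsum fun A => (measurable_psiTerm s).enorm.aemeasurable]
    exact lintegral_norm_psiTerm hK hσ hm hF hs
  have h3 : ∀ A : Lm σ 𝔞 m, ∫ x in F, psiTerm ι s A x ∂omegaSq =
      ∫ t, ((1 + t : ℝ) : ℂ) ^ (-s) ∂((omegaSq.restrict F).map (g ι A)) := fun A =>
    (integral_map measurable_g.aemeasurable hmeas.aestronglyMeasurable).symm
  rw [h2, tsum_congr h3, ← h1, ENNReal.toReal_mul, Complex.real_smul]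
  push_cast
  simp
  ring

theorem measurable_Psi (hK : Module.finrank ℚ K = 2) (hσ : σ ≠ AlgEquiv.refl) (hm : 0 < m)
    {s : ℂ} (hs : 1 < s.re) : Measurable (Psi ι σ 𝔞 m s) := by
  refine Continuous.measurable (continuous_iff_continuousAt.2 fun z => ?_)
  have h := (contDiffAt_Psi (ι := ι) (σ := σ) (𝔞 := 𝔞) hK hσ hm hs z).continuousAt
  have h' := ContinuousAt.comp (f := fun z : ℍ × ℍ => ((z.1 : ℂ), (z.2 : ℂ))) h
    (by fun_prop)
  simpa [Function.comp_def] using h'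

theorem integrableOn_Psi (hK : Module.finrank ℚ K = 2) (hσ : σ ≠ AlgEquiv.refl) (hm : 0 < m)
    {F : Set (ℍ × ℍ)} (hF : IsTransversal ι σ 𝔞 F) {s : ℂ} (hs : 1 < s.re) :
    IntegrableOn (Psi ι σ 𝔞 m s) F omegaSq := by
  refine ⟨(measurable_Psi hK hσ hm hs).aestronglyMeasurable, ?_⟩
  rw [hasFiniteIntegral_iff_enorm]
  exact (lintegral_mono fun x => enorm_tsum_le_tsum_enorm).trans_lt
    (lintegral_norm_psiTerm hK hσ hm hF hs).lt_top

end

end HilbertModular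

end


/-! ### Descent to the quotient and conclusion -/

open HilbertModular
theorem theorem5p3 {K : Type*} [Field K] [NumberField K] (hK : Module.finrank ℚ K = 2)
    (ι : K →+* ℝ) (σ : K ≃ₐ[ℚ] K) (hσ : σ ≠ AlgEquiv.refl)
    (𝔞 : (FractionalIdeal (𝓞 K)⁰ K)ˣ) (m : ℕ) (hm : 0 < m) (s : ℂ) (hs : 1 < s.re) :
    (∀ z : ℍ × ℍ, Summable fun A : Lm σ 𝔞 m => psiTerm ι s A z) ∧
    ContDiffOn ℝ ∞
      (fun z : ℂ × ℂ => Psi ι σ 𝔞 m s (UpperHalfPlane.ofComplex z.1, UpperHalfPlane.ofComplex z.2))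
      {z : ℂ × ℂ | 0 < z.1.im ∧ 0 < z.2.im} ∧
    volT ι σ 𝔞 m ≠ ⊤ ∧
    areaT ι σ 𝔞 m = 2 * volT ι σ 𝔞 m ∧
    ∃ f : X ι σ 𝔞 → ℂ,
      (∀ z : ℍ × ℍ, f (Quotient.mk (orbitSetoid ι σ 𝔞) z) = Psi ι σ 𝔞 m s z) ∧
      Integrable f (quotientMeasure (orbitSetoid ι σ 𝔞) omegaSq) ∧
      ∫ x, f x ∂(quotientMeasure (orbitSetoid ι σ 𝔞) omegaSq) =
        4 / (s - 1) * ((volT ι σ 𝔞 m).toReal : ℂ) := by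
  refine ⟨fun z => (summable_norm_psiTerm hK hσ hm hs z).of_norm, contDiffOn_Psi hK hσ hm hs,
    volT_ne_top hK hσ hm, areaT_eq hK hσ hm, ?_⟩
  obtain ⟨F, hF⟩ := exists_isTransversal (ι := ι) (𝔞 := 𝔞) hK hσ
  set f : X ι σ 𝔞 → ℂ := Quotient.lift (Psi ι σ 𝔞 m s) (by
    rintro z w ⟨M, hM, rfl⟩
    exact (Psi_act hK hσ s hM z).symm) with hf
  have hmk : Measurable (Quotient.mk (orbitSetoid ι σ 𝔞)) := measurable_quotient_mk''
  have hfm : Measurable f := measurable_from_quotient.2 (measurable_Psi hK hσ hm hs)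
  refine ⟨f, fun z => rfl, ?_, ?_⟩
  · rw [hF.quotientMeasure_eq]
    exact (integrable_map_measure hfm.aestronglyMeasurable hmk.aemeasurable).2
      (integrableOn_Psi hK hσ hm hF hs)
  · rw [hF.quotientMeasure_eq, integral_map hmk.aemeasurable hfm.aestronglyMeasurable]
    exact integral_Psi hK hσ hm hF hs
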